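/- \textbf{Model.} Let $p$ and $\theta_0=(\alpha_0,\beta_0')'\in\mathbb R^{p+1}$ be fixed. For each $n$ let $(y_i,x_i)=(y_{ni},x_{ni})$, $i=1,\dots,n$, be independent (not necessarily identically distributed), with $x_i=(1,\tilde x_i')'\in\mathbb R^{p+1}$ and conditional density of $y_i$ given $x_i$ equal to $f(y\mid x_i)=\exp(y\,x_i'\theta_0-a(x_i'\theta_0))c(y)$ on a sample space $\mathcal Y\subset\mathbb R$ (with respect to a fixed $\sigma$-finite measure; $y\mapsto\exp(yt-a(t))c(y)$ is a density for every $t\in\mathbb R$). Let $w_i=w_{ni}>0$ be non-random weights. Put $g(y,t)=a(t)-yt-\log c(y)$, $\dot g=\partial_t g$, $\ddot g=\partial_t^2 g$, and $$L(\theta)=-\frac1n\sum_i w_i g(y_i,x_i'\theta),\quad S(\theta)=-\frac1n\sum_i w_ix_i\dot g(y_i,x_i'\theta),$$ $$\hat H(\theta)=\frac1n\sum_i w_ix_ix_i'\ddot g(y_i,x_i'\theta),\quad \hat I(\theta)=\frac1n\sum_i w_i^2x_ix_i'\dot g(y_i,x_i'\theta)^2,$$ $H(\theta_0)=\mathrm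 E\hat H(\theta_0)$, $I(\theta_0)=\mathrm E\hat I(\theta_0)$, and $X=(x_1,\dots,x_n)'$. \textbf{Assumptions.} There are positive constants $C_l,C_u,\lambda_l,\lambda_u,L_0,\eta$, independent of $n$, such that for all large $n$: (a) $\|x_i\|_{\psi_2}<C_u$ and, a.s., $\|x_i\|_\infty<C_u$ and $\|X\theta_0\|_\infty<C_u$; $C_l<w_i<C_u$. Here $\|Z\|_{\psi_2}=\sup_{m\ge1}m^{-1/2}(\mathrm E|Z|^m)^{1/m}$ for scalars and $\|x\|_{\psi_2}=\sup_{\|b\|=1}\|x'b\|_{\psi_2}$ for vectors. (b) The eigenvalues of $H(\theta_0)$, $I(\theta_0)$ and $\mathrm E[n^{-1}X'X]$ lie in $[\lambda_l,\lambda_u]$. (c) $g(y,\cdot)$ is convex and twice differentiable on $\mathbb R$ for every $y$. There is a positive definite matrix $H$ with $\lambda_{\min}(H)>\lambda_l$ such that $n^{-1}\sum_i\mathrm E[w_i(g(y_i,x_i'\theta)-g(y_i,x_i'\theta_0))]\ge\|H^{1/2}(\theta-\theta_0)\|^2$ for every $\theta$ with $\|X(\theta-\theta_0)\|_\infty<\eta$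 a.s. Almost surely, for all $i$, with $t_0=x_i'\theta_0$, all $y\in\mathcal Y$ and all $t,\tilde t\in[t_0-\eta,t_0+\eta]$: $|\ddot g(y,t)-\ddot g(y,\tilde t)|\le L_0|t-\tilde t|$, $|\dot g(y,t_0)|\le C_u$ and $|\ddot g(y,t)|\le C_u$. Moreover, $H(\theta_0)$ and $I(\theta_0)$ converge, as $n\to\infty$, to nonsingular matrices, and $\lambda=\lambda_n=C_nn^{-1/2}$ with $C_n$ bounded and bounded away from $0$. \textbf{Selection.} Let $\hat\theta=(\hat\alpha,\hat\beta')'$ be a (measurable) minimizer of $-L(\theta)+\lambda\|\beta\|_1$ (almost surely a minimizer whenever one exists, and arbitrary otherwise). Let $\hat M\subseteq\{1,\dots,p+1\}$ consist of the intercept and the indices of the nonzero elements of $\hat\beta$, and $\hat{\mathtt s}_{\hat M}=\operatorname{sign}(\hat\beta_{\hat M})$. \textbf{Interval.} On $\{\hat M=M,\hat{\mathtt s}_{\hat M}=\mathtt s\}$ let blocks be indexed by $M$ and its complement $-M$, evaluate all quantities at $\hat\theta$, and let $J=[0,I_{|M|-1}]$ (which drops the intercept), $\sigma=(0,\mathtt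 s')'$, $$\tilde\beta_M=\hat\beta_M+J\hat H_M^{-1}S_M,\quad \tilde S_{-M}=S_{-M}-\hat H_{-MM}\hat H_M^{-1}S_M,\quad Z=n^{1/2}\begin{bmatrix}\tilde\beta_M\\ \tilde S_{-M}\end{bmatrix}\in\mathbb R^p,$$ $$A=\begin{bmatrix}-\mathrm{diag}(\mathtt s)&0\\0&I\\0&-I\end{bmatrix},\quad b=n^{1/2}\begin{bmatrix}-\mathrm{diag}(\mathtt s)J\hat H_M^{-1}\lambda\sigma\\ \lambda(\mathbf 1-\hat H_{-MM}\hat H_M^{-1}\sigma)\\ \lambda(\mathbf 1+\hat H_{-MM}\hat H_M^{-1}\sigma)\end{bmatrix},\quad \hat\Sigma=\begin{bmatrix}\hat\Sigma_{\beta\beta}&\hat\Sigma_{\beta s}\\ \hat\Sigma_{\beta s}'&\hat\Sigma_{ss}\end{bmatrix},$$ where $\hat\Sigma_{\beta\beta}=J\hat H_M^{-1}\hat I_M\hat H_M^{-1}J'$, $\hat\Sigma_{\beta s}=J[\hat H_M^{-1}\hat I_{M(-M)}-\hat H_M^{-1}\hat I_M\hat H_M^{-1}\hat H_{M(-M)}]$,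 and, with $K=[I,-\hat H_{-MM}\hat H_M^{-1}]$, $\hat\Sigma_{ss}=K\begin{bmatrix}\hat I_{-M}&\hat I_{-MM}\\ \hat I_{M(-M)}&\hat I_M\end{bmatrix}K'$. (The first block of rows of $A,b$ expresses the active and the other two the inactive Karush--Kuhn--Tucker constraints.) For $j=1,\dots,|M|-1$ let $e_j$ be the $j$-th unit vector of $\mathbb R^p$, $\kappa=\hat\Sigma e_j(e_j'\hat\Sigma e_j)^{-1}$, $r=(I_p-\kappa e_j')Z$, $$\mathcal V^-=\max_{l:(A\kappa)_l<0}\frac{b_l-(Ar)_l}{(A\kappa)_l},\qquad \mathcal V^+=\min_{l:(A\kappa)_l>0}\frac{b_l-(Ar)_l}{(A\kappa)_l}$$ (with $\max\emptyset=-\infty$, $\min\emptyset=\infty$), and let $F(x;\mu,\sigma^2,l,u)=\frac{\Phi((x-\mu)/\sigma)-\Phi((l-\mu)/\sigma)}{\Phi((u-\mu)/\sigma)-\Phi((l-\mu)/\sigma)}$ be the truncated Gaussian distribution function. For $\zeta\in(0,1)$ put $\mathrm{CI}_{\hat Mj}=[\tilde q_l,\tilde q_u]$, where $q=\tilde q_l$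 and $q=\tilde q_u$ solve $$F(e_j'Z;\,n^{1/2}q,\,e_j'\hat\Sigma e_j,\,\mathcal V^-,\mathcal V^+)=1-\zeta/2\quad\text{and}\quad=\zeta/2,$$ respectively. \textbf{Claim.} Let $M$ contain the intercept and every index of a nonzero element of $\theta_0$, and let $\mathtt s\in\{-1,1\}^{|M|-1}$ agree with $\operatorname{sign}(\beta_{M0})$ at every nonzero element of $\beta_{M0}$ (in particular, $M$ may be the intercept and the support of $\beta_0$, with $\mathtt s=\operatorname{sign}(\beta_{M0})$). Then, for every $j=1,\dots,|M|-1$ and every $\zeta\in(0,1)$, $$\liminf_{n\to\infty}P\big[e_j'\beta_{\hat M0}\in\mathrm{CI}_{\hat Mj}\,\big|\,\hat M=M,\ \hat{\mathtt s}_{\hat M}=\mathtt s\big]=1-\zeta .$$ -/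

import Mathlib

open Filter Topology MeasureTheory ProbabilityTheory
open scoped ENNReal Matrix

noncomputable section

namespace SurveyLasso

/-! ### Generalized linear model -/

/-- `(a, c)` define a one-parameter exponential family with sample space `Y`, dominated by `ν`:
for every real `t`, the function `v ↦ exp (v t - a t) c v` is a probability density. -/
structure IsGLM (ν : Measure ℝ) (Y : Set ℝ) (a c : ℝ → ℝ) : Prop where
  measurable_c : Measurable c
  ae_mem : ∀ᵐ v ∂ν, v ∈ Y
  pos : ∀ v ∈ Y, 0 < c v
  density : ∀ t : ℝ, ∫⁻ v, ENNReal.ofReal (Real.exp (v * t - a t) * c v) ∂ν = 1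

/-- The conditional density of `y` given `x` is `v ↦ exp (v x'θ - a (x'θ)) c v`. -/
def HasGLMDensity {Ω : Type*} [MeasurableSpace Ω] {d : ℕ} (P : Measure Ω) (ν : Measure ℝ)
    (a c : ℝ → ℝ) (θ : Fin d → ℝ) (x : Ω → Fin d → ℝ) (y : Ω → ℝ) : Prop :=
  ∀ (s : Set (Fin d → ℝ)) (B : Set ℝ), MeasurableSet s → MeasurableSet B →
    P (x ⁻¹' s ∩ y ⁻¹' B) =
      ∫⁻ ω in x ⁻¹' s,
        (∫⁻ v in B, ENNReal.ofReal (Real.exp (v * (x ω ⬝ᵥ θ) - a (x ω ⬝ᵥ θ)) * c v) ∂ν) ∂P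

/-- The loss `g(y, t) = a(t) - y t - log c(y)`, i.e. minus the log-density. -/
def loss (a c : ℝ → ℝ) (y t : ℝ) : ℝ := a t - y * t - Real.log (c y)

/-- First derivative of the loss in `t`. -/
def loss1 (a c : ℝ → ℝ) (y t : ℝ) : ℝ := deriv (loss a c y) t

/-- Second derivative of the loss in `t`. -/
def loss2 (a c : ℝ → ℝ) (y t : ℝ) : ℝ := deriv (deriv (loss a c y)) t

/-! ### Weighted likelihood and Lasso -/

/-- A realized weighted sample of size `n`, with `p + 1` regressors. -/
structure Sample (n p : ℕ) where
  y : Fin n → ℝ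
  x : Fin n → Fin (p + 1) → ℝ
  w : Fin n → ℝ

section Likelihood

variable {n p : ℕ} (a c : ℝ → ℝ) (D : Sample n p)

/-- Weighted log-likelihood `L(θ)`. -/
def logLik (θ : Fin (p + 1) → ℝ) : ℝ :=
  -((n : ℝ)⁻¹ * ∑ i, D.w i * loss a c (D.y i) (D.x i ⬝ᵥ θ))

/-- Score `S(θ)`. -/
def score (θ : Fin (p + 1) → ℝ) : Fin (p + 1) → ℝ := fun k =>
  -((n : ℝ)⁻¹ * ∑ i, D.w i * D.x i k * loss1 a c (D.y i) (D.x i ⬝ᵥ θ))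

/-- Sample information matrix. -/
def info (θ : Fin (p + 1) → ℝ) : Matrix (Fin (p + 1)) (Fin (p + 1)) ℝ := Matrix.of fun k l =>
  (n : ℝ)⁻¹ * ∑ i, D.w i ^ 2 * (D.x i k * D.x i l) * loss1 a c (D.y i) (D.x i ⬝ᵥ θ) ^ 2

/-- Negative Hessian matrix. -/
def hess (θ : Fin (p + 1) → ℝ) : Matrix (Fin (p + 1)) (Fin (p + 1)) ℝ := Matrix.of fun k l =>
  (n : ℝ)⁻¹ * ∑ i, D.w i * (D.x i k * D.x i l) * loss2 a c (D.y i) (D.x i ⬝ᵥ θ)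

/-- Gram matrix `n⁻¹ X'X`. -/
def gram : Matrix (Fin (p + 1)) (Fin (p + 1)) ℝ := Matrix.of fun k l =>
  (n : ℝ)⁻¹ * ∑ i, D.x i k * D.x i l

/-- Lasso criterion; the intercept (coordinate `0`) is not penalized. -/
def lassoObj (lam : ℝ) (θ : Fin (p + 1) → ℝ) : ℝ :=
  -logLik a c D θ + lam * ∑ k : Fin p, |θ k.succ|

/-- `θ` solves the Lasso problem. -/
def IsLasso (lam : ℝ) (θ : Fin (p + 1) → ℝ) : Prop :=
  ∀ θ' : Fin (p + 1) → ℝ, lassoObj a c D lam θ ≤ lassoObj a c D lam θ'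

end Likelihood

/-- The selected model: the intercept and the regressors with nonzero coefficients. -/
def activeSet {p : ℕ} (θ : Fin (p + 1) → ℝ) : Finset (Fin (p + 1)) :=
  Finset.univ.filter fun k => k = 0 ∨ θ k ≠ 0

/-! ### Truncated Gaussian distribution and polyhedral truncation limits -/

/-- `Φ((t - μ)/σ)`, extended by `0` and `1` to `t = -∞` and `t = ∞`. -/
def gaussCDF (μ σ : ℝ) : EReal → ℝ
  | ⊥ => 0
  | ⊤ => 1
  | (t : ℝ) => cdf (gaussianReal 0 1) ((t - μ) / σ)

/-- `F(x; μ, σ², l, u)`: distribution function of `N(μ, σ²)` truncated to `[l, u]`. -/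
def truncCDF (x μ σsq : ℝ) (l u : EReal) : ℝ :=
  (gaussCDF μ (Real.sqrt σsq) (x : EReal) - gaussCDF μ (Real.sqrt σsq) l) /
    (gaussCDF μ (Real.sqrt σsq) u - gaussCDF μ (Real.sqrt σsq) l)

section Polyhedral

variable {ι κ : Type*} [Fintype ι] [DecidableEq ι]

/-- `c = Σ η (η'Σ η)⁻¹`. -/
def polyC (Sig : Matrix ι ι ℝ) (η : ι → ℝ) : ι → ℝ := (η ⬝ᵥ (Sig *ᵥ η))⁻¹ • (Sig *ᵥ η)

/-- `r = (I - c η') Z`. -/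
def polyR (Sig : Matrix ι ι ℝ) (η Z : ι → ℝ) : ι → ℝ :=
  (1 - Matrix.vecMulVec (polyC Sig η) η) *ᵥ Z

/-- Lower truncation limit `𝒱⁻` (`-∞` if no constraint is binding from below). -/
def vMinus (A : Matrix κ ι ℝ) (b : κ → ℝ) (cv r : ι → ℝ) : EReal :=
  ⨆ i : κ, ⨆ _ : (A *ᵥ cv) i < 0, (((b i - (A *ᵥ r) i) / (A *ᵥ cv) i : ℝ) : EReal)

/-- Upper truncation limit `𝒱⁺` (`∞` if no constraint is binding from above). -/
def vPlus (A : Matrix κ ι ℝ) (b : κ → ℝ) (cv r : ι → ℝ) : EReal :=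
  ⨅ i : κ, ⨅ _ : 0 < (A *ᵥ cv) i, (((b i - (A *ᵥ r) i) / (A *ᵥ cv) i : ℝ) : EReal)

end Polyhedral

/-! ### Selective inference -/

/-- Coordinates in the model `M`. -/
abbrev Act {p : ℕ} (M : Finset (Fin (p + 1))) : Type := {k : Fin (p + 1) // k ∈ M}

/-- Slope coordinates in the model `M`. -/
abbrev Slope {p : ℕ} (M : Finset (Fin (p + 1))) : Type := {k : Fin (p + 1) // k ∈ M ∧ k ≠ 0}

/-- Coordinates outside the model `M`. -/
abbrev Inact {p : ℕ} (M : Finset (Fin (p + 1))) : Type := {k : Fin (p + 1) // k ∉ M}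

section Selective

variable {n p : ℕ} (a c : ℝ → ℝ) (D : Sample n p) (lam : ℝ) (θ : Fin (p + 1) → ℝ)
  (M : Finset (Fin (p + 1))) (s : Slope M → ℝ)

/-- Block `Ĥ_M`. -/
def hessMM : Matrix (Act M) (Act M) ℝ := (hess a c D θ).submatrix Subtype.val Subtype.val

/-- Block `Ĥ_{-M M}`. -/
def hessNM : Matrix (Inact M) (Act M) ℝ := (hess a c D θ).submatrix Subtype.val Subtype.val

/-- Block `Ĥ_{M (-M)}`. -/
def hessMN : Matrix (Act M) (Inact M) ℝ := (hess a c D θ).submatrix Subtype.val Subtype.val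

/-- Block `Î_M`. -/
def infoMM : Matrix (Act M) (Act M) ℝ := (info a c D θ).submatrix Subtype.val Subtype.val

/-- Block `Î_{M (-M)}`. -/
def infoMN : Matrix (Act M) (Inact M) ℝ := (info a c D θ).submatrix Subtype.val Subtype.val

/-- Block `Î_{-M M}`. -/
def infoNM : Matrix (Inact M) (Act M) ℝ := (info a c D θ).submatrix Subtype.val Subtype.val

/-- Block `Î_{-M}`. -/
def infoNN : Matrix (Inact M) (Inact M) ℝ := (info a c D θ).submatrix Subtype.val Subtype.val

/-- `S_M`. -/
def scoreM : Act M → ℝ := fun k => score a c D θ k.1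

/-- `S_{-M}`. -/
def scoreN : Inact M → ℝ := fun k => score a c D θ k.1

/-- The matrix `[0, I]` which drops the intercept. -/
def dropIntercept : Matrix (Slope M) (Act M) ℝ := Matrix.of fun k l => if k.1 = l.1 then 1 else 0

/-- The vector `(0, s_M')'`. -/
def padSign : Act M → ℝ := fun k => if h : k.1 = 0 then 0 else s ⟨k.1, k.2, h⟩

/-- One-step estimator `β̃_M`. -/
def oneStep : Slope M → ℝ := fun k =>
  θ k.1 + (dropIntercept M *ᵥ ((hessMM a c D θ M)⁻¹ *ᵥ scoreM a c D θ M)) k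

/-- Orthogonalized inactive score `S̃_{-M}`. -/
def scoreTilde : Inact M → ℝ :=
  scoreN a c D θ M - hessNM a c D θ M *ᵥ ((hessMM a c D θ M)⁻¹ *ᵥ scoreM a c D θ M)

/-- `Z = n^{1/2} (β̃_M', S̃_{-M}')'`. -/
def Zvec : Slope M ⊕ Inact M → ℝ :=
  Real.sqrt n • Sum.elim (oneStep a c D θ M) (scoreTilde a c D θ M)

/-- Constraint matrix `A`: active sign constraints, then the inactive ones. -/
def Amat : Matrix (Slope M ⊕ (Inact M ⊕ Inact M)) (Slope M ⊕ Inact M) ℝ :=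
  Matrix.fromBlocks (-Matrix.diagonal s) 0 0 (Matrix.fromRows 1 (-1))

/-- Constraint bound `b`. -/
def bvec : Slope M ⊕ (Inact M ⊕ Inact M) → ℝ :=
  let h : Inact M → ℝ := hessNM a c D θ M *ᵥ ((hessMM a c D θ M)⁻¹ *ᵥ padSign M s)
  Real.sqrt n • Sum.elim
    (-(Matrix.diagonal s *ᵥ
      (dropIntercept M *ᵥ ((hessMM a c D θ M)⁻¹ *ᵥ (lam • padSign M s)))))
    (Sum.elim (lam • (1 - h)) (lam • (1 + h)))

/-- Estimated asymptotic covariance matrix `Σ̂`. -/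
def sigmaHat : Matrix (Slope M ⊕ Inact M) (Slope M ⊕ Inact M) ℝ :=
  let Hi := (hessMM a c D θ M)⁻¹
  let E := dropIntercept M
  let K : Matrix (Inact M) (Inact M ⊕ Act M) ℝ := Matrix.fromCols 1 (-(hessNM a c D θ M * Hi))
  let Sbb := E * Hi * infoMM a c D θ M * Hi * Eᵀ
  let Sbs := E * (Hi * infoMN a c D θ M - Hi * infoMM a c D θ M * Hi * hessMN a c D θ M)
  let Sss := K * Matrix.fromBlocks (infoNN a c D θ M) (infoNM a c D θ M)
    (infoMN a c D θ M) (infoMM a c D θ M) * Kᵀ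
  Matrix.fromBlocks Sbb Sbs Sbsᵀ Sss

/-- The truncated Gaussian pivot `F(e_j'Z; n^{1/2} q, e_j'Σ̂ e_j, 𝒱⁻(r), 𝒱⁺(r))`
as a function of the candidate value `q` of the `j`-th selected coefficient. -/
def pivot (j : Slope M) (q : ℝ) : ℝ :=
  let Z := Zvec a c D θ M
  let Sig := sigmaHat a c D θ M
  let η : Slope M ⊕ Inact M → ℝ := Pi.single (Sum.inl j) 1
  let A := Amat M s
  let b := bvec a c D lam θ M s
  truncCDF (η ⬝ᵥ Z) (Real.sqrt n * q) (η ⬝ᵥ (Sig *ᵥ η))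
    (vMinus A b (polyC Sig η) (polyR Sig η Z)) (vPlus A b (polyC Sig η) (polyR Sig η Z))

/-- The interval `[q_l, q_u]` whose end points solve `pivot = 1 - ζ/2` and `pivot = ζ/2`
(the pivot is decreasing in `q`), for a model `M` with signs `s`. -/
def modelCI (ζ : ℝ) (j : Slope M) : Set ℝ :=
  {q | ∃ ql qu : ℝ, pivot a c D lam θ M s j ql = 1 - ζ / 2 ∧
    pivot a c D lam θ M s j qu = ζ / 2 ∧ q ∈ Set.Icc ql qu}

/-- The selective-inference interval computed from the Lasso solution `θ`: the model and the signs
are those selected by `θ`. It is only meaningful for selected slopes `k`. -/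
def selectiveCI (ζ : ℝ) (k : Fin (p + 1)) : Set ℝ :=
  {q | ∃ hk : k ∈ activeSet θ ∧ k ≠ 0,
    q ∈ modelCI a c D lam θ (activeSet θ) (fun l => Real.sign (θ l.1)) ζ ⟨k, hk⟩}

end Selective

/-! ### Regularity conditions -/

section Assumptions

variable {Ω : Type*} [MeasurableSpace Ω]

/-- Sub-Gaussian norm `sup_{m ≥ 1} m^{-1/2} (E|X|^m)^{1/m}`. -/
def psi2Norm (X : Ω → ℝ) (P : Measure Ω) : ℝ≥0∞ :=
  ⨆ m : ℝ, ⨆ _ : 1 ≤ m,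
    ENNReal.ofReal (m ^ (-(1 / 2) : ℝ)) * eLpNorm X (ENNReal.ofReal m) P

/-- Sub-Gaussian norm of a random vector. -/
def psi2NormVec {d : ℕ} (X : Ω → Fin d → ℝ) (P : Measure Ω) : ℝ≥0∞ :=
  ⨆ v : Fin d → ℝ, ⨆ _ : ∑ k, v k ^ 2 = 1, psi2Norm (fun ω => X ω ⬝ᵥ v) P

/-- Entrywise expectation of a random matrix. -/
def meanMatrix {d : ℕ} (P : Measure Ω) (A : Ω → Matrix (Fin d) (Fin d) ℝ) :
    Matrix (Fin d) (Fin d) ℝ := Matrix.of fun k l => ∫ ω, A ω k l ∂P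

/-- The sample realized at `ω`. -/
def sampleAt {n p : ℕ} (y : Fin n → Ω → ℝ) (x : Fin n → Ω → Fin (p + 1) → ℝ) (w : Fin n → ℝ)
    (ω : Ω) : Sample n p := ⟨fun i => y i ω, fun i => x i ω, w⟩

/-- The regularity conditions at sample size `n`; the constants do not depend on `n`. -/
structure Regular {n p : ℕ} (P : Measure Ω) (Y : Set ℝ) (a c : ℝ → ℝ) (θ₀ : Fin (p + 1) → ℝ)
    (y : Fin n → Ω → ℝ) (x : Fin n → Ω → Fin (p + 1) → ℝ) (w : Fin n → ℝ)
    (Cl Cu lmin lmax L₀ η : ℝ) : Prop where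
  /-- independent, not necessarily identically distributed observations -/
  indep : iIndepFun (fun i ω => (y i ω, x i ω)) P
  psi2 : ∀ i, psi2NormVec (x i) P < ENNReal.ofReal Cu
  x_bdd : ∀ᵐ ω ∂P, ∀ i k, |x i ω k| < Cu
  lin_bdd : ∀ᵐ ω ∂P, ∀ i, |x i ω ⬝ᵥ θ₀| < Cu
  weight : ∀ i, Cl < w i ∧ w i < Cu
  eig_hess : spectrum ℝ (meanMatrix P fun ω => hess a c (sampleAt y x w ω) θ₀) ⊆
    Set.Icc lmin lmax
  eig_info : spectrum ℝ (meanMatrix P fun ω => info a c (sampleAt y x w ω) θ₀) ⊆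
    Set.Icc lmin lmax
  eig_gram : spectrum ℝ (meanMatrix P fun ω => gram (sampleAt y x w ω)) ⊆ Set.Icc lmin lmax
  convex : ∀ v, ConvexOn ℝ Set.univ (loss a c v)
  diff : ∀ v, Differentiable ℝ (loss a c v)
  diff_deriv : ∀ v, Differentiable ℝ (deriv (loss a c v))
  /-- quadratic margin: `‖H^{1/2}(θ - θ₀)‖² = (θ - θ₀)' H (θ - θ₀)` bounds the excess risk -/
  margin : ∃ H : Matrix (Fin (p + 1)) (Fin (p + 1)) ℝ, H.PosDef ∧ (∀ μ ∈ spectrum ℝ H, lmin < μ) ∧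
    ∀ θ : Fin (p + 1) → ℝ, (∀ᵐ ω ∂P, ∀ i, |x i ω ⬝ᵥ (θ - θ₀)| < η) →
      (θ - θ₀) ⬝ᵥ (H *ᵥ (θ - θ₀)) ≤
        (n : ℝ)⁻¹ * ∑ i, ∫ ω, w i *
          (loss a c (y i ω) (x i ω ⬝ᵥ θ) - loss a c (y i ω) (x i ω ⬝ᵥ θ₀)) ∂P
  lip : ∀ᵐ ω ∂P, ∀ i, ∀ t u : ℝ, |t - x i ω ⬝ᵥ θ₀| ≤ η → |u - x i ω ⬝ᵥ θ₀| ≤ η →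
    ∀ v ∈ Y, |loss2 a c v t - loss2 a c v u| ≤ L₀ * |t - u|
  bdd1 : ∀ᵐ ω ∂P, ∀ i, ∀ v ∈ Y, |loss1 a c v (x i ω ⬝ᵥ θ₀)| ≤ Cu
  bdd2 : ∀ᵐ ω ∂P, ∀ i, ∀ t : ℝ, |t - x i ω ⬝ᵥ θ₀| ≤ η → ∀ v ∈ Y, |loss2 a c v t| ≤ Cu

end Assumptions

end SurveyLasso

end

/-!
The proof carries the polyhedral lemma of exact Gaussian selective inference over to the Lasso by
localizing at the rate `n^{-1/2}`.

*Localization.* The score at `θ₀` has mean zero, since the mean of an exponential family is the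
derivative of its cumulant function (`HasGLMDensity.integral_score_eq_zero`). All summands are
uniformly bounded, so `√n S(θ₀)` is asymptotically `N(0, I)`
(`RegularArray.tendstoInDistribution_score`). Convexity and a quadratic lower bound on a small sphere
show that Lasso solutions exist and lie within `O(n^{-1/2})` of `θ₀`, up to small probability
(`exists_isLasso_and_norm_sub_le`, `RegularArray.exists_goodEvent`). With `u = √n (θ̂ - θ₀)` and
`v = √n S(θ̂)`, a Taylor expansion shows that the localized score `Y = v + H u`, with `H` the limit
Hessian, has the same limit `N(0, I)`, while Hessian and information matrix at `θ̂` are consistent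
(`RegularArray.tendstoInDistribution_sampleData`).

*Selection.* The Karush--Kuhn--Tucker conditions say that `v` is a subgradient of the penalty at
`θ₀ + u / √n`. Subgradients are monotone and `H` is positive definite, so `Y` determines `u`
(`IsKKT.unique`). Hence, up to its boundary, the event of selecting `(M, s)` is exactly a polyhedron
in `Y` (`IsKKT.selects`, `Selects.slack_slope_pos`, `Selects.slack_inactive_nonneg`). The slacks of
sign constraints at nonzero entries of `θ₀` grow like `√n`; they are rescaled to converge to
`|θ₀ k|` (`slack`).

*Coverage.* The truncated Gaussian distribution function decreases continuously from one to zero in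
its mean, so that the interval covers if and only if the pivot, the distribution function at the
true coefficient, lies in `[ζ/2, 1 - ζ/2]` (`truncCDF_interval_iff`, `mem_modelCI_iff`). Truncation
limits are discontinuous functions of the data where a constraint does not react to the statistic of
interest, and drift to infinity where slacks do. Written through the relative slopes `slope / slack`
of the constraints the pivot is continuous nevertheless (`slopePivot`, `continuousAt_slopePivot`).

*Limit.* For Gaussian `Y` the pivot is uniform given the polyhedron (`gaussianVec_polyhedral`): the
remainder of `Y` after regression on the statistic of interest is independent of it, and along a line
the claim is the probability integral transform. The polyhedron has positive mass for every `M` and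
`s` compatible with `θ₀` (`gaussianVec_strictRegion_ne_zero`). A portmanteau argument
(`tendsto_measure_of_between`), applied to selection and to selection with coverage along
subsequences with convergent penalty constants, gives the limit `1 - ζ`.
-/

namespace SurveyLasso

/-! ### Truncated Gaussian distribution functions -/

/-- The standard normal distribution function. -/
noncomputable abbrev stdCDF (x : ℝ) : ℝ := cdf (gaussianReal 0 1) x

lemma stdCDF_eq (x : ℝ) : stdCDF x = (gaussianReal 0 1).real (Set.Iic x) := cdf_eq_real _ x

lemma gaussianReal_real_pos {μ : ℝ} {v : NNReal} (hv : v ≠ 0) {A : Set ℝ} {r s : ℝ} (hrs : r < s)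
    (hA : Set.Ioo r s ⊆ A) : 0 < (gaussianReal μ v).real A := by
  refine ENNReal.toReal_pos (fun h => ?_) (measure_ne_top _ _)
  have h1 := gaussianReal_absolutelyContinuous' μ hv (measure_mono_null hA h)
  rw [Real.volume_Ioo] at h1
  simp at h1
  linarith

lemma continuous_stdCDF : Continuous stdCDF := by
  have : NullSingletonClass (gaussianReal 0 1) := nullSingletonClass_gaussianReal one_ne_zero
  have hmono : Monotone stdCDF := monotone_cdf _
  refine continuous_iff_continuousAt.2 fun x => ?_
  have hR : ContinuousWithinAt stdCDF (Set.Ici x) x := (cdf (gaussianReal 0 1)).right_continuous x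
  have hL : ContinuousWithinAt stdCDF (Set.Iio x) x := by
    have h := (cdf (gaussianReal 0 1)).measure_singleton x
    rw [measure_cdf, measure_singleton] at h
    have h' := ENNReal.ofReal_eq_zero.1 h.symm
    have hle := hmono.leftLim_le (le_refl x)
    have heq : Function.leftLim stdCDF x = stdCDF x := le_antisymm hle (by linarith)
    have := hmono.tendsto_leftLim x
    rw [heq] at this
    exact this
  rw [← continuousWithinAt_univ, ← Set.Iio_union_Ici (a := x)]
  exact hL.union hR

lemma strictMono_stdCDF : StrictMono stdCDF := by
  intro x z hxz
  rw [stdCDF_eq, stdCDF_eq, ← sub_pos, ← measureReal_sdiff (Set.Iic_subset_Iic.2 hxz.le)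
    measurableSet_Iic, Set.Iic_sdiff_Iic]
  exact gaussianReal_real_pos one_ne_zero hxz Set.Ioo_subset_Ioc_self

lemma stdCDF_pos (x : ℝ) : 0 < stdCDF x :=
  (cdf_nonneg _ (x - 1)).trans_lt (strictMono_stdCDF (by linarith))

lemma stdCDF_lt_one (x : ℝ) : stdCDF x < 1 :=
  (strictMono_stdCDF (by linarith : x < x + 1)).trans_le (cdf_le_one _ _)

lemma exists_stdCDF_eq {q : ℝ} (h0 : 0 < q) (h1 : q < 1) : ∃ z, stdCDF z = q := by
  obtain ⟨x, hx⟩ := ((tendsto_cdf_atBot (gaussianReal 0 1)).eventually (gt_mem_nhds h0)).exists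
  obtain ⟨z, hz⟩ := ((tendsto_cdf_atTop (gaussianReal 0 1)).eventually (lt_mem_nhds h1)).exists
  obtain ⟨c, hc⟩ := mem_range_of_exists_le_of_exists_ge continuous_stdCDF ⟨x, hx.le⟩ ⟨z, hz.le⟩
  exact ⟨c, hc⟩

/-- `Φ((t - μ)/σ)`, for extended real `t`, is the mass that `N(μ, σ²)` gives to `(-∞, t]`. -/
lemma gaussCDF_eq_real (μ : ℝ) {v : ℝ} (hv : 0 < v) (t : EReal) :
    gaussCDF μ (Real.sqrt v) t =
      (gaussianReal μ v.toNNReal).real {z : ℝ | (z : EReal) ≤ t} := by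
  induction t with
  | bot =>
    change (0 : ℝ) = _
    simp
  | top =>
    change (1 : ℝ) = _
    simp
  | coe t =>
    have hs : 0 < Real.sqrt v := Real.sqrt_pos.2 hv
    have hmap : gaussianReal μ v.toNNReal =
        (gaussianReal 0 1).map (fun z => Real.sqrt v * z + μ) := by
      have : (fun z => Real.sqrt v * z + μ) = (fun z => z + μ) ∘ (fun z => Real.sqrt v * z) := rfl
      rw [this, ← Measure.map_map (by fun_prop) (by fun_prop), gaussianReal_map_const_mul,
        gaussianReal_map_add_const]
      congr 1
      · simp
      · ext; simp [Real.sq_sqrt hv.le, hv.le]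
    have hset : {z : ℝ | (z : EReal) ≤ (t : EReal)} = Set.Iic t := by
      ext z; simp
    rw [hset, hmap, map_measureReal_apply (by fun_prop) measurableSet_Iic]
    change stdCDF _ = _
    rw [stdCDF_eq]
    congr 1
    ext z
    simp only [Set.mem_Iic, Set.mem_preimage]
    rw [le_div_iff₀ hs, mul_comm z]
    constructor <;> intro h <;> linarith

lemma measurableSet_ereal_Ioc (l u : EReal) :
    MeasurableSet {z : ℝ | l < (z : EReal) ∧ (z : EReal) ≤ u} :=
  (measurableSet_Ioc (a := l) (b := u)).preimage measurable_coe_real_ereal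

lemma gaussCDF_sub (μ : ℝ) {v : ℝ} (hv : 0 < v) {l u : EReal} (hlu : l ≤ u) :
    gaussCDF μ (Real.sqrt v) u - gaussCDF μ (Real.sqrt v) l =
      (gaussianReal μ v.toNNReal).real {z : ℝ | l < (z : EReal) ∧ (z : EReal) ≤ u} := by
  have hm : MeasurableSet {z : ℝ | (z : EReal) ≤ l} :=
    (measurableSet_Iic (a := l)).preimage measurable_coe_real_ereal
  have hsub : {z : ℝ | (z : EReal) ≤ l} ⊆ {z : ℝ | (z : EReal) ≤ u} :=
    fun z hz => le_trans hz hlu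
  rw [gaussCDF_eq_real μ hv, gaussCDF_eq_real μ hv, ← measureReal_sdiff hsub hm]
  congr 1
  ext z
  simp only [Set.mem_sdiff, Set.mem_ofPred_eq, not_le]
  exact and_comm

/-- The ratio at `x` of the densities of `N(μ₂, v)` and `N(μ₁, v)`; it increases with `x` when
`μ₁ ≤ μ₂`. -/
noncomputable def likRatio (v μ₁ μ₂ x : ℝ) : ℝ :=
  Real.exp ((μ₂ - μ₁) * (2 * x - μ₁ - μ₂) / (2 * v))

lemma likRatio_pos (v μ₁ μ₂ x : ℝ) : 0 < likRatio v μ₁ μ₂ x := Real.exp_pos _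

lemma gaussianPDFReal_eq_likRatio_mul {v : ℝ} (hv : 0 < v) (μ₁ μ₂ z : ℝ) :
    gaussianPDFReal μ₂ v.toNNReal z =
      likRatio v μ₁ μ₂ z * gaussianPDFReal μ₁ v.toNNReal z := by
  rw [gaussianPDFReal, gaussianPDFReal, likRatio, mul_left_comm, ← Real.exp_add]
  congr 2
  rw [Real.coe_toNNReal v hv.le]
  field_simp
  ring

lemma likRatio_le {v μ₁ μ₂ x z : ℝ} (hv : 0 < v) (hμ : μ₁ ≤ μ₂) (hz : z ≤ x) :
    likRatio v μ₁ μ₂ z ≤ likRatio v μ₁ μ₂ x := by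
  unfold likRatio
  have : 0 ≤ μ₂ - μ₁ := by linarith
  gcongr

lemma gaussianReal_le_likRatio_mul {v μ₁ μ₂ x : ℝ} (hv : 0 < v) (hμ : μ₁ ≤ μ₂) {A : Set ℝ}
    (hAm : MeasurableSet A) (hA : A ⊆ Set.Iic x) :
    (gaussianReal μ₂ v.toNNReal).real A ≤
      likRatio v μ₁ μ₂ x * (gaussianReal μ₁ v.toNNReal).real A := by
  have hv' : v.toNNReal ≠ 0 := by simpa using hv
  rw [measureReal_def, measureReal_def, gaussianReal_apply_eq_integral _ hv',
    gaussianReal_apply_eq_integral _ hv', ENNReal.toReal_ofReal, ENNReal.toReal_ofReal,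
    ← integral_const_mul]
  · refine setIntegral_mono_on (integrable_gaussianPDFReal _ _).integrableOn
      ((integrable_gaussianPDFReal _ _).integrableOn.const_mul _) hAm fun z hz => ?_
    rw [gaussianPDFReal_eq_likRatio_mul hv μ₁ μ₂ z]
    exact mul_le_mul_of_nonneg_right (likRatio_le hv hμ (hA hz)) (gaussianPDFReal_nonneg _ _ _)
  all_goals exact integral_nonneg fun z => gaussianPDFReal_nonneg _ _ _

lemma likRatio_mul_le_gaussianReal {v μ₁ μ₂ x : ℝ} (hv : 0 < v) (hμ : μ₁ ≤ μ₂) {A : Set ℝ}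
    (hAm : MeasurableSet A) (hA : A ⊆ Set.Ici x) :
    likRatio v μ₁ μ₂ x * (gaussianReal μ₁ v.toNNReal).real A ≤
      (gaussianReal μ₂ v.toNNReal).real A := by
  have hv' : v.toNNReal ≠ 0 := by simpa using hv
  rw [measureReal_def, measureReal_def, gaussianReal_apply_eq_integral _ hv',
    gaussianReal_apply_eq_integral _ hv', ENNReal.toReal_ofReal, ENNReal.toReal_ofReal,
    ← integral_const_mul]
  · refine setIntegral_mono_on ((integrable_gaussianPDFReal _ _).integrableOn.const_mul _)
      (integrable_gaussianPDFReal _ _).integrableOn hAm fun z hz => ?_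
    rw [gaussianPDFReal_eq_likRatio_mul hv μ₁ μ₂ z]
    exact mul_le_mul_of_nonneg_right (likRatio_le hv hμ (hA hz)) (gaussianPDFReal_nonneg _ _ _)
  all_goals exact integral_nonneg fun z => gaussianPDFReal_nonneg _ _ _

section Trunc

variable {v x : ℝ} {l u : EReal}

/-- The mass of `(l, x]` under `N(μ, v)`. -/
noncomputable def massBelow (v x : ℝ) (l : EReal) (μ : ℝ) : ℝ :=
  (gaussianReal μ v.toNNReal).real {z : ℝ | l < (z : EReal) ∧ (z : EReal) ≤ x}

/-- The mass of `(x, u]` under `N(μ, v)`. -/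
noncomputable def massAbove (v x : ℝ) (u : EReal) (μ : ℝ) : ℝ :=
  (gaussianReal μ v.toNNReal).real {z : ℝ | (x : EReal) < (z : EReal) ∧ (z : EReal) ≤ u}

lemma massBelow_pos (hv : 0 < v) (hl : l < x) (μ : ℝ) : 0 < massBelow v x l μ := by
  obtain ⟨r, hr, hrx⟩ := EReal.lt_iff_exists_real_btwn.1 hl
  have hrx' : r < x := by exact_mod_cast hrx
  refine gaussianReal_real_pos (by simpa using hv) hrx' fun z hz => ⟨hr.trans ?_, ?_⟩
  · exact_mod_cast hz.1
  · exact_mod_cast hz.2.le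

lemma massAbove_pos (hv : 0 < v) (hu : (x : EReal) < u) (μ : ℝ) : 0 < massAbove v x u μ := by
  obtain ⟨r, hr, hru⟩ := EReal.lt_iff_exists_real_btwn.1 hu
  have hxr : x < r := by exact_mod_cast hr
  refine gaussianReal_real_pos (by simpa using hv) hxr fun z hz => ⟨?_, le_trans ?_ hru.le⟩
  · exact_mod_cast hz.1
  · exact_mod_cast hz.2.le

lemma truncCDF_eq_div (hv : 0 < v) (hl : l < x) (hu : (x : EReal) < u) (μ : ℝ) :
    truncCDF x μ v l u = massBelow v x l μ / (massBelow v x l μ + massAbove v x u μ) := by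
  have h1 := gaussCDF_sub μ hv hl.le
  have h2 := gaussCDF_sub μ hv hu.le
  rw [truncCDF, massBelow, massAbove, ← h1, ← h2]
  congr 1
  ring

/-- The truncated Gaussian distribution function decreases with the mean parameter: the tilt by the
likelihood ratio favours points above `x` over points below it. -/
lemma antitone_truncCDF (hv : 0 < v) (hl : l < x) (hu : (x : EReal) < u) :
    Antitone fun μ => truncCDF x μ v l u := by
  intro μ₁ μ₂ hμ
  simp only [truncCDF_eq_div hv hl hu]
  have hN1 := massBelow_pos hv hl μ₁
  have hN2 := massBelow_pos hv hl μ₂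
  have hD1 := massAbove_pos hv hu μ₁
  have hD2 := massAbove_pos hv hu μ₂
  have h1 : massBelow v x l μ₂ ≤ likRatio v μ₁ μ₂ x * massBelow v x l μ₁ :=
    gaussianReal_le_likRatio_mul hv hμ (measurableSet_ereal_Ioc _ _)
      fun z hz => by simpa using hz.2
  have h2 : likRatio v μ₁ μ₂ x * massAbove v x u μ₁ ≤ massAbove v x u μ₂ :=
    likRatio_mul_le_gaussianReal hv hμ (measurableSet_ereal_Ioc _ _)
      fun z hz => by have := hz.1; simp only [EReal.coe_lt_coe_iff] at this; exact this.le
  rw [div_le_div_iff₀ (by positivity) (by positivity)]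
  -- both masses are compared with the likelihood ratio at the common end point `x`
  have h3 : massBelow v x l μ₂ * massAbove v x u μ₁ ≤ massBelow v x l μ₁ * massAbove v x u μ₂ :=
    calc massBelow v x l μ₂ * massAbove v x u μ₁
        ≤ likRatio v μ₁ μ₂ x * massBelow v x l μ₁ * massAbove v x u μ₁ := by gcongr
      _ = massBelow v x l μ₁ * (likRatio v μ₁ μ₂ x * massAbove v x u μ₁) := by ring
      _ ≤ _ := by gcongr
  nlinarith

lemma continuous_gaussCDF_mean (σ : ℝ) (t : EReal) : Continuous fun μ => gaussCDF μ σ t := by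
  induction t with
  | bot => exact continuous_const
  | top => exact continuous_const
  | coe t => exact continuous_stdCDF.comp (by fun_prop)

lemma continuous_truncCDF (hv : 0 < v) (hl : l < x) (hu : (x : EReal) < u) :
    Continuous fun μ => truncCDF x μ v l u := by
  unfold truncCDF
  refine Continuous.div₀ ?_ ?_ fun μ => ?_
  · exact (continuous_gaussCDF_mean _ _).sub (continuous_gaussCDF_mean _ _)
  · exact (continuous_gaussCDF_mean _ _).sub (continuous_gaussCDF_mean _ _)
  · have h1 := gaussCDF_sub μ hv hl.le
    have h2 := gaussCDF_sub μ hv hu.le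
    have h3 := massBelow_pos hv hl μ
    have h4 := massAbove_pos hv hu μ
    unfold massBelow at h3
    unfold massAbove at h4
    intro h
    linarith

lemma likRatio_zero_left (v x μ : ℝ) :
    likRatio v 0 μ x = Real.exp (-(μ ^ 2 / (2 * v))) * Real.exp (μ * x / v) := by
  rw [likRatio, ← Real.exp_add]
  congr 1
  by_cases hv : v = 0
  · simp [hv]
  · field_simp; ring

lemma likRatio_zero_right (v x μ : ℝ) :
    likRatio v μ 0 x = Real.exp (μ ^ 2 / (2 * v)) * Real.exp (-(μ * x / v)) := by
  rw [likRatio, ← Real.exp_add]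
  congr 1
  by_cases hv : v = 0
  · simp [hv]
  · field_simp; ring

lemma tendsto_truncCDF_atTop (hv : 0 < v) (hl : l < x) (hu : (x : EReal) < u) :
    Tendsto (fun μ => truncCDF x μ v l u) atTop (𝓝 0) := by
  obtain ⟨r, hr, hru⟩ := EReal.lt_iff_exists_real_btwn.1 hu
  have hxr : x < r := by exact_mod_cast hr
  set N0 := massBelow v x l 0
  set D0 := massAbove v r u 0
  have hN0 : 0 < N0 := massBelow_pos hv hl 0
  have hD0 : 0 < D0 := massAbove_pos hv hru 0
  have hlim : Tendsto (fun μ : ℝ => N0 / D0 * Real.exp (-(μ * ((r - x) / v)))) atTop (𝓝 0) := by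
    have h1 : Tendsto (fun μ : ℝ => μ * ((r - x) / v)) atTop atTop :=
      tendsto_id.atTop_mul_const (by have : 0 < r - x := by linarith
                                     positivity)
    simpa using (Real.tendsto_exp_neg_atTop_nhds_zero.comp h1).const_mul (N0 / D0)
  refine squeeze_zero' (Eventually.of_forall fun μ => ?_) ?_ hlim
  · rw [truncCDF_eq_div hv hl hu]
    have := massBelow_pos hv hl μ
    have := massAbove_pos hv hu μ
    positivity
  · filter_upwards [eventually_ge_atTop 0] with μ hμ
    rw [truncCDF_eq_div hv hl hu]
    have hN := massBelow_pos hv hl μ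
    have hD := massAbove_pos hv hu μ
    have h1 : massBelow v x l μ ≤ likRatio v 0 μ x * N0 :=
      gaussianReal_le_likRatio_mul hv hμ (measurableSet_ereal_Ioc _ _)
        fun z hz => by simpa using hz.2
    have h2 : likRatio v 0 μ r * D0 ≤ massAbove v x u μ := by
      refine (likRatio_mul_le_gaussianReal hv hμ (measurableSet_ereal_Ioc _ _)
        fun z hz => ?_).trans (measureReal_mono fun z hz => ⟨hr.trans hz.1, hz.2⟩)
      have := hz.1
      simp only [EReal.coe_lt_coe_iff] at this
      exact this.le
    have hK := likRatio_pos v 0 μ r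
    calc massBelow v x l μ / (massBelow v x l μ + massAbove v x u μ)
        ≤ (likRatio v 0 μ x * N0) / (likRatio v 0 μ r * D0) :=
          div_le_div₀ (by have := likRatio_pos v 0 μ x; positivity) h1 (by positivity)
            (by linarith)
      _ = _ := by
          rw [likRatio_zero_left, likRatio_zero_left]
          have : -(μ * ((r - x) / v)) = μ * x / v - μ * r / v := by ring
          rw [this, Real.exp_sub]
          field_simp

lemma tendsto_truncCDF_atBot (hv : 0 < v) (hl : l < x) (hu : (x : EReal) < u) :
    Tendsto (fun μ => truncCDF x μ v l u) atBot (𝓝 1) := by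
  obtain ⟨r, hlr, hr⟩ := EReal.lt_iff_exists_real_btwn.1 hl
  have hrx : r < x := by exact_mod_cast hr
  set N0 := massBelow v r l 0
  set D0 := massAbove v x u 0
  have hN0 : 0 < N0 := massBelow_pos hv hlr 0
  have hD0 : 0 < D0 := massAbove_pos hv hu 0
  have hlim : Tendsto (fun μ : ℝ => 1 - D0 / N0 * Real.exp (μ * ((x - r) / v))) atBot (𝓝 1) := by
    have h1 : Tendsto (fun μ : ℝ => μ * ((x - r) / v)) atBot atBot :=
      tendsto_id.atBot_mul_const (by have : 0 < x - r := by linarith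
                                     positivity)
    simpa using ((Real.tendsto_exp_atBot.comp h1).const_mul (D0 / N0)).const_sub 1
  refine tendsto_of_tendsto_of_tendsto_of_le_of_le' hlim tendsto_const_nhds ?_
    (Eventually.of_forall fun μ => ?_)
  · filter_upwards [eventually_le_atBot 0] with μ hμ
    rw [truncCDF_eq_div hv hl hu]
    have hN := massBelow_pos hv hl μ
    have hD := massAbove_pos hv hu μ
    have hKr := likRatio_pos v μ 0 r
    have hKx := likRatio_pos v μ 0 x
    have h1 : N0 / likRatio v μ 0 r ≤ massBelow v x l μ := by
      rw [div_le_iff₀ hKr, mul_comm]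
      refine (gaussianReal_le_likRatio_mul hv hμ (measurableSet_ereal_Ioc _ _)
        fun z hz => by simpa using hz.2).trans ?_
      gcongr
      exact measureReal_mono fun z hz => ⟨hz.1, hz.2.trans hr.le⟩
    have h2 : massAbove v x u μ ≤ D0 / likRatio v μ 0 x := by
      rw [le_div_iff₀ hKx, mul_comm]
      refine likRatio_mul_le_gaussianReal hv hμ (measurableSet_ereal_Ioc _ _) fun z hz => ?_
      have := hz.1
      simp only [EReal.coe_lt_coe_iff] at this
      exact this.le
    have h3 : 1 - massBelow v x l μ / (massBelow v x l μ + massAbove v x u μ) ≤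
        (D0 / likRatio v μ 0 x) / (N0 / likRatio v μ 0 r) := by
      have : 1 - massBelow v x l μ / (massBelow v x l μ + massAbove v x u μ) =
          massAbove v x u μ / (massBelow v x l μ + massAbove v x u μ) := by
        field_simp; ring
      rw [this]
      gcongr
      linarith
    have h4 : (D0 / likRatio v μ 0 x) / (N0 / likRatio v μ 0 r) =
        D0 / N0 * Real.exp (μ * ((x - r) / v)) := by
      rw [likRatio_zero_right, likRatio_zero_right]
      have : μ * ((x - r) / v) = -(μ * r / v) - -(μ * x / v) := by ring
      rw [this, Real.exp_sub]
      field_simp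
    linarith
  · rw [truncCDF_eq_div hv hl hu]
    have hN := massBelow_pos hv hl μ
    have hD := massAbove_pos hv hu μ
    rw [div_le_one (by positivity)]
    linarith

/-- Inversion of the truncated Gaussian pivot: the interval between the solutions of
`F = 1 - ζ/2` and `F = ζ/2` contains `q` exactly when the pivot at `q` lies between the levels. -/
lemma truncCDF_interval_iff (hv : 0 < v) (hl : l < x) (hu : (x : EReal) < u) {m : ℝ} (hm : 0 < m)
    {ζ : ℝ} (hζ : ζ ∈ Set.Ioo (0 : ℝ) 1) (q : ℝ) :
    (∃ ql qu : ℝ, truncCDF x (m * ql) v l u = 1 - ζ / 2 ∧ truncCDF x (m * qu) v l u = ζ / 2 ∧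
      q ∈ Set.Icc ql qu) ↔ truncCDF x (m * q) v l u ∈ Set.Icc (ζ / 2) (1 - ζ / 2) := by
  have hanti : Antitone fun q => truncCDF x (m * q) v l u := fun a b hab =>
    antitone_truncCDF hv hl hu (mul_le_mul_of_nonneg_left hab hm.le)
  have hcont : Continuous fun q => truncCDF x (m * q) v l u :=
    (continuous_truncCDF hv hl hu).comp (by fun_prop)
  constructor
  · rintro ⟨ql, qu, h1, h2, h3, h4⟩
    exact ⟨h2 ▸ hanti h4, h1 ▸ hanti h3⟩
  · rintro ⟨h1, h2⟩
    have htop : Tendsto (fun q => truncCDF x (m * q) v l u) atTop (𝓝 0) :=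
      (tendsto_truncCDF_atTop hv hl hu).comp (tendsto_id.const_mul_atTop hm)
    have hbot : Tendsto (fun q => truncCDF x (m * q) v l u) atBot (𝓝 1) :=
      (tendsto_truncCDF_atBot hv hl hu).comp (tendsto_id.const_mul_atBot hm)
    obtain ⟨hζ0, hζ1⟩ := hζ
    obtain ⟨b, hb, hqb⟩ := ((htop.eventually (gt_mem_nhds (by linarith : 0 < ζ / 2))).and
      (eventually_ge_atTop q)).exists
    obtain ⟨a, ha, haq⟩ := ((hbot.eventually (lt_mem_nhds (by linarith : 1 - ζ / 2 < 1))).and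
      (eventually_le_atBot q)).exists
    obtain ⟨ql, hql, hql'⟩ := intermediate_value_Icc' haq hcont.continuousOn ⟨h2, ha.le⟩
    obtain ⟨qu, hqu, hqu'⟩ := intermediate_value_Icc' hqb hcont.continuousOn ⟨hb.le, h1⟩
    exact ⟨ql, qu, hql', hqu', hql.2, hqu.1⟩

end Trunc

/-! ### The pivot as a function of the relative slopes of the constraints -/

/-- The value of `Φ(·/σ)` at the right end point `x + 1/r` which a constraint with relative slope
`r` (rate of decrease of its slack, divided by the slack) imposes; a constraint with `r ≤ 0`
imposes none. -/
noncomputable def upperMass (x r σ : ℝ) : ℝ := if 0 < r then stdCDF ((x + 1 / r) / σ) else 1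

/-- The value of `Φ(·/σ)` at the left end point `x + 1/r` which a constraint with relative slope
`r` imposes; a constraint with `0 ≤ r` imposes none. -/
noncomputable def lowerMass (x r σ : ℝ) : ℝ := if r < 0 then stdCDF ((x + 1 / r) / σ) else 0

/-- The pivot written with the relative slopes `r l` of the constraints. Unlike the truncation
limits themselves, this expression is continuous where some `r l` vanishes. -/
noncomputable def slopePivot {L : Type*} [Fintype L] [Nonempty L] (x σ : ℝ) (r : L → ℝ) : ℝ :=
  (stdCDF (x / σ) - Finset.univ.sup' Finset.univ_nonempty fun l => lowerMass x (r l) σ) /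
    ((Finset.univ.inf' Finset.univ_nonempty fun l => upperMass x (r l) σ) -
      Finset.univ.sup' Finset.univ_nonempty fun l => lowerMass x (r l) σ)

lemma stdCDF_lt_upperMass {σ : ℝ} (hσ : 0 < σ) (x r : ℝ) : stdCDF (x / σ) < upperMass x r σ := by
  unfold upperMass
  split_ifs with h
  · refine strictMono_stdCDF (div_lt_div_of_pos_right ?_ hσ)
    have : 0 < 1 / r := by positivity
    linarith
  · exact stdCDF_lt_one _

lemma lowerMass_lt_stdCDF {σ : ℝ} (hσ : 0 < σ) (x r : ℝ) : lowerMass x r σ < stdCDF (x / σ) := by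
  unfold lowerMass
  split_ifs with h
  · refine strictMono_stdCDF (div_lt_div_of_pos_right ?_ hσ)
    have : 1 / r < 0 := by rw [one_div]; exact inv_lt_zero.2 h
    linarith
  · exact stdCDF_pos _

section Continuity

variable {V : Type*} [TopologicalSpace V] {v₀ : V} {x r σ : V → ℝ}

/-- As the relative slope tends to zero the end point tends to infinity, so `upperMass` is
continuous there as well. -/
lemma continuousAt_upperMass (hx : ContinuousAt x v₀) (hr : ContinuousAt r v₀)
    (hσ : ContinuousAt σ v₀) (h0 : 0 < σ v₀) :
    ContinuousAt (fun v => upperMass (x v) (r v) (σ v)) v₀ := by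
  rcases lt_trichotomy (r v₀) 0 with h | h | h
  · have : (fun v => upperMass (x v) (r v) (σ v)) =ᶠ[𝓝 v₀] fun _ => 1 := by
      filter_upwards [hr.eventually (gt_mem_nhds h)] with v hv
      simp [upperMass, hv.le]
    exact continuousAt_const.congr this.symm
  · have hval : upperMass (x v₀) (r v₀) (σ v₀) = 1 := by simp [upperMass, h]
    rw [ContinuousAt, hval, tendsto_order]
    refine ⟨fun a ha => ?_, fun a ha => ?_⟩
    · obtain ⟨T, hT⟩ :=
        ((tendsto_cdf_atTop (gaussianReal 0 1)).eventually (lt_mem_nhds ha)).exists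
      have hc : ContinuousAt (fun v => r v * (T * σ v - x v)) v₀ :=
        hr.mul ((hσ.const_mul T).sub hx)
      have h1 : r v₀ * (T * σ v₀ - x v₀) < 1 := by simp [h]
      filter_upwards [hc.eventually (gt_mem_nhds h1), hσ.eventually (lt_mem_nhds h0)]
        with v hv hs
      unfold upperMass
      split_ifs with hpos
      · refine hT.trans (strictMono_stdCDF ?_)
        rw [lt_div_iff₀ hs]
        have : T * σ v - x v < 1 / r v := by rw [lt_div_iff₀ hpos]; linarith
        linarith
      · exact ha
    · refine Eventually.of_forall fun v => lt_of_le_of_lt ?_ ha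
      unfold upperMass
      split_ifs
      exacts [cdf_le_one _ _, le_rfl]
  · have : (fun v => upperMass (x v) (r v) (σ v)) =ᶠ[𝓝 v₀]
        fun v => stdCDF ((x v + 1 / r v) / σ v) := by
      filter_upwards [hr.eventually (lt_mem_nhds h)] with v hv
      simp [upperMass, hv]
    refine ContinuousAt.congr ?_ this.symm
    exact continuous_stdCDF.continuousAt.comp
      ((hx.add (continuousAt_const.div hr h.ne')).div hσ h0.ne')

lemma continuousAt_lowerMass (hx : ContinuousAt x v₀) (hr : ContinuousAt r v₀)
    (hσ : ContinuousAt σ v₀) (h0 : 0 < σ v₀) :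
    ContinuousAt (fun v => lowerMass (x v) (r v) (σ v)) v₀ := by
  rcases lt_trichotomy (r v₀) 0 with h | h | h
  · have : (fun v => lowerMass (x v) (r v) (σ v)) =ᶠ[𝓝 v₀]
        fun v => stdCDF ((x v + 1 / r v) / σ v) := by
      filter_upwards [hr.eventually (gt_mem_nhds h)] with v hv
      simp [lowerMass, hv]
    refine ContinuousAt.congr ?_ this.symm
    exact continuous_stdCDF.continuousAt.comp
      ((hx.add (continuousAt_const.div hr h.ne)).div hσ h0.ne')
  · have hval : lowerMass (x v₀) (r v₀) (σ v₀) = 0 := by simp [lowerMass, h]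
    rw [ContinuousAt, hval, tendsto_order]
    refine ⟨fun a ha => ?_, fun a ha => ?_⟩
    · refine Eventually.of_forall fun v => lt_of_lt_of_le ha ?_
      unfold lowerMass
      split_ifs
      exacts [cdf_nonneg _ _, le_rfl]
    · obtain ⟨T, hT⟩ :=
        ((tendsto_cdf_atBot (gaussianReal 0 1)).eventually (gt_mem_nhds ha)).exists
      have hc : ContinuousAt (fun v => r v * (T * σ v - x v)) v₀ :=
        hr.mul ((hσ.const_mul T).sub hx)
      have h1 : r v₀ * (T * σ v₀ - x v₀) < 1 := by simp [h]
      filter_upwards [hc.eventually (gt_mem_nhds h1), hσ.eventually (lt_mem_nhds h0)]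
        with v hv hs
      unfold lowerMass
      split_ifs with hneg
      · refine (strictMono_stdCDF ?_).trans hT
        rw [div_lt_iff₀ hs]
        have : 1 / r v < T * σ v - x v := by rw [div_lt_iff_of_neg hneg]; linarith
        linarith
      · exact ha
  · have : (fun v => lowerMass (x v) (r v) (σ v)) =ᶠ[𝓝 v₀] fun _ => 0 := by
      filter_upwards [hr.eventually (lt_mem_nhds h)] with v hv
      simp [lowerMass, hv.le]
    exact continuousAt_const.congr this.symm

lemma continuousAt_slopePivot {L : Type*} [Fintype L] [Nonempty L] {r : V → L → ℝ}
    (hx : ContinuousAt x v₀) (hr : ∀ l, ContinuousAt (fun v => r v l) v₀)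
    (hσ : ContinuousAt σ v₀) (h0 : 0 < σ v₀) :
    ContinuousAt (fun v => slopePivot (x v) (σ v) (r v)) v₀ := by
  have hL : ContinuousAt (fun v => Finset.univ.sup' Finset.univ_nonempty
      fun l => lowerMass (x v) (r v l) (σ v)) v₀ :=
    ContinuousAt.finset_sup'_apply _ fun l _ => continuousAt_lowerMass hx (hr l) hσ h0
  have hU : ContinuousAt (fun v => Finset.univ.inf' Finset.univ_nonempty
      fun l => upperMass (x v) (r v l) (σ v)) v₀ :=
    ContinuousAt.finset_inf'_apply _ fun l _ => continuousAt_upperMass hx (hr l) hσ h0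
  have hx' : ContinuousAt (fun v => stdCDF (x v / σ v)) v₀ :=
    continuous_stdCDF.continuousAt.comp (hx.div hσ h0.ne')
  refine (hx'.sub hL).div (hU.sub hL) (sub_pos.2 ?_).ne'
  calc _ < stdCDF (x v₀ / σ v₀) :=
        (Finset.sup'_lt_iff _).2 fun l _ => lowerMass_lt_stdCDF h0 _ _
    _ < _ := (Finset.lt_inf'_iff _).2 fun l _ => stdCDF_lt_upperMass h0 _ _

end Continuity

lemma gaussCDF_mono (μ : ℝ) {v : ℝ} (hv : 0 < v) : Monotone (gaussCDF μ (Real.sqrt v)) := by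
  intro s t hst
  rw [gaussCDF_eq_real μ hv, gaussCDF_eq_real μ hv]
  exact measureReal_mono fun z hz => le_trans hz hst

section Polyhedral

variable {ι κ : Type*} [Fintype ι]

lemma polyR_eq [DecidableEq ι] (Sig : Matrix ι ι ℝ) (η Z : ι → ℝ) :
    polyR Sig η Z = Z - (η ⬝ᵥ Z) • polyC Sig η := by
  rw [polyR, Matrix.sub_mulVec, Matrix.one_mulVec, Matrix.vecMulVec_mulVec]
  ext i
  simp

variable {A : Matrix κ ι ℝ} {b : κ → ℝ} {Z cv : ι → ℝ} {x : ℝ}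

/-- In terms of the slack `b - A Z` and the slope `A c`, the truncation limits are `x` plus
slack over slope. -/
lemma truncation_limit_eq (hd : ∀ l, 0 < (b - A *ᵥ Z) l) {l : κ} (hg : (A *ᵥ cv) l ≠ 0) :
    (b l - (A *ᵥ (Z - x • cv)) l) / (A *ᵥ cv) l =
      x + 1 / ((A *ᵥ cv) l / (b - A *ᵥ Z) l) := by
  have := (hd l).ne'
  rw [Matrix.mulVec_sub, Matrix.mulVec_smul]
  simp only [Pi.sub_apply, Pi.smul_apply, smul_eq_mul] at this ⊢
  field_simp
  ring

variable [Fintype κ] [Nonempty κ]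

lemma vPlus_eq_inf' (hd : ∀ l, 0 < (b - A *ᵥ Z) l) :
    vPlus A b cv (Z - x • cv) = Finset.univ.inf' Finset.univ_nonempty fun l =>
      if 0 < (A *ᵥ cv) l / (b - A *ᵥ Z) l then
        ((x + 1 / ((A *ᵥ cv) l / (b - A *ᵥ Z) l) : ℝ) : EReal) else ⊤ := by
  rw [Finset.inf'_univ_eq_ciInf, vPlus]
  refine iInf_congr fun l => ?_
  have hiff : 0 < (A *ᵥ cv) l / (b - A *ᵥ Z) l ↔ 0 < (A *ᵥ cv) l :=
    div_pos_iff_of_pos_right (hd l)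
  by_cases h : 0 < (A *ᵥ cv) l
  · rw [iInf_pos h, if_pos (hiff.2 h), truncation_limit_eq hd h.ne']
  · rw [iInf_neg h, if_neg (fun h' => h (hiff.1 h'))]

lemma vMinus_eq_sup' (hd : ∀ l, 0 < (b - A *ᵥ Z) l) :
    vMinus A b cv (Z - x • cv) = Finset.univ.sup' Finset.univ_nonempty fun l =>
      if (A *ᵥ cv) l / (b - A *ᵥ Z) l < 0 then
        ((x + 1 / ((A *ᵥ cv) l / (b - A *ᵥ Z) l) : ℝ) : EReal) else ⊥ := by
  rw [Finset.sup'_univ_eq_ciSup, vMinus]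
  refine iSup_congr fun l => ?_
  have hiff : (A *ᵥ cv) l / (b - A *ᵥ Z) l < 0 ↔ (A *ᵥ cv) l < 0 := by
    rw [div_neg_iff]
    have := hd l
    constructor
    · rintro (h | h)
      · linarith [h.2]
      · exact h.1
    · exact fun h => Or.inr ⟨h, this⟩
  by_cases h : (A *ᵥ cv) l < 0
  · rw [iSup_pos h, if_pos (hiff.2 h), truncation_limit_eq hd h.ne]
  · rw [iSup_neg h, if_neg (fun h' => h (hiff.1 h'))]

lemma lt_vPlus (hd : ∀ l, 0 < (b - A *ᵥ Z) l) : (x : EReal) < vPlus A b cv (Z - x • cv) := by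
  rw [vPlus_eq_inf' hd, Finset.lt_inf'_iff]
  intro l _
  split_ifs with h
  · have : 0 < 1 / ((A *ᵥ cv) l / (b - A *ᵥ Z) l) := by positivity
    exact_mod_cast (by linarith : x < x + 1 / ((A *ᵥ cv) l / (b - A *ᵥ Z) l))
  · exact EReal.coe_lt_top _

lemma vMinus_lt (hd : ∀ l, 0 < (b - A *ᵥ Z) l) : vMinus A b cv (Z - x • cv) < (x : EReal) := by
  rw [vMinus_eq_sup' hd, Finset.sup'_lt_iff]
  intro l _
  split_ifs with h
  · have : 1 / ((A *ᵥ cv) l / (b - A *ᵥ Z) l) < 0 := by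
      rw [one_div]; exact inv_lt_zero.2 h
    exact_mod_cast (by linarith : x + 1 / ((A *ᵥ cv) l / (b - A *ᵥ Z) l) < x)
  · exact EReal.bot_lt_coe _

lemma truncCDF_eq_slopePivot (hd : ∀ l, 0 < (b - A *ᵥ Z) l) (μ : ℝ) {v : ℝ} (hv : 0 < v) :
    truncCDF x μ v (vMinus A b cv (Z - x • cv)) (vPlus A b cv (Z - x • cv)) =
      slopePivot (x - μ) (Real.sqrt v) fun l => (A *ᵥ cv) l / (b - A *ᵥ Z) l := by
  have hmono := gaussCDF_mono μ hv
  have hU : gaussCDF μ (Real.sqrt v) (vPlus A b cv (Z - x • cv)) =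
      Finset.univ.inf' Finset.univ_nonempty fun l =>
        upperMass (x - μ) ((A *ᵥ cv) l / (b - A *ᵥ Z) l) (Real.sqrt v) := by
    rw [vPlus_eq_inf' hd, Finset.apply_inf'_eq_inf'_comp _ (gaussCDF μ (Real.sqrt v))
      fun s t => hmono.map_inf s t]
    congr 1
    ext l
    simp only [Function.comp_apply, upperMass]
    split_ifs with h
    · change stdCDF _ = _
      congr 2
      ring
    · rfl
  have hL : gaussCDF μ (Real.sqrt v) (vMinus A b cv (Z - x • cv)) =
      Finset.univ.sup' Finset.univ_nonempty fun l =>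
        lowerMass (x - μ) ((A *ᵥ cv) l / (b - A *ᵥ Z) l) (Real.sqrt v) := by
    rw [vMinus_eq_sup' hd, Finset.apply_sup'_eq_sup'_comp _ (gaussCDF μ (Real.sqrt v))
      fun s t => hmono.map_sup s t]
    congr 1
    ext l
    simp only [Function.comp_apply, lowerMass]
    split_ifs with h
    · change stdCDF _ = _
      congr 2
      ring
    · rfl
  rw [truncCDF, hU, hL, slopePivot]
  rfl

end Polyhedral

/-! ### The Gaussian limit experiment -/

/-- Probability integral transform: `Φ(ξ)` is uniform on `[0, 1]` for a standard normal `ξ`. -/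
lemma map_stdCDF : (gaussianReal 0 1).map stdCDF = volume.restrict (Set.Icc (0 : ℝ) 1) := by
  have hm : Measurable stdCDF := continuous_stdCDF.measurable
  have : IsProbabilityMeasure ((gaussianReal 0 1).map stdCDF) :=
    Measure.isProbabilityMeasure_map hm.aemeasurable
  refine Measure.ext_of_Iic _ _ fun a => ?_
  rw [Measure.map_apply hm measurableSet_Iic, Measure.restrict_apply measurableSet_Iic]
  rcases le_or_gt a 0 with ha | ha
  · have h1 : stdCDF ⁻¹' Set.Iic a = ∅ := by
      ext z
      simpa using ha.trans_lt (stdCDF_pos z)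
    have h2 : Set.Iic a ∩ Set.Icc (0 : ℝ) 1 ⊆ {0} := by
      rintro z ⟨hz, hz0, -⟩
      exact le_antisymm (le_trans hz ha) hz0
    rw [h1, measure_empty]
    exact (measure_mono_null h2 (by simp)).symm
  rcases lt_or_ge a 1 with ha1 | ha1
  · obtain ⟨z, rfl⟩ := exists_stdCDF_eq ha ha1
    have h1 : stdCDF ⁻¹' Set.Iic (stdCDF z) = Set.Iic z := by
      ext w
      simp [strictMono_stdCDF.le_iff_le]
    have h2 : Set.Iic (stdCDF z) ∩ Set.Icc (0 : ℝ) 1 = Set.Icc 0 (stdCDF z) := by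
      ext w
      simp only [Set.mem_inter_iff, Set.mem_Iic, Set.mem_Icc]
      exact ⟨fun h => ⟨h.2.1, h.1⟩, fun h => ⟨h.2, h.1, h.2.trans ha1.le⟩⟩
    rw [h1, h2, Real.volume_Icc, sub_zero, ← ofReal_cdf]
  · have h1 : stdCDF ⁻¹' Set.Iic a = Set.univ := by
      ext z
      simpa using (stdCDF_lt_one z).le.trans ha1
    have h2 : Set.Iic a ∩ Set.Icc (0 : ℝ) 1 = Set.Icc 0 1 := by
      ext w
      simp only [Set.mem_inter_iff, Set.mem_Iic, Set.mem_Icc]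
      exact ⟨fun h => h.2, fun h => ⟨h.2.trans ha1, h⟩⟩
    rw [h1, h2, measure_univ]
    simp

lemma gaussianReal_stdCDF_mem {p q : ℝ} (hp : 0 ≤ p) (hq : q ≤ 1) {B : Set ℝ}
    (h1 : Set.Ioo p q ⊆ B) (h2 : B ⊆ Set.Icc p q) :
    gaussianReal 0 1 (stdCDF ⁻¹' B) = ENNReal.ofReal (q - p) := by
  have hm : Measurable stdCDF := continuous_stdCDF.measurable
  refine le_antisymm ?_ ?_
  · calc _ ≤ gaussianReal 0 1 (stdCDF ⁻¹' Set.Icc p q) :=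
          measure_mono (Set.preimage_mono h2)
      _ ≤ _ := by
          rw [← Measure.map_apply hm measurableSet_Icc, map_stdCDF, ← Real.volume_Icc]
          exact Measure.restrict_apply_le _ _
  · calc ENNReal.ofReal (q - p) = gaussianReal 0 1 (stdCDF ⁻¹' Set.Ioo p q) := by
          rw [← Measure.map_apply hm measurableSet_Ioo, map_stdCDF,
            Measure.restrict_apply measurableSet_Ioo, Set.inter_eq_left.2, Real.volume_Ioo]
          exact fun z hz => ⟨hp.trans hz.1.le, hz.2.le.trans hq⟩
      _ ≤ _ := measure_mono (Set.preimage_mono h1)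

/-- Conditionally on `Lo < Φ(ξ) < Up`, the ratio `(Φ(ξ) - Lo)/(Up - Lo)` is uniform. -/
lemma gaussianReal_truncated_uniform {Lo Up α β : ℝ} (hLo : 0 ≤ Lo) (hUp : Up ≤ 1)
    (hα : 0 ≤ α) (hαβ : α ≤ β) (hβ : β ≤ 1) :
    gaussianReal 0 1 {z | (Lo < stdCDF z ∧ stdCDF z < Up) ∧
        (stdCDF z - Lo) / (Up - Lo) ∈ Set.Icc α β} =
      ENNReal.ofReal (β - α) * gaussianReal 0 1 {z | Lo < stdCDF z ∧ stdCDF z < Up} := by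
  rcases le_or_gt Up Lo with h | h
  · have h1 : ∀ z, ¬ (Lo < stdCDF z ∧ stdCDF z < Up) := fun z hz => by linarith [hz.1, hz.2]
    simp [h1]
  · have hd : 0 < Up - Lo := by linarith
    have e2 : gaussianReal 0 1 {z | Lo < stdCDF z ∧ stdCDF z < Up} =
        ENNReal.ofReal (Up - Lo) :=
      gaussianReal_stdCDF_mem (B := Set.Ioo Lo Up) hLo hUp subset_rfl
        Set.Ioo_subset_Icc_self
    have e1 := gaussianReal_stdCDF_mem (p := Lo + α * (Up - Lo)) (q := Lo + β * (Up - Lo))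
      (B := {w | (Lo < w ∧ w < Up) ∧ (w - Lo) / (Up - Lo) ∈ Set.Icc α β})
      (by positivity) (by nlinarith) ?_ ?_
    · rw [e2, ← ENNReal.ofReal_mul (by linarith)]
      refine Eq.trans e1 ?_
      congr 1
      ring
    · rintro w ⟨hw1, hw2⟩
      refine ⟨⟨by nlinarith, by nlinarith⟩, ?_, ?_⟩
      · rw [le_div_iff₀ hd]; linarith
      · rw [div_le_iff₀ hd]; linarith
    · rintro w ⟨-, hw1, hw2⟩
      rw [le_div_iff₀ hd] at hw1
      rw [div_le_iff₀ hd] at hw2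
      exact ⟨by linarith, by linarith⟩

section Slice

variable {L : Type*} [Fintype L] [Nonempty L]

/-- The polyhedral lemma along a line: for slacks `D l - γ l σ z` which are affine in a standard
normal `z`, the pivot is uniform given that all slacks are positive. -/
lemma gaussianReal_slice_uniform (D γ : L → ℝ) {σ : ℝ} (hσ : 0 < σ) {α β : ℝ}
    (hα : 0 ≤ α) (hαβ : α ≤ β) (hβ : β ≤ 1) :
    gaussianReal 0 1 {z | (∀ l, 0 < D l - γ l * (σ * z)) ∧
        slopePivot (σ * z) σ (fun l => γ l / (D l - γ l * (σ * z))) ∈ Set.Icc α β} =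
      ENNReal.ofReal (β - α) * gaussianReal 0 1 {z | ∀ l, 0 < D l - γ l * (σ * z)} := by
  -- a violated constraint that does not depend on `z` makes both sides vanish
  by_cases hdeg : ∃ l, γ l = 0 ∧ D l ≤ 0
  · obtain ⟨l, h1, h2⟩ := hdeg
    have h3 : ∀ z, ¬ ∀ l, 0 < D l - γ l * (σ * z) := fun z hz => by
      have := hz l
      rw [h1] at this
      linarith
    simp only [h3, false_and, Set.ofPred_false, measure_empty, mul_zero]
  push Not at hdeg
  -- `z` moves `x` and the slacks, but the end point `x + slack / γ` is fixed along the line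
  set U : L → ℝ := fun l => if 0 < γ l then stdCDF (D l / γ l / σ) else 1 with hU
  set W : L → ℝ := fun l => if γ l < 0 then stdCDF (D l / γ l / σ) else 0 with hW
  set Up := Finset.univ.inf' Finset.univ_nonempty U with hUp
  set Lo := Finset.univ.sup' Finset.univ_nonempty W with hLo
  have hiff : ∀ z, (∀ l, 0 < D l - γ l * (σ * z)) ↔ Lo < stdCDF z ∧ stdCDF z < Up := by
    intro z
    rw [hUp, hLo, Finset.lt_inf'_iff, Finset.sup'_lt_iff]
    have key : ∀ l, 0 < D l - γ l * (σ * z) ↔ W l < stdCDF z ∧ stdCDF z < U l := by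
      intro l
      rcases lt_trichotomy (γ l) 0 with h | h | h
      · simp only [hU, hW, if_pos h, if_neg h.not_gt, strictMono_stdCDF.lt_iff_lt, stdCDF_lt_one,
          and_true]
        rw [div_lt_iff₀ hσ, div_lt_iff_of_neg h]
        constructor <;> intro <;> linarith
      · simp only [hU, hW, h, lt_irrefl, if_false, stdCDF_lt_one, stdCDF_pos]
        simpa using hdeg l h
      · simp only [hU, hW, if_pos h, if_neg h.not_gt, strictMono_stdCDF.lt_iff_lt, stdCDF_pos,
          true_and]
        rw [lt_div_iff₀ hσ, lt_div_iff₀ h]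
        constructor <;> intro <;> linarith
    constructor
    · exact fun h => ⟨fun l _ => ((key l).1 (h l)).1, fun l _ => ((key l).1 (h l)).2⟩
    · exact fun h l => (key l).2 ⟨h.1 l (Finset.mem_univ _), h.2 l (Finset.mem_univ _)⟩
  have hpiv : ∀ z, (∀ l, 0 < D l - γ l * (σ * z)) →
      slopePivot (σ * z) σ (fun l => γ l / (D l - γ l * (σ * z))) =
        (stdCDF z - Lo) / (Up - Lo) := by
    intro z hz
    have h1 : ∀ l, upperMass (σ * z) (γ l / (D l - γ l * (σ * z))) σ = U l := by
      intro l
      have hd := hz l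
      simp only [upperMass, hU, div_pos_iff_of_pos_right hd]
      split_ifs with h
      · congr 2
        field_simp
        ring
      · rfl
    have h2 : ∀ l, lowerMass (σ * z) (γ l / (D l - γ l * (σ * z))) σ = W l := by
      intro l
      have hd := hz l
      have : γ l / (D l - γ l * (σ * z)) < 0 ↔ γ l < 0 := by
        rw [div_lt_iff₀ hd, zero_mul]
      simp only [lowerMass, hW, this]
      split_ifs with h
      · have := h.ne
        congr 2
        field_simp
        ring
      · rfl
    rw [slopePivot]
    simp only [h1, h2]
    rw [mul_div_cancel_left₀ _ hσ.ne']
  have hLo0 : 0 ≤ Lo := by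
    obtain ⟨l⟩ := ‹Nonempty L›
    refine le_trans ?_ (Finset.le_sup' W (Finset.mem_univ l))
    simp only [hW]
    split_ifs
    exacts [(stdCDF_pos _).le, le_rfl]
  have hUp1 : Up ≤ 1 := by
    obtain ⟨l⟩ := ‹Nonempty L›
    refine (Finset.inf'_le U (Finset.mem_univ l)).trans ?_
    simp only [hU]
    split_ifs
    exacts [(stdCDF_lt_one _).le, le_rfl]
  rw [show {z | ∀ l, 0 < D l - γ l * (σ * z)} = {z | Lo < stdCDF z ∧ stdCDF z < Up} from
      Set.ext hiff, ← gaussianReal_truncated_uniform hLo0 hUp1 hα hαβ hβ]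
  congr 1
  ext z
  change _ ∧ _ ↔ _ ∧ _
  rw [← hiff z]
  refine and_congr_right fun hz => ?_
  rw [hpiv z hz]

end Slice

lemma measurable_sup'_fun {E L : Type*} [MeasurableSpace E] [Fintype L] [Nonempty L]
    {f : E → L → ℝ} (hf : ∀ l, Measurable fun x => f x l) :
    Measurable fun x => Finset.univ.sup' Finset.univ_nonempty (f x) := by
  convert Finset.measurable_sup' (f := fun l x => f x l) Finset.univ_nonempty
    (fun l _ => hf l) using 2 with x
  rw [Finset.sup'_apply]

lemma measurable_inf'_fun {E L : Type*} [MeasurableSpace E] [Fintype L] [Nonempty L]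
    {f : E → L → ℝ} (hf : ∀ l, Measurable fun x => f x l) :
    Measurable fun x => Finset.univ.inf' Finset.univ_nonempty (f x) := by
  have h : Measurable (Finset.univ.inf' Finset.univ_nonempty fun l x => f x l) :=
    Finset.inf'_induction (p := Measurable) _ _ (fun _ hf _ hg => hf.inf hg) fun l _ => hf l
  convert h using 2 with x
  rw [Finset.inf'_apply]

section Multivariate

variable {ι : Type*} [Fintype ι] [DecidableEq ι]

/-- The centred Gaussian law on `ι → ℝ` with covariance matrix `S`. -/
noncomputable def gaussianVec (S : Matrix ι ι ℝ) : Measure (ι → ℝ) :=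
  (multivariateGaussian 0 S).map WithLp.ofLp

instance (S : Matrix ι ι ℝ) : IsProbabilityMeasure (gaussianVec S) :=
  Measure.isProbabilityMeasure_map (by fun_prop)

/-- Gaussian decomposition: replacing the component `t'Y` of `Y` by an independent copy does not
change the law. The remainder `Y - (t'Y) S t / (t'S t)` is independent of `t'Y`. -/
lemma map_resample_multivariateGaussian {S : Matrix ι ι ℝ} (hS : S.PosSemidef) (t : ι → ℝ)
    (ht : 0 < t ⬝ᵥ (S *ᵥ t)) :
    ((gaussianReal 0 1).prod (multivariateGaussian 0 S)).map
      (fun q : ℝ × EuclideanSpace ℝ ι => q.2 +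
        (Real.sqrt (t ⬝ᵥ (S *ᵥ t)) * q.1 - t ⬝ᵥ q.2.ofLp) •
          WithLp.toLp 2 ((t ⬝ᵥ (S *ᵥ t))⁻¹ • (S *ᵥ t))) =
      multivariateGaussian 0 S := by
  set v := t ⬝ᵥ (S *ᵥ t) with hv
  set k : EuclideanSpace ℝ ι := WithLp.toLp 2 (v⁻¹ • (S *ᵥ t)) with hk
  have hmeas : Measurable (fun q : ℝ × EuclideanSpace ℝ ι => q.2 +
      (Real.sqrt v * q.1 - t ⬝ᵥ q.2.ofLp) • k) := by
    have : Measurable fun q : ℝ × EuclideanSpace ℝ ι => t ⬝ᵥ q.2.ofLp := by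
      unfold dotProduct
      fun_prop
    fun_prop
  have : IsProbabilityMeasure (((gaussianReal 0 1).prod (multivariateGaussian 0 S)).map
      (fun q : ℝ × EuclideanSpace ℝ ι => q.2 +
        (Real.sqrt v * q.1 - t ⬝ᵥ q.2.ofLp) • k)) :=
    Measure.isProbabilityMeasure_map hmeas.aemeasurable
  refine Measure.ext_of_charFun (funext fun w => ?_)
  set a : ℝ := inner ℝ k w with ha
  have hinner : ∀ q : ℝ × EuclideanSpace ℝ ι,
      (inner ℝ (q.2 + (Real.sqrt v * q.1 - t ⬝ᵥ q.2.ofLp) • k) w : ℝ) =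
        (Real.sqrt v * a) * q.1 + inner ℝ q.2 (w - a • WithLp.toLp 2 t) := by
    intro q
    have : (inner ℝ q.2 (WithLp.toLp 2 t : EuclideanSpace ℝ ι) : ℝ) = t ⬝ᵥ q.2.ofLp := by
      simp [EuclideanSpace.inner_eq_star_dotProduct]
    rw [inner_add_left, real_inner_smul_left, inner_sub_right, real_inner_smul_right, this, ← ha]
    ring
  rw [charFun_apply, integral_map hmeas.aemeasurable (by fun_prop)]
  have hsplit : ∀ q : ℝ × EuclideanSpace ℝ ι,
      Complex.exp (((inner ℝ (q.2 + (Real.sqrt v * q.1 - t ⬝ᵥ q.2.ofLp) • k) w : ℝ) : ℂ) *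
        Complex.I) = Complex.exp (((Real.sqrt v * a : ℝ) : ℂ) * q.1 * Complex.I) *
        Complex.exp (((inner ℝ q.2 (w - a • WithLp.toLp 2 t) : ℝ) : ℂ) * Complex.I) := by
    intro q
    rw [hinner, ← Complex.exp_add]
    push_cast
    ring_nf
  simp only [hsplit]
  rw [integral_prod_mul (μ := gaussianReal 0 1) (ν := multivariateGaussian 0 S)
    (fun z : ℝ => Complex.exp (((Real.sqrt v * a : ℝ) : ℂ) * z * Complex.I))
    (fun Y => Complex.exp (((inner ℝ Y (w - a • WithLp.toLp 2 t) : ℝ) : ℂ) * Complex.I)),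
    ← charFun_apply_real, ← charFun_apply, charFun_gaussianReal,
    charFun_multivariateGaussian hS, charFun_multivariateGaussian hS, ← Complex.exp_add]
  congr 1
  have hsym : ∀ u z : ι → ℝ, u ⬝ᵥ (S *ᵥ z) = z ⬝ᵥ (S *ᵥ u) := by
    intro u z
    have hT : Sᵀ = S := by
      simpa only [Matrix.conjTranspose_eq_transpose_of_trivial] using hS.isHermitian.eq
    rw [Matrix.dotProduct_mulVec, ← Matrix.mulVec_transpose, hT, dotProduct_comm]
  have ha' : w.ofLp ⬝ᵥ (S *ᵥ t) = a * v := by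
    rw [ha, hk, EuclideanSpace.inner_eq_star_dotProduct]
    simp only [star_trivial, dotProduct_smul, smul_eq_mul]
    field_simp
  have hquad : (w - a • WithLp.toLp 2 t : EuclideanSpace ℝ ι).ofLp ⬝ᵥ
      (S *ᵥ (w - a • WithLp.toLp 2 t : EuclideanSpace ℝ ι).ofLp) =
      w.ofLp ⬝ᵥ (S *ᵥ w.ofLp) - a ^ 2 * v := by
    simp only [WithLp.ofLp_sub, WithLp.ofLp_smul, Matrix.mulVec_sub, Matrix.mulVec_smul,
      sub_dotProduct, dotProduct_sub, smul_dotProduct, dotProduct_smul, smul_eq_mul]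
    rw [hsym t w.ofLp, ha', ← hv]
    ring
  rw [hquad]
  have hsq : ((Real.sqrt v * a : ℝ) : ℂ) ^ 2 = ((v * a ^ 2 : ℝ) : ℂ) := by
    rw [← Complex.ofReal_pow, mul_pow, Real.sq_sqrt ht.le]
  rw [hsq]
  push_cast
  simp only [inner_zero_right, Complex.ofReal_zero]
  ring

lemma map_resample_gaussianVec {S : Matrix ι ι ℝ} (hS : S.PosSemidef) (t : ι → ℝ)
    (ht : 0 < t ⬝ᵥ (S *ᵥ t)) :
    ((gaussianReal 0 1).prod (gaussianVec S)).map
      (fun q : ℝ × (ι → ℝ) => q.2 + (Real.sqrt (t ⬝ᵥ (S *ᵥ t)) * q.1 - t ⬝ᵥ q.2) •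
          ((t ⬝ᵥ (S *ᵥ t))⁻¹ • (S *ᵥ t))) = gaussianVec S := by
  have hof : Measurable (WithLp.ofLp : EuclideanSpace ℝ ι → ι → ℝ) := by fun_prop
  have hprod : (gaussianReal 0 1).prod (gaussianVec S) =
      ((gaussianReal 0 1).prod (multivariateGaussian 0 S)).map (Prod.map id WithLp.ofLp) := by
    rw [← Measure.map_prod_map _ _ measurable_id hof, Measure.map_id, gaussianVec]
  have hd : Measurable fun q : ℝ × (ι → ℝ) => t ⬝ᵥ q.2 := by
    unfold dotProduct
    fun_prop
  have hd' : Measurable fun q : ℝ × EuclideanSpace ℝ ι => t ⬝ᵥ q.2.ofLp := by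
    unfold dotProduct
    fun_prop
  rw [hprod, Measure.map_map (by fun_prop) (by fun_prop)]
  conv_rhs => rw [gaussianVec, ← map_resample_multivariateGaussian hS t ht]
  rw [Measure.map_map hof (by fun_prop)]
  rfl

lemma gaussianVec_eq_lintegral_line {S : Matrix ι ι ℝ} (hS : S.PosSemidef) (t : ι → ℝ)
    (ht : 0 < t ⬝ᵥ (S *ᵥ t)) {B : Set (ι → ℝ)} (hB : MeasurableSet B) :
    gaussianVec S B = ∫⁻ Y, gaussianReal 0 1 {z | Y + (Real.sqrt (t ⬝ᵥ (S *ᵥ t)) * z - t ⬝ᵥ Y) •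
      ((t ⬝ᵥ (S *ᵥ t))⁻¹ • (S *ᵥ t)) ∈ B} ∂(gaussianVec S) := by
  have hd : Measurable fun q : ℝ × (ι → ℝ) => t ⬝ᵥ q.2 := by
    unfold dotProduct
    fun_prop
  have hrm : Measurable (fun q : ℝ × (ι → ℝ) => q.2 + (Real.sqrt (t ⬝ᵥ (S *ᵥ t)) * q.1 -
      t ⬝ᵥ q.2) • ((t ⬝ᵥ (S *ᵥ t))⁻¹ • (S *ᵥ t))) := by
    fun_prop
  conv_lhs => rw [← map_resample_gaussianVec hS t ht]
  rw [Measure.map_apply hrm hB, Measure.prod_apply_symm (hrm hB)]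
  rfl

/-- Polyhedral lemma for Gaussian vectors. The slacks `D l` decrease at the constant rate `γ l` in
the direction `S t` (scaled so that `t'Y` grows at rate one); given that all slacks are positive,
the pivot based on `t'Y` is uniform. -/
lemma gaussianVec_polyhedral {L : Type*} [Fintype L] [Nonempty L] {S : Matrix ι ι ℝ}
    (hS : S.PosSemidef) (t : ι → ℝ) (ht : 0 < t ⬝ᵥ (S *ᵥ t)) (D : (ι → ℝ) → L → ℝ)
    (hDm : ∀ l, Measurable fun Y => D Y l) (γ : L → ℝ)
    (hD : ∀ Y h l, D (Y + h • ((t ⬝ᵥ (S *ᵥ t))⁻¹ • (S *ᵥ t))) l = D Y l - γ l * h) {α β : ℝ}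
    (hα : 0 ≤ α) (hαβ : α ≤ β) (hβ : β ≤ 1) :
    gaussianVec S {Y | (∀ l, 0 < D Y l) ∧
        slopePivot (t ⬝ᵥ Y) (Real.sqrt (t ⬝ᵥ (S *ᵥ t))) (fun l => γ l / D Y l) ∈ Set.Icc α β} =
      ENNReal.ofReal (β - α) * gaussianVec S {Y | ∀ l, 0 < D Y l} := by
  set v := t ⬝ᵥ (S *ᵥ t) with hv
  set k := v⁻¹ • (S *ᵥ t) with hk
  have hσ : 0 < Real.sqrt v := Real.sqrt_pos.2 ht
  have htk : t ⬝ᵥ k = 1 := by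
    rw [hk, dotProduct_smul, ← hv, smul_eq_mul, inv_mul_cancel₀ ht.ne']
  have hd : Measurable fun Y : ι → ℝ => t ⬝ᵥ Y := by
    unfold dotProduct
    fun_prop
  have hA : MeasurableSet {Y | ∀ l, 0 < D Y l} := by
    rw [Set.ofPred_forall]
    exact MeasurableSet.iInter fun l => measurableSet_lt measurable_const (hDm l)
  have hU : Measurable fun Y => Finset.univ.inf' Finset.univ_nonempty fun l =>
      upperMass (t ⬝ᵥ Y) (γ l / D Y l) (Real.sqrt v) := by
    refine measurable_inf'_fun fun l => ?_
    unfold upperMass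
    have h1 : Measurable fun Y => γ l / D Y l := (hDm l).const_div _
    exact Measurable.ite (measurableSet_lt measurable_const h1)
      (continuous_stdCDF.measurable.comp ((hd.add (h1.const_div 1)).div_const _))
      measurable_const
  have hL : Measurable fun Y => Finset.univ.sup' Finset.univ_nonempty fun l =>
      lowerMass (t ⬝ᵥ Y) (γ l / D Y l) (Real.sqrt v) := by
    refine measurable_sup'_fun fun l => ?_
    unfold lowerMass
    have h1 : Measurable fun Y => γ l / D Y l := (hDm l).const_div _
    exact Measurable.ite (measurableSet_lt h1 measurable_const)
      (continuous_stdCDF.measurable.comp ((hd.add (h1.const_div 1)).div_const _))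
      measurable_const
  have hP : Measurable fun Y =>
      slopePivot (t ⬝ᵥ Y) (Real.sqrt v) (fun l => γ l / D Y l) := by
    unfold slopePivot
    exact ((continuous_stdCDF.measurable.comp (hd.div_const _)).sub hL).div (hU.sub hL)
  have hB : MeasurableSet {Y | (∀ l, 0 < D Y l) ∧
      slopePivot (t ⬝ᵥ Y) (Real.sqrt v) (fun l => γ l / D Y l) ∈ Set.Icc α β} :=
    hA.inter (hP measurableSet_Icc)
  have hslice : ∀ (Y : ι → ℝ) (z : ℝ) (l : L),
      D (Y + (Real.sqrt v * z - t ⬝ᵥ Y) • k) l =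
        D (Y - (t ⬝ᵥ Y) • k) l - γ l * (Real.sqrt v * z) := by
    intro Y z l
    rw [← hD]
    congr 1
    module
  have htY : ∀ (Y : ι → ℝ) (z : ℝ),
      t ⬝ᵥ (Y + (Real.sqrt v * z - t ⬝ᵥ Y) • k) = Real.sqrt v * z := by
    intro Y z
    rw [dotProduct_add, dotProduct_smul, htk, smul_eq_mul]
    ring
  rw [gaussianVec_eq_lintegral_line hS t ht hA, gaussianVec_eq_lintegral_line hS t ht hB, ← lintegral_const_mul']
  · simp only [← hv, ← hk]
    refine lintegral_congr fun Y => ?_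
    have := gaussianReal_slice_uniform (fun l => D (Y - (t ⬝ᵥ Y) • k) l) γ hσ hα hαβ hβ
    simpa only [Set.mem_ofPred_eq, hslice, htY] using this
  · exact ENNReal.ofReal_ne_top

open scoped MatrixOrder in
lemma isOpenPosMeasure_gaussianVec {S : Matrix ι ι ℝ} (hS : S.PosDef) :
    (gaussianVec S).IsOpenPosMeasure := by
  have h1 : (gaussianReal 0 1).IsOpenPosMeasure :=
    (gaussianReal_absolutelyContinuous' 0 one_ne_zero).isOpenPosMeasure
  have h2 : (stdGaussian (EuclideanSpace ℝ ι)).IsOpenPosMeasure := by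
    rw [← map_pi_eq_stdGaussian]
    exact Continuous.isOpenPosMeasure_map (by fun_prop) (WithLp.toLp_surjective 2)
  have h3 : (multivariateGaussian 0 S).IsOpenPosMeasure := by
    refine Continuous.isOpenPosMeasure_map (by fun_prop) fun y => ?_
    have hinv : CFC.sqrt S * (CFC.sqrt S * S⁻¹) = 1 := by
      rw [← mul_assoc, CFC.sqrt_mul_sqrt_self S hS.posSemidef.nonneg,
        Matrix.mul_nonsing_inv _ ((Matrix.isUnit_iff_isUnit_det _).1 hS.isUnit)]
    refine ⟨Matrix.toEuclideanCLM (𝕜 := ℝ) (CFC.sqrt S * S⁻¹) y, ?_⟩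
    rw [← mul_apply_eq_comp, ← map_mul, hinv, map_one]
    simp
  exact Continuous.isOpenPosMeasure_map (by fun_prop) (WithLp.ofLp_surjective 2)

lemma gaussianVec_dotProduct_null {S : Matrix ι ι ℝ} (hS : S.PosDef) {t : ι → ℝ} (ht : t ≠ 0)
    (a : ℝ) : gaussianVec S {Y | t ⬝ᵥ Y = a} = 0 := by
  have hv : 0 < t ⬝ᵥ (S *ᵥ t) := by simpa using hS.dotProduct_mulVec_pos ht
  have hd : Measurable fun Y : ι → ℝ => t ⬝ᵥ Y := by
    unfold dotProduct
    fun_prop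
  have : NullSingletonClass (gaussianReal 0 1) := nullSingletonClass_gaussianReal one_ne_zero
  have hm : MeasurableSet {Y : ι → ℝ | t ⬝ᵥ Y = a} := hd (measurableSet_singleton a)
  rw [gaussianVec_eq_lintegral_line hS.posSemidef t hv hm]
  refine (lintegral_congr fun Y => ?_).trans lintegral_zero
  refine measure_mono_null (t := {a / Real.sqrt (t ⬝ᵥ (S *ᵥ t))}) (fun z hz => ?_)
    (measure_singleton _)
  have hσ := Real.sqrt_pos.2 hv
  have hz' : t ⬝ᵥ (Y + (Real.sqrt (t ⬝ᵥ (S *ᵥ t)) * z - t ⬝ᵥ Y) •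
      ((t ⬝ᵥ (S *ᵥ t))⁻¹ • (S *ᵥ t))) = a := hz
  rw [dotProduct_add, dotProduct_smul, dotProduct_smul, smul_eq_mul, smul_eq_mul,
    inv_mul_cancel₀ hv.ne'] at hz'
  rw [Set.mem_singleton_iff, eq_div_iff hσ.ne']
  linarith

end Multivariate

/-! ### Limit theorems for triangular arrays of bounded variables -/

section Limit

variable {Ω : Type*} [MeasurableSpace Ω] {P : Measure Ω} [IsProbabilityMeasure P]

lemma norm_prod_sub_prod_le {α : Type*} (s : Finset α) (f g : α → ℂ) (hf : ∀ i ∈ s, ‖f i‖ ≤ 1)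
    (hg : ∀ i ∈ s, ‖g i‖ ≤ 1) :
    ‖∏ i ∈ s, f i - ∏ i ∈ s, g i‖ ≤ ∑ i ∈ s, ‖f i - g i‖ := by
  classical
  induction s using Finset.induction_on with
  | empty => simp
  | insert a s ha ih =>
    rw [Finset.prod_insert ha, Finset.prod_insert ha, Finset.sum_insert ha]
    have hg' : ‖∏ i ∈ s, g i‖ ≤ 1 := by
      rw [norm_prod]
      exact Finset.prod_le_one (fun _ _ => norm_nonneg _)
        fun i hi => hg i (Finset.mem_insert_of_mem hi)
    have ih' := ih (fun i hi => hf i (Finset.mem_insert_of_mem hi))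
      (fun i hi => hg i (Finset.mem_insert_of_mem hi))
    have hfa := hf a (Finset.mem_insert_self a s)
    calc ‖f a * ∏ i ∈ s, f i - g a * ∏ i ∈ s, g i‖
        = ‖f a * (∏ i ∈ s, f i - ∏ i ∈ s, g i) + (f a - g a) * ∏ i ∈ s, g i‖ := by
          congr 1; ring
      _ ≤ ‖f a‖ * ‖∏ i ∈ s, f i - ∏ i ∈ s, g i‖ + ‖f a - g a‖ * ‖∏ i ∈ s, g i‖ := by
          refine (norm_add_le _ _).trans ?_
          rw [norm_mul, norm_mul]
      _ ≤ 1 * ‖∏ i ∈ s, f i - ∏ i ∈ s, g i‖ + ‖f a - g a‖ * 1 := by gcongr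
      _ ≤ _ := by linarith

lemma norm_exp_mul_I_sub_le {x : ℝ} (hx : |x| ≤ 1) :
    ‖Complex.exp (x * Complex.I) - (1 + x * Complex.I - x ^ 2 / 2)‖ ≤ |x| ^ 3 := by
  have hn : ‖(x : ℂ) * Complex.I‖ = |x| := by simp
  have h := Complex.exp_bound (x := (x : ℂ) * Complex.I) (by rw [hn]; exact hx) (n := 3)
    (by norm_num)
  rw [hn] at h
  have hs : ∑ m ∈ Finset.range 3, ((x : ℂ) * Complex.I) ^ m / (m.factorial : ℂ) =
      1 + x * Complex.I - x ^ 2 / 2 := by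
    simp only [Finset.sum_range_succ, Finset.sum_range_zero, Nat.factorial]
    simp only [mul_pow, Complex.I_sq]
    push_cast
    ring
  rw [hs] at h
  refine h.trans ?_
  have h3 : (0 : ℝ) ≤ |x| ^ 3 := by positivity
  have : ((Nat.succ 3 : ℕ) : ℝ) * ((Nat.factorial 3 : ℕ) * (3 : ℕ) : ℝ)⁻¹ ≤ 1 := by
    norm_num [Nat.factorial]
  nlinarith

lemma integrable_of_ae_abs_le {X : Ω → ℝ} (hX : Measurable X) {B : ℝ} (hb : ∀ᵐ ω ∂P, |X ω| ≤ B) :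
    Integrable X P :=
  (integrable_const B).mono' hX.aestronglyMeasurable hb

/-- Second order expansion of the characteristic function of a bounded centred variable. -/
lemma norm_charFun_sub_le {X : Ω → ℝ} (hX : Measurable X) {B s : ℝ} (hb : ∀ᵐ ω ∂P, |X ω| ≤ B)
    (h0 : ∫ ω, X ω ∂P = 0) (hs : |s| * B ≤ 1) :
    ‖charFun (P.map X) s - (1 - s ^ 2 * (∫ ω, X ω ^ 2 ∂P) / 2 : ℝ)‖ ≤ (|s| * B) ^ 3 := by
  have hsX : ∀ᵐ ω ∂P, |s * X ω| ≤ |s| * B := by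
    filter_upwards [hb] with ω h
    rw [abs_mul]
    gcongr
  have hi1 : Integrable X P := integrable_of_ae_abs_le hX hb
  have hi2 : Integrable (fun ω => X ω ^ 2) P := by
    refine integrable_of_ae_abs_le (hX.pow_const 2) (B := B ^ 2) ?_
    filter_upwards [hb] with ω h
    rw [abs_pow]
    gcongr
  have hie : Integrable (fun ω => Complex.exp ((s * X ω : ℝ) * Complex.I)) P := by
    refine (integrable_const (1 : ℝ)).mono' (by fun_prop) (Eventually.of_forall fun ω => ?_)
    rw [Complex.norm_exp_ofReal_mul_I]
  have hip : Integrable (fun ω => (1 : ℂ) + (s * X ω : ℝ) * Complex.I - (s * X ω : ℝ) ^ 2 / 2) P := by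
    refine ((integrable_const _).add ((hi1.const_mul s).ofReal.mul_const _)).sub ?_
    have : (fun ω => ((s * X ω : ℝ) : ℂ) ^ 2 / 2) =
        fun ω => ((s ^ 2 / 2 * X ω ^ 2 : ℝ) : ℂ) := by
      funext ω; push_cast; ring
    rw [this]
    exact (hi2.const_mul _).ofReal
  have hval : ((1 - s ^ 2 * (∫ ω, X ω ^ 2 ∂P) / 2 : ℝ) : ℂ) =
      ∫ ω, ((1 : ℂ) + (s * X ω : ℝ) * Complex.I - (s * X ω : ℝ) ^ 2 / 2) ∂P := by
    have e : (fun ω => (1 : ℂ) + (s * X ω : ℝ) * Complex.I - (s * X ω : ℝ) ^ 2 / 2) =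
        fun ω => ((1 - s ^ 2 / 2 * X ω ^ 2 : ℝ) : ℂ) + ((s * X ω : ℝ) : ℂ) * Complex.I := by
      funext ω; push_cast; ring
    rw [e, integral_add, integral_mul_const, integral_complex_ofReal, integral_complex_ofReal,
      integral_const_mul, h0, integral_sub, integral_const_mul]
    · simp
      ring
    · exact integrable_const _
    · exact hi2.const_mul _
    · exact ((integrable_const _).sub (hi2.const_mul _)).ofReal
    · exact (hi1.const_mul s).ofReal.mul_const _
  rw [charFun_apply_real, integral_map hX.aemeasurable (by fun_prop), hval]
  have e2 : (fun ω => Complex.exp (s * X ω * Complex.I)) =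
      fun ω => Complex.exp ((s * X ω : ℝ) * Complex.I) := by
    funext ω; push_cast; rfl
  rw [e2, ← integral_sub hie hip]
  refine (norm_integral_le_of_norm_le_const (C := (|s| * B) ^ 3) ?_).trans (by simp)
  filter_upwards [hsX] with ω h
  exact (norm_exp_mul_I_sub_le (h.trans hs)).trans (by gcongr)

variable {ξ : (n : ℕ) → Fin n → Ω → ℝ} {B : ℝ}

/-- Central limit theorem, on the level of characteristic functions, for a triangular array of
uniformly bounded centred variables (so that the Lindeberg condition is automatic). -/
lemma tendsto_charFun_sum_array (hm : ∀ᶠ n in atTop, ∀ i, Measurable (ξ n i))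
    (hind : ∀ᶠ n in atTop, iIndepFun (ξ n) P) (hb : ∀ᶠ n in atTop, ∀ i, ∀ᵐ ω ∂P, |ξ n i ω| ≤ B)
    (h0 : ∀ᶠ n in atTop, ∀ i, ∫ ω, ξ n i ω ∂P = 0) {v : ℝ}
    (hv : Tendsto (fun n : ℕ => (n : ℝ)⁻¹ * ∑ i, ∫ ω, ξ n i ω ^ 2 ∂P) atTop (𝓝 v)) :
    Tendsto (fun n : ℕ => charFun (P.map fun ω => ∑ i, ξ n i ω) (Real.sqrt n)⁻¹) atTop
      (𝓝 (Complex.exp (-(v / 2 : ℝ)))) := by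
  wlog hB : 0 ≤ B generalizing B
  · refine this (B := |B|) ?_ (abs_nonneg B)
    filter_upwards [hb] with n hn i
    filter_upwards [hn i] with ω h using h.trans (le_abs_self B)
  -- each factor of the characteristic function is close to `exp (-q n i)`
  set q : (n : ℕ) → Fin n → ℝ := fun n i => (n : ℝ)⁻¹ * (∫ ω, ξ n i ω ^ 2 ∂P) / 2 with hq
  have hexp : Tendsto (fun n : ℕ => ∏ i, Complex.exp (-(q n i : ℝ))) atTop
      (𝓝 (Complex.exp (-(v / 2 : ℝ)))) := by
    have : (fun n : ℕ => ∏ i, Complex.exp (-(q n i : ℝ))) = fun n : ℕ =>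
        Complex.exp (-(((n : ℝ)⁻¹ * ∑ i, ∫ ω, ξ n i ω ^ 2 ∂P) / 2 : ℝ)) := by
      funext n
      rw [← Complex.exp_sum, hq]
      congr 1
      push_cast
      rw [Finset.sum_neg_distrib, Finset.mul_sum, Finset.sum_div]
    rw [this]
    have hc : Continuous fun r : ℝ => Complex.exp (-(r / 2 : ℝ)) := by fun_prop
    exact (hc.tendsto v).comp hv
  have hdiff : Tendsto (fun n : ℕ => charFun (P.map fun ω => ∑ i, ξ n i ω) (Real.sqrt n)⁻¹ -
      ∏ i, Complex.exp (-(q n i : ℝ))) atTop (𝓝 0) := by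
    have hs0 : Tendsto (fun n : ℕ => (Real.sqrt n)⁻¹) atTop (𝓝 0) :=
      tendsto_inv_atTop_zero.comp (Real.tendsto_sqrt_atTop.comp tendsto_natCast_atTop_atTop)
    have hbound : Tendsto (fun n : ℕ => B ^ 3 * (Real.sqrt n)⁻¹ + B ^ 4 * (Real.sqrt n)⁻¹ ^ 2)
        atTop (𝓝 0) := by
      simpa using (hs0.const_mul (B ^ 3)).add ((hs0.pow 2).const_mul (B ^ 4))
    refine squeeze_zero_norm' ?_ hbound
    have hsmall : ∀ᶠ n : ℕ in atTop, (Real.sqrt n)⁻¹ * B < 1 := by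
      have : Tendsto (fun n : ℕ => (Real.sqrt n)⁻¹ * B) atTop (𝓝 0) := by
        simpa using hs0.mul_const B
      exact this.eventually (gt_mem_nhds one_pos)
    filter_upwards [hm, hind, hb, h0, hsmall, eventually_gt_atTop 0]
      with n hm hind hb h0 hsmall hn
    have hn' : (0 : ℝ) < n := by exact_mod_cast hn
    set s := (Real.sqrt n)⁻¹ with hs
    have hs_pos : 0 < s := by positivity
    have hs2 : s ^ 2 = (n : ℝ)⁻¹ := by rw [hs, inv_pow, Real.sq_sqrt hn'.le]
    have hsa : |s| * B ≤ 1 := by rw [abs_of_pos hs_pos]; exact hsmall.le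
    rw [hind.charFun_map_fun_sum_eq_prod fun i => (hm i).aemeasurable, Finset.prod_apply]
    have hEnn : ∀ i, 0 ≤ ∫ ω, ξ n i ω ^ 2 ∂P := fun i => integral_nonneg fun ω => sq_nonneg _
    have hE : ∀ i, ∫ ω, ξ n i ω ^ 2 ∂P ≤ B ^ 2 := by
      intro i
      refine (integral_mono_of_nonneg (Eventually.of_forall fun ω => sq_nonneg _)
        (integrable_const (B ^ 2)) ?_).trans (by simp)
      filter_upwards [hb i] with ω h
      exact sq_le_sq' (abs_le.1 h).1 (abs_le.1 h).2
    have hq0 : ∀ i, 0 ≤ q n i := fun i => by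
      have := hEnn i
      simp only [hq]; positivity
    have hqB : ∀ i, q n i ≤ s ^ 2 * B ^ 2 := fun i => by
      simp only [hq]
      rw [← hs2]
      have : s ^ 2 * (∫ ω, ξ n i ω ^ 2 ∂P) ≤ s ^ 2 * B ^ 2 := by gcongr; exact hE i
      have : 0 ≤ s ^ 2 * (∫ ω, ξ n i ω ^ 2 ∂P) := mul_nonneg (sq_nonneg _) (hEnn i)
      linarith
    refine (norm_prod_sub_prod_le _ _ _ (fun i _ => ?_) (fun i _ => ?_)).trans ?_
    · have : IsProbabilityMeasure (P.map (ξ n i)) :=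
        Measure.isProbabilityMeasure_map (hm i).aemeasurable
      exact norm_charFun_le_one (μ := P.map (ξ n i)) s
    · rw [← Complex.ofReal_neg, Complex.norm_exp_ofReal]
      exact Real.exp_le_one_iff.2 (by linarith [hq0 i])
    · have hterm : ∀ i ∈ Finset.univ, ‖charFun (P.map (ξ n i)) s - Complex.exp (-(q n i : ℝ))‖ ≤
          s ^ 3 * B ^ 3 + s ^ 4 * B ^ 4 := by
        intro i _
        have e1 := norm_charFun_sub_le (hm i) (hb i) (h0 i) hsa
        rw [abs_of_pos hs_pos] at e1
        have hq' : s ^ 2 * (∫ ω, ξ n i ω ^ 2 ∂P) / 2 = q n i := by simp only [hq]; rw [hs2]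
        rw [hq'] at e1
        have hq1 : q n i ≤ 1 := (hqB i).trans (by
          rw [← mul_pow]; exact pow_le_one₀ (by positivity) hsmall.le)
        have e2 : ‖((1 - q n i : ℝ) : ℂ) - Complex.exp (-(q n i : ℝ))‖ ≤ q n i ^ 2 := by
          rw [← Complex.ofReal_neg, ← Complex.ofReal_exp, ← Complex.ofReal_sub, Complex.norm_real,
            Real.norm_eq_abs, abs_sub_comm]
          have := Real.abs_exp_sub_one_sub_id_le (x := -q n i)
            (by rw [abs_neg, abs_of_nonneg (hq0 i)]; exact hq1)
          rw [neg_sq] at this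
          convert this using 2
          ring
        have e3 : q n i ^ 2 ≤ s ^ 4 * B ^ 4 := by
          calc q n i ^ 2 ≤ (s ^ 2 * B ^ 2) ^ 2 := by
                have := hq0 i
                gcongr
                exact hqB i
            _ = _ := by ring
        calc _ ≤ ‖charFun (P.map (ξ n i)) s - ((1 - q n i : ℝ) : ℂ)‖ +
              ‖((1 - q n i : ℝ) : ℂ) - Complex.exp (-(q n i : ℝ))‖ := norm_sub_le_norm_sub_add_norm_sub _ _ _
          _ ≤ _ := by
            rw [mul_pow] at e1
            linarith
      refine (Finset.sum_le_card_nsmul _ _ _ hterm).trans ?_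
      rw [Finset.card_univ, Fintype.card_fin, nsmul_eq_mul]
      have hns : (n : ℝ) * s ^ 2 = 1 := by rw [hs2, mul_inv_cancel₀ hn'.ne']
      refine le_of_eq ?_
      calc (n : ℝ) * (s ^ 3 * B ^ 3 + s ^ 4 * B ^ 4)
          = (n * s ^ 2) * (B ^ 3 * s + B ^ 4 * s ^ 2) := by ring
        _ = _ := by rw [hns, one_mul]
  have := hdiff.add hexp
  simpa using this

/-- Weak law of large numbers for a triangular array of uniformly bounded variables. -/
lemma tendsto_measure_mean_array (hm : ∀ᶠ n in atTop, ∀ i, Measurable (ξ n i))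
    (hind : ∀ᶠ n in atTop, iIndepFun (ξ n) P) (hb : ∀ᶠ n in atTop, ∀ i, ∀ᵐ ω ∂P, |ξ n i ω| ≤ B)
    {m : ℝ} (hmean : Tendsto (fun n : ℕ => (n : ℝ)⁻¹ * ∑ i, ∫ ω, ξ n i ω ∂P) atTop (𝓝 m))
    {ε : ℝ} (hε : 0 < ε) :
    Tendsto (fun n : ℕ => P {ω | ε ≤ |(n : ℝ)⁻¹ * ∑ i, ξ n i ω - m|}) atTop (𝓝 0) := by
  have hlim : Tendsto (fun n : ℕ => ENNReal.ofReal ((n : ℝ)⁻¹ * (B ^ 2 / (ε / 2) ^ 2))) atTop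
      (𝓝 0) := by
    have : Tendsto (fun n : ℕ => (n : ℝ)⁻¹ * (B ^ 2 / (ε / 2) ^ 2)) atTop (𝓝 0) := by
      simpa using (tendsto_inv_atTop_nhds_zero_nat (𝕜 := ℝ)).mul_const (B ^ 2 / (ε / 2) ^ 2)
    simpa using ENNReal.tendsto_ofReal this
  refine tendsto_of_tendsto_of_tendsto_of_le_of_le' tendsto_const_nhds hlim
    (Eventually.of_forall fun _ => zero_le) ?_
  have hclose : ∀ᶠ n : ℕ in atTop, |(n : ℝ)⁻¹ * ∑ i, ∫ ω, ξ n i ω ∂P - m| < ε / 2 := by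
    have := (tendsto_iff_dist_tendsto_zero.1 hmean).eventually (gt_mem_nhds (half_pos hε))
    simpa [Real.dist_eq] using this
  filter_upwards [hm, hind, hb, hclose, eventually_gt_atTop 0] with n hm hind hb hclose hn
  have hn' : (0 : ℝ) < n := by exact_mod_cast hn
  have hL : ∀ i, MemLp (ξ n i) 2 P := fun i =>
    MemLp.of_bound (hm i).aestronglyMeasurable B (hb i)
  have hSL : MemLp (∑ i, ξ n i) 2 P := memLp_finsetSum' _ fun i _ => hL i
  have hint : P[∑ i, ξ n i] = ∑ i, ∫ ω, ξ n i ω ∂P := by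
    simp only [Finset.sum_apply]
    exact integral_finsetSum _ fun i _ => (hL i).integrable (by norm_num)
  have hvar : Var[∑ i, ξ n i; P] ≤ n * B ^ 2 := by
    rw [IndepFun.variance_sum (fun i _ => hL i) fun i _ j _ hij => hind.indepFun hij]
    refine (Finset.sum_le_card_nsmul _ _ (B ^ 2) fun i _ => ?_).trans ?_
    · refine (variance_le_expectation_sq (hm i).aestronglyMeasurable).trans ?_
      refine (integral_mono_of_nonneg (Eventually.of_forall fun ω => sq_nonneg _)
        (integrable_const (B ^ 2)) ?_).trans (by simp)
      filter_upwards [hb i] with ω h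
      exact sq_le_sq' (abs_le.1 h).1 (abs_le.1 h).2
    · rw [Finset.card_univ, Fintype.card_fin, nsmul_eq_mul]
  have hcheb := meas_ge_le_variance_div_sq hSL (c := n * (ε / 2)) (by positivity)
  refine (measure_mono fun ω hω => ?_).trans (hcheb.trans (ENNReal.ofReal_le_ofReal ?_))
  · have hω : ε ≤ |(n : ℝ)⁻¹ * ∑ i, ξ n i ω - m| := hω
    rw [Set.mem_ofPred_eq, hint, Finset.sum_apply]
    have h1 : ε / 2 ≤ |(n : ℝ)⁻¹ * ∑ i, ξ n i ω - (n : ℝ)⁻¹ * ∑ i, ∫ ω, ξ n i ω ∂P| := by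
      have := abs_sub_le ((n : ℝ)⁻¹ * ∑ i, ξ n i ω) ((n : ℝ)⁻¹ * ∑ i, ∫ ω, ξ n i ω ∂P) m
      linarith
    rw [← mul_sub, abs_mul, abs_of_pos (inv_pos.2 hn'), inv_mul_eq_div, le_div_iff₀ hn'] at h1
    linarith
  · rw [div_le_iff₀ (by positivity)]
    refine hvar.trans (le_of_eq ?_)
    field_simp

open WithLp in
/-- Multivariate central limit theorem for a triangular array of uniformly bounded centred
vectors. -/
lemma tendstoInDistribution_sum_array {ι : Type*} [Fintype ι] [DecidableEq ι]
    {ζ : (n : ℕ) → Fin n → Ω → ι → ℝ} (hm : ∀ n i, Measurable (ζ n i))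
    (hind : ∀ᶠ n in atTop, iIndepFun (ζ n) P)
    (hb : ∀ᶠ n in atTop, ∀ i, ∀ᵐ ω ∂P, ∀ k, |ζ n i ω k| ≤ B)
    (h0 : ∀ᶠ n in atTop, ∀ i k, ∫ ω, ζ n i ω k ∂P = 0) {S : Matrix ι ι ℝ} (hS : S.PosSemidef)
    (hcov : ∀ k l, Tendsto (fun n : ℕ => (n : ℝ)⁻¹ * ∑ i, ∫ ω, ζ n i ω k * ζ n i ω l ∂P) atTop
      (𝓝 (S k l))) :
    TendstoInDistribution (fun (n : ℕ) ω => (Real.sqrt n)⁻¹ • ∑ i, ζ n i ω) atTop id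
      (fun _ => P) (gaussianVec S) := by
  have hmW : ∀ n : ℕ, Measurable fun ω => (Real.sqrt n)⁻¹ • ∑ i, ζ n i ω := fun n => by
    have h : Measurable fun ω => ∑ i, ζ n i ω := Finset.measurable_fun_sum _ fun i _ => hm n i
    exact h.const_smul (Real.sqrt n)⁻¹
  have hcl : TendstoInDistribution
      (fun (n : ℕ) ω => (toLp 2 ((Real.sqrt n)⁻¹ • ∑ i, ζ n i ω) : EuclideanSpace ℝ ι)) atTop id
      (fun _ => P) (multivariateGaussian 0 S) := by
    have hmE : ∀ n : ℕ, Measurable fun ω =>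
        (toLp 2 ((Real.sqrt n)⁻¹ • ∑ i, ζ n i ω) : EuclideanSpace ℝ ι) := fun n =>
      (WithLp.measurable_toLp 2 _).comp (hmW n)
    refine ⟨fun n => (hmE n).aemeasurable, aemeasurable_id,
      ProbabilityMeasure.tendsto_iff_tendsto_charFun.2 fun u => ?_⟩
    set ξ : (n : ℕ) → Fin n → Ω → ℝ := fun n i ω => ζ n i ω ⬝ᵥ u.ofLp with hξ
    have hdm : Measurable fun z : ι → ℝ => z ⬝ᵥ u.ofLp := by
      unfold dotProduct
      fun_prop
    have h1 : ∀ n : ℕ, charFun (P.map fun ω =>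
        (toLp 2 ((Real.sqrt n)⁻¹ • ∑ i, ζ n i ω) : EuclideanSpace ℝ ι)) u =
        charFun (P.map fun ω => ∑ i, ξ n i ω) (Real.sqrt n)⁻¹ := by
      intro n
      have hms : Measurable fun ω => ∑ i, ξ n i ω :=
        Finset.measurable_sum _ fun i _ => hdm.comp (hm n i)
      rw [charFun_apply, charFun_apply_real, integral_map (hmE n).aemeasurable (by fun_prop),
        integral_map hms.aemeasurable (by fun_prop)]
      refine integral_congr_ae (Eventually.of_forall fun ω => ?_)
      have : (inner ℝ (toLp 2 ((Real.sqrt n)⁻¹ • ∑ i, ζ n i ω) : EuclideanSpace ℝ ι) u : ℝ) =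
          (Real.sqrt n)⁻¹ * ∑ i, ξ n i ω := by
        rw [EuclideanSpace.inner_eq_star_dotProduct]
        simp only [star_trivial, dotProduct_smul, smul_eq_mul, hξ]
        rw [dotProduct_comm, ← sum_dotProduct]
      simp only [this]
      push_cast
      rfl
    have h2 : charFun (multivariateGaussian 0 S) u =
        Complex.exp (-((u.ofLp ⬝ᵥ (S *ᵥ u.ofLp)) / 2 : ℝ)) := by
      rw [charFun_multivariateGaussian hS]
      simp
    have h3 := tendsto_charFun_sum_array (P := P) (ξ := ξ) (B := B * ∑ k, |u.ofLp k|)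
      (v := u.ofLp ⬝ᵥ (S *ᵥ u.ofLp)) (Eventually.of_forall fun n i => hdm.comp (hm n i)) ?_ ?_ ?_ ?_
    · simp only [ProbabilityMeasure.coe_mk, h1, Measure.map_id, h2]
      exact h3
    · filter_upwards [hind] with n hn
      exact hn.comp (fun _ z => z ⬝ᵥ u.ofLp) fun _ => hdm
    · filter_upwards [hb] with n hn i
      filter_upwards [hn i] with ω hω
      simp only [hξ, dotProduct]
      rw [Finset.mul_sum]
      refine (Finset.abs_sum_le_sum_abs _ _).trans (Finset.sum_le_sum fun k _ => ?_)
      rw [abs_mul]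
      gcongr
      exact hω k
    · filter_upwards [hb, h0] with n hn h0 i
      simp only [hξ, dotProduct]
      rw [integral_finsetSum]
      · simp [integral_mul_const, h0]
      · intro k _
        refine (integrable_of_ae_abs_le (B := B) (by have := hm n i; fun_prop) ?_).mul_const _
        filter_upwards [hn i] with ω hω using hω k
    · have hlim : Tendsto (fun n : ℕ => ∑ k, ∑ l, u.ofLp k * u.ofLp l *
          ((n : ℝ)⁻¹ * ∑ i, ∫ ω, ζ n i ω k * ζ n i ω l ∂P)) atTop
          (𝓝 (∑ k, ∑ l, u.ofLp k * u.ofLp l * S k l)) :=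
        tendsto_finsetSum _ fun k _ => tendsto_finsetSum _ fun l _ => (hcov k l).const_mul _
      have hval : u.ofLp ⬝ᵥ (S *ᵥ u.ofLp) = ∑ k, ∑ l, u.ofLp k * u.ofLp l * S k l := by
        simp only [dotProduct, Matrix.mulVec, Finset.mul_sum]
        refine Finset.sum_congr rfl fun k _ => Finset.sum_congr rfl fun l _ => by ring
      rw [hval]
      refine hlim.congr' ?_
      filter_upwards [hb] with n hn
      have hint : ∀ i k l, Integrable (fun ω => ζ n i ω k * ζ n i ω l) P := by
        intro i k l
        refine integrable_of_ae_abs_le (B := B * B) (by have := hm n i; fun_prop) ?_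
        filter_upwards [hn i] with ω hω
        rw [abs_mul]
        exact mul_le_mul (hω k) (hω l) (abs_nonneg _) ((abs_nonneg _).trans (hω k))
      have hsq : ∀ i, ∫ ω, ξ n i ω ^ 2 ∂P =
          ∑ k, ∑ l, u.ofLp k * u.ofLp l * ∫ ω, ζ n i ω k * ζ n i ω l ∂P := by
        intro i
        have : (fun ω => ξ n i ω ^ 2) =
            fun ω => ∑ k, ∑ l, u.ofLp k * u.ofLp l * (ζ n i ω k * ζ n i ω l) := by
          funext ω
          simp only [hξ, dotProduct, sq, Finset.sum_mul_sum]
          refine Finset.sum_congr rfl fun k _ => Finset.sum_congr rfl fun l _ => by ring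
        rw [this, integral_finsetSum _ fun k _ => integrable_finsetSum _ fun l _ =>
          (hint i k l).const_mul _]
        refine Finset.sum_congr rfl fun k _ => ?_
        rw [integral_finsetSum _ fun l _ => (hint i k l).const_mul _]
        exact Finset.sum_congr rfl fun l _ => integral_const_mul _ _
      simp only [hsq, Finset.mul_sum]
      rw [Finset.sum_comm (s := (Finset.univ : Finset (Fin n)))]
      refine Finset.sum_congr rfl fun k _ => ?_
      rw [Finset.sum_comm (s := (Finset.univ : Finset (Fin n)))]
      exact Finset.sum_congr rfl fun l _ => Finset.sum_congr rfl fun i _ => by ring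
  have hof : Continuous (ofLp : EuclideanSpace ℝ ι → ι → ℝ) := by fun_prop
  have := hcl.continuous_comp hof
  refine ⟨fun n => (hmW n).aemeasurable, aemeasurable_id, ?_⟩
  convert this.tendsto using 2
  · simp only [gaussianVec, Measure.map_id]
    rfl

end Limit

/-! ### The exponential family: the score has conditional mean zero -/

section GLM

variable {ν : Measure ℝ} {Y : Set ℝ} {a c : ℝ → ℝ}

/-- The member of the exponential family with natural parameter `t`. -/
noncomputable def expFamily (ν : Measure ℝ) (a c : ℝ → ℝ) (t : ℝ) : Measure ℝ :=
  ν.withDensity fun v => ENNReal.ofReal (Real.exp (v * t - a t) * c v)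

lemma IsGLM.isProbabilityMeasure (h : IsGLM ν Y a c) (t : ℝ) :
    IsProbabilityMeasure (expFamily ν a c t) :=
  ⟨by rw [expFamily, withDensity_apply _ MeasurableSet.univ, Measure.restrict_univ, h.density]⟩

lemma IsGLM.expFamily_eq (h : IsGLM ν Y a c) (t : ℝ) :
    expFamily ν a c t = (ν.withDensity fun v => ENNReal.ofReal (c v)).withDensity
      fun v => ENNReal.ofReal (Real.exp (v * t - a t)) := by
  have hc := h.measurable_c
  rw [expFamily, ← withDensity_mul _ (by fun_prop) (by fun_prop)]
  congr 1
  ext v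
  rw [Pi.mul_apply, ENNReal.ofReal_mul (Real.exp_pos _).le]
  exact mul_comm _ _

lemma IsGLM.lintegral_exp (h : IsGLM ν Y a c) (t : ℝ) :
    ∫⁻ v, ENNReal.ofReal (Real.exp (t * v)) ∂(ν.withDensity fun v => ENNReal.ofReal (c v)) =
      ENNReal.ofReal (Real.exp (a t)) := by
  have h1 := (h.isProbabilityMeasure t).measure_univ
  rw [h.expFamily_eq, withDensity_apply _ MeasurableSet.univ, Measure.restrict_univ] at h1
  have h2 : (fun v => ENNReal.ofReal (Real.exp (t * v))) =
      fun v => ENNReal.ofReal (Real.exp (a t)) * ENNReal.ofReal (Real.exp (v * t - a t)) := by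
    funext v
    rw [← ENNReal.ofReal_mul (Real.exp_pos _).le, ← Real.exp_add]
    congr 2
    ring
  rw [h2, lintegral_const_mul _ (by fun_prop), h1, mul_one]

/-- The mean of an exponential family is the derivative of its cumulant function. -/
lemma IsGLM.integral_id (h : IsGLM ν Y a c) (ha : Differentiable ℝ a) (t : ℝ) :
    Integrable (fun v => v) (expFamily ν a c t) ∧ ∫ v, v ∂(expFamily ν a c t) = deriv a t := by
  set m := ν.withDensity fun v => ENNReal.ofReal (c v) with hm
  have hint : ∀ t, Integrable (fun v => Real.exp (t * v)) m := by
    intro t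
    refine ⟨by fun_prop, ?_⟩
    rw [hasFiniteIntegral_iff_ofReal (Eventually.of_forall fun v => (Real.exp_pos _).le),
      h.lintegral_exp]
    exact ENNReal.ofReal_lt_top
  have hmgf : mgf (fun v : ℝ => v) m = fun t => Real.exp (a t) := by
    funext t
    rw [mgf, integral_eq_lintegral_of_nonneg_ae
      (Eventually.of_forall fun v => (Real.exp_pos _).le) (by fun_prop), h.lintegral_exp,
      ENNReal.toReal_ofReal (Real.exp_pos _).le]
  have hset : integrableExpSet (fun v : ℝ => v) m = Set.univ := Set.eq_univ_of_forall hint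
  have hmem : t ∈ interior (integrableExpSet (fun v : ℝ => v) m) := by
    rw [hset, interior_univ]; trivial
  have hd := deriv_mgf hmem
  have hd2 : deriv (mgf (fun v : ℝ => v) m) t = Real.exp (a t) * deriv a t := by
    rw [hmgf]
    exact ((ha t).hasDerivAt.exp).deriv
  have hi : Integrable (fun v : ℝ => v ^ 1 * Real.exp (t * v)) m :=
    integrable_pow_mul_exp_of_mem_interior_integrableExpSet hmem 1
  have hdens : Measurable fun v : ℝ => ENNReal.ofReal (Real.exp (v * t - a t)) := by fun_prop
  have hlt : ∀ᵐ v ∂m, ENNReal.ofReal (Real.exp (v * t - a t)) < ∞ :=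
    Eventually.of_forall fun v => ENNReal.ofReal_lt_top
  have he : ∀ v : ℝ, (ENNReal.ofReal (Real.exp (v * t - a t))).toReal • v =
      Real.exp (-a t) * (v ^ 1 * Real.exp (t * v)) := by
    intro v
    rw [ENNReal.toReal_ofReal (Real.exp_pos _).le, smul_eq_mul, pow_one, sub_eq_add_neg,
      Real.exp_add, mul_comm v t]
    ring
  -- the family is the exponential tilt of `m`, whose moment generating function is `exp ∘ a`
  rw [h.expFamily_eq, ← hm]
  constructor
  · rw [integrable_withDensity_iff_integrable_smul' hdens hlt]
    simp only [he]
    exact hi.const_mul _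
  · rw [integral_withDensity_eq_integral_toReal_smul hdens hlt]
    simp only [he]
    rw [integral_const_mul]
    simp only [pow_one]
    rw [← hd, hd2, ← mul_assoc, ← Real.exp_add]
    simp

lemma IsGLM.nonempty (h : IsGLM ν Y a c) : Y.Nonempty := by
  by_contra hY
  rw [Set.not_nonempty_iff_eq_empty] at hY
  have h1 := h.ae_mem
  rw [hY] at h1
  have h2 : ν = 0 := by simpa using h1
  have h3 := h.density 0
  rw [h2] at h3
  simp at h3

variable {Ω : Type*} [MeasurableSpace Ω] {P : Measure Ω} {d : ℕ}
  {θ : Fin d → ℝ} {x : Ω → Fin d → ℝ} {y : Ω → ℝ}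

lemma HasGLMDensity.ae_mem (hd : HasGLMDensity P ν a c θ x y) (h : IsGLM ν Y a c) :
    ∀ᵐ ω ∂P, y ω ∈ Y := by
  obtain ⟨N, hN, hNm, hN0⟩ := exists_measurable_superset_of_null (ae_iff.1 h.ae_mem)
  have h1 := hd Set.univ N MeasurableSet.univ hNm
  have h2 : ∀ g : ℝ → ℝ≥0∞, ∫⁻ v in N, g v ∂ν = 0 := fun g => by
    rw [Measure.restrict_eq_zero.2 hN0, lintegral_zero_measure]
  simp only [h2, Set.preimage_univ, Set.univ_inter, lintegral_zero] at h1
  exact measure_mono_null (fun ω hω => hN hω) h1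

/-- The score `φ(x) (a'(x'θ) - y)` has mean zero. -/
lemma HasGLMDensity.integral_score_eq_zero [IsProbabilityMeasure P] [SigmaFinite ν]
    (hd : HasGLMDensity P ν a c θ x y)
    (h : IsGLM ν Y a c) (ha : Differentiable ℝ a) (hx : Measurable x) (hy : Measurable y)
    {φ : (Fin d → ℝ) → ℝ} (hφ : Measurable φ)
    (hint : Integrable (fun ω => φ (x ω) * (deriv a (x ω ⬝ᵥ θ) - y ω)) P) :
    ∫ ω, φ (x ω) * (deriv a (x ω ⬝ᵥ θ) - y ω) ∂P = 0 := by
  have hdot : Measurable fun z : Fin d → ℝ => z ⬝ᵥ θ := by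
    unfold dotProduct
    fun_prop
  have hc := h.measurable_c
  have ham : Measurable a := ha.continuous.measurable
  set f : (Fin d → ℝ) → ℝ → ℝ≥0∞ := fun z v =>
    ENNReal.ofReal (Real.exp (v * (z ⬝ᵥ θ) - a (z ⬝ᵥ θ)) * c v) with hf
  have hfm : Measurable (Function.uncurry f) := by
    simp only [hf, Function.uncurry_def]
    fun_prop
  set κ : Kernel (Fin d → ℝ) ℝ := Kernel.withDensity (Kernel.const _ ν) f with hκ
  have hκa : ∀ z, κ z = expFamily ν a c (z ⬝ᵥ θ) := fun z => by
    rw [hκ, Kernel.withDensity_apply _ hfm, Kernel.const_apply]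
    rfl
  have : IsMarkovKernel κ := ⟨fun z => by rw [hκa]; exact h.isProbabilityMeasure _⟩
  have : IsProbabilityMeasure (P.map x) := Measure.isProbabilityMeasure_map hx.aemeasurable
  have : IsProbabilityMeasure (P.map fun ω => (x ω, y ω)) :=
    Measure.isProbabilityMeasure_map (hx.prodMk hy).aemeasurable
  -- the conditional density amounts to a disintegration of the joint law along `κ`
  have hjoint : P.map (fun ω => (x ω, y ω)) = (P.map x) ⊗ₘ κ := by
    refine Measure.ext_prod fun {s B} hs hB => ?_
    rw [Measure.map_apply (hx.prodMk hy) (hs.prod hB), Measure.compProd_apply_prod hs hB,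
      setLIntegral_map hs (κ.measurable_coe hB) hx]
    have : (fun ω => (x ω, y ω)) ⁻¹' s ×ˢ B = x ⁻¹' s ∩ y ⁻¹' B := rfl
    rw [this, hd s B hs hB]
    refine lintegral_congr fun ω => ?_
    rw [hκa, expFamily, withDensity_apply _ hB]
  set G : (Fin d → ℝ) × ℝ → ℝ := fun q => φ q.1 * (deriv a (q.1 ⬝ᵥ θ) - q.2) with hG
  have hda : Measurable (deriv a) := measurable_deriv a
  have hGm : Measurable G := by
    simp only [hG]
    exact (hφ.comp measurable_fst).mul
      ((hda.comp (hdot.comp measurable_fst)).sub measurable_snd)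
  have hGi : Integrable G ((P.map x) ⊗ₘ κ) := by
    rw [← hjoint, integrable_map_measure hGm.aestronglyMeasurable (hx.prodMk hy).aemeasurable]
    exact hint
  have h1 : ∫ ω, φ (x ω) * (deriv a (x ω ⬝ᵥ θ) - y ω) ∂P = ∫ q, G q ∂((P.map x) ⊗ₘ κ) := by
    rw [← hjoint, integral_map (hx.prodMk hy).aemeasurable hGm.aestronglyMeasurable]
  rw [h1, Measure.integral_compProd hGi]
  refine (integral_congr_ae (Eventually.of_forall fun z => ?_)).trans (integral_zero _ _)
  have := h.isProbabilityMeasure (z ⬝ᵥ θ)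
  obtain ⟨hi, hv⟩ := h.integral_id ha (z ⬝ᵥ θ)
  simp only [hG]
  rw [hκa, integral_const_mul, integral_sub (integrable_const _) hi, hv]
  simp

end GLM

/-! ### Quadratic expansion of the criterion and localization of the Lasso -/

section Loss

variable {a : ℝ → ℝ} (c : ℝ → ℝ)

lemma hasDerivAt_loss (ha : Differentiable ℝ a) (y t : ℝ) :
    HasDerivAt (loss a c y) (deriv a t - y) t := by
  unfold loss
  simpa using ((ha t).hasDerivAt.sub ((hasDerivAt_id t).const_mul y)).sub_const (Real.log (c y))

lemma loss1_eq (ha : Differentiable ℝ a) (y t : ℝ) : loss1 a c y t = deriv a t - y :=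
  (hasDerivAt_loss c ha y t).deriv

lemma loss2_eq (ha : Differentiable ℝ a) (y t : ℝ) : loss2 a c y t = deriv (deriv a) t := by
  have h : deriv (loss a c y) = fun t => deriv a t - y :=
    funext fun t => (hasDerivAt_loss c ha y t).deriv
  rw [loss2, h, deriv_sub_const]

lemma loss_sub_loss (y t u : ℝ) : loss a c y t - loss a c y u = a t - a u - y * (t - u) := by
  unfold loss; ring

end Loss

section Taylor

variable {a : ℝ → ℝ} {t₀ L B η : ℝ}

/-- First order expansion of `a'` at `t₀`, when `a''` is Lipschitz around `t₀`. -/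
lemma abs_deriv_taylor_le (ha' : Differentiable ℝ (deriv a)) (hL : 0 ≤ L)
    (hlip : ∀ t, |t - t₀| ≤ η → |deriv (deriv a) t - deriv (deriv a) t₀| ≤ L * |t - t₀|)
    {t : ℝ} (ht : |t - t₀| ≤ η) :
    |deriv a t - deriv a t₀ - deriv (deriv a) t₀ * (t - t₀)| ≤ L * |t - t₀| ^ 2 := by
  set e := |t - t₀|
  have hsub : ∀ s ∈ Set.uIcc t₀ t, |s - t₀| ≤ e := fun s hs => Set.abs_sub_left_of_mem_uIcc hs
  have hd : ∀ s ∈ Set.uIcc t₀ t, HasDerivWithinAt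
      (fun s => deriv a s - deriv (deriv a) t₀ * (s - t₀))
      (deriv (deriv a) s - deriv (deriv a) t₀) (Set.uIcc t₀ t) s := by
    intro s _
    have h := (ha' s).hasDerivAt.sub (((hasDerivAt_id s).sub_const t₀).const_mul
      (deriv (deriv a) t₀))
    exact (h.congr_deriv (by simp)).hasDerivWithinAt
  have h := (convex_uIcc t₀ t).norm_image_sub_le_of_norm_hasDerivWithin_le (C := L * e) hd
    (fun s hs => (hlip s ((hsub s hs).trans ht)).trans (by gcongr; exact hsub s hs))
    Set.left_mem_uIcc Set.right_mem_uIcc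
  simp only [Real.norm_eq_abs, sub_self, mul_zero, sub_zero] at h
  calc _ = |deriv a t - deriv (deriv a) t₀ * (t - t₀) - deriv a t₀| := by congr 1; ring
    _ ≤ L * e * e := h
    _ = _ := by ring

/-- Second order expansion of `a` at `t₀`. -/
lemma abs_taylor_two_le (ha : Differentiable ℝ a) (ha' : Differentiable ℝ (deriv a)) (hL : 0 ≤ L)
    (hlip : ∀ t, |t - t₀| ≤ η → |deriv (deriv a) t - deriv (deriv a) t₀| ≤ L * |t - t₀|)
    {t : ℝ} (ht : |t - t₀| ≤ η) :
    |a t - a t₀ - deriv a t₀ * (t - t₀) - deriv (deriv a) t₀ * (t - t₀) ^ 2 / 2| ≤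
      L * |t - t₀| ^ 3 := by
  set e := |t - t₀|
  have hsub : ∀ s ∈ Set.uIcc t₀ t, |s - t₀| ≤ e := fun s hs => Set.abs_sub_left_of_mem_uIcc hs
  have hd : ∀ s ∈ Set.uIcc t₀ t, HasDerivWithinAt
      (fun s => a s - deriv a t₀ * (s - t₀) - deriv (deriv a) t₀ * (s - t₀) ^ 2 / 2)
      (deriv a s - deriv a t₀ - deriv (deriv a) t₀ * (s - t₀)) (Set.uIcc t₀ t) s := by
    intro s _
    have h1 := ((hasDerivAt_id s).sub_const t₀)
    have h := ((ha s).hasDerivAt.sub (h1.const_mul (deriv a t₀))).sub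
      (((h1.pow 2).const_mul (deriv (deriv a) t₀)).div_const 2)
    refine (h.congr_deriv ?_).hasDerivWithinAt
    simp
    ring
  have h := (convex_uIcc t₀ t).norm_image_sub_le_of_norm_hasDerivWithin_le (C := L * e ^ 2) hd
    (fun s hs => (abs_deriv_taylor_le ha' hL hlip ((hsub s hs).trans ht)).trans
      (by gcongr; exact hsub s hs))
    Set.left_mem_uIcc Set.right_mem_uIcc
  simp only [Real.norm_eq_abs, sub_self, mul_zero, sub_zero] at h
  calc _ = |a t - deriv a t₀ * (t - t₀) - deriv (deriv a) t₀ * (t - t₀) ^ 2 / 2 -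
        (a t₀ - deriv (deriv a) t₀ * 0 ^ 2 / 2)| := by congr 1; ring
    _ ≤ L * e ^ 2 * e := h
    _ = _ := by ring

lemma abs_deriv_sub_le (ha' : Differentiable ℝ (deriv a))
    (hB : ∀ t, |t - t₀| ≤ η → |deriv (deriv a) t| ≤ B) {t : ℝ} (ht : |t - t₀| ≤ η) :
    |deriv a t - deriv a t₀| ≤ B * |t - t₀| := by
  have hsub : ∀ s ∈ Set.uIcc t₀ t, |s - t₀| ≤ |t - t₀| :=
    fun s hs => Set.abs_sub_left_of_mem_uIcc hs
  exact (convex_uIcc t₀ t).norm_image_sub_le_of_norm_hasDerivWithin_le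
    (fun s _ => (ha' s).hasDerivAt.hasDerivWithinAt) (fun s hs => hB s ((hsub s hs).trans ht))
    Set.left_mem_uIcc Set.right_mem_uIcc

end Taylor

lemma abs_mean_le {n : ℕ} {f : Fin n → ℝ} {K : ℝ} (hK : 0 ≤ K) (hf : ∀ i, |f i| ≤ K) :
    |(n : ℝ)⁻¹ * ∑ i, f i| ≤ K := by
  rcases Nat.eq_zero_or_pos n with rfl | hn
  · simpa using hK
  have hn' : (0 : ℝ) < n := by exact_mod_cast hn
  rw [abs_mul, abs_of_pos (inv_pos.2 hn'), inv_mul_le_iff₀ hn']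
  refine (Finset.abs_sum_le_sum_abs _ _).trans ((Finset.sum_le_card_nsmul _ _ K
    fun i _ => hf i).trans ?_)
  simp

lemma abs_dotProduct_le {d : ℕ} {x u : Fin d → ℝ} {B ρ : ℝ} (hx : ∀ k, |x k| ≤ B)
    (hu : ‖u‖ ≤ ρ) : |x ⬝ᵥ u| ≤ d * (B * ρ) := by
  refine (Finset.abs_sum_le_sum_abs _ _).trans ((Finset.sum_le_card_nsmul _ _ (B * ρ)
    fun k _ => ?_).trans ?_)
  · rw [abs_mul]
    exact mul_le_mul (hx k) ((norm_le_pi_norm u k).trans hu) (abs_nonneg _)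
      ((abs_nonneg _).trans (hx k))
  · simp

/-- The bounds which a sample satisfies almost surely under the regularity conditions: bounded
covariates, weights and scores at `θ₀`, and `a''` bounded and Lipschitz near the linear
predictors. -/
structure BoundedSample {n p : ℕ} (a : ℝ → ℝ) (D : Sample n p) (θ₀ : Fin (p + 1) → ℝ)
    (B L η : ℝ) : Prop where
  x_le : ∀ i k, |D.x i k| ≤ B
  w_nonneg : ∀ i, 0 ≤ D.w i
  w_le : ∀ i, D.w i ≤ B
  score_le : ∀ i, |deriv a (D.x i ⬝ᵥ θ₀) - D.y i| ≤ B
  lip : ∀ i t, |t - D.x i ⬝ᵥ θ₀| ≤ η →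
    |deriv (deriv a) t - deriv (deriv a) (D.x i ⬝ᵥ θ₀)| ≤ L * |t - D.x i ⬝ᵥ θ₀|
  hess_le : ∀ i t, |t - D.x i ⬝ᵥ θ₀| ≤ η → |deriv (deriv a) t| ≤ B

section Deterministic

variable {n p : ℕ} {a : ℝ → ℝ} (c : ℝ → ℝ) {D : Sample n p} {θ₀ θ : Fin (p + 1) → ℝ}
  {B L η ρ : ℝ}

section Bounds

variable (ha : Differentiable ℝ a) (ha' : Differentiable ℝ (deriv a)) (hB : 0 ≤ B) (hL : 0 ≤ L)
  (hD : BoundedSample a D θ₀ B L η) (hρ : ‖θ - θ₀‖ ≤ ρ) (hρη : (p + 1) * (B * ρ) ≤ η)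

include hD hρ in
lemma abs_predictor_sub_le (i : Fin n) :
    |D.x i ⬝ᵥ θ - D.x i ⬝ᵥ θ₀| ≤ (p + 1) * (B * ρ) := by
  rw [← dotProduct_sub]
  simpa using abs_dotProduct_le (hD.x_le i) hρ

include ha hB hL hD hρ hρη in
lemma abs_hess_sub_le (k l : Fin (p + 1)) :
    |hess a c D θ k l - hess a c D θ₀ k l| ≤ B ^ 3 * (L * ((p + 1) * (B * ρ))) := by
  have hρ0 : 0 ≤ ρ := (norm_nonneg _).trans hρ
  simp only [hess, Matrix.of_apply, loss2_eq c ha]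
  rw [← mul_sub, ← Finset.sum_sub_distrib]
  refine abs_mean_le (by positivity) fun i => ?_
  have h1 := abs_predictor_sub_le hD hρ i
  have h2 := hD.lip i _ (h1.trans hρη)
  rw [← mul_sub, abs_mul, abs_mul, abs_mul, abs_of_nonneg (hD.w_nonneg i)]
  calc _ ≤ B * (B * B) * (L * ((p + 1) * (B * ρ))) := by
        gcongr
        · exact hD.w_le i
        · exact hD.x_le i k
        · exact hD.x_le i l
        · exact h2.trans (by gcongr)
    _ = _ := by ring

include ha ha' hB hD hρ hρη in
lemma abs_info_sub_le (k l : Fin (p + 1)) :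
    |info a c D θ k l - info a c D θ₀ k l| ≤
      B ^ 4 * (B * ((p + 1) * (B * ρ)) * (2 * B + B * ((p + 1) * (B * ρ)))) := by
  have hρ0 : 0 ≤ ρ := (norm_nonneg _).trans hρ
  simp only [info, Matrix.of_apply, loss1_eq c ha]
  rw [← mul_sub, ← Finset.sum_sub_distrib]
  refine abs_mean_le (by positivity) fun i => ?_
  have h1 := abs_predictor_sub_le hD hρ i
  have h2 := (abs_deriv_sub_le ha' (hD.hess_le i) (h1.trans hρη)).trans
    (mul_le_mul_of_nonneg_left h1 hB)
  set e := B * ((p + 1) * (B * ρ))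
  have h3 := hD.score_le i
  set u := deriv a (D.x i ⬝ᵥ θ)
  set v := deriv a (D.x i ⬝ᵥ θ₀)
  have h4 : |(u - D.y i) ^ 2 - (v - D.y i) ^ 2| ≤ e * (2 * B + e) := by
    have : (u - D.y i) ^ 2 - (v - D.y i) ^ 2 = (u - v) * (2 * (v - D.y i) + (u - v)) := by ring
    rw [this, abs_mul]
    refine mul_le_mul h2 ((abs_add_le _ _).trans (add_le_add ?_ h2)) (abs_nonneg _)
      ((abs_nonneg _).trans h2)
    rw [abs_mul, abs_two]
    gcongr
  rw [← mul_sub, abs_mul, abs_mul, abs_mul, abs_pow, abs_of_nonneg (hD.w_nonneg i)]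
  calc _ ≤ B ^ 2 * (B * B) * (e * (2 * B + e)) := by
        have := hD.w_nonneg i
        gcongr
        · exact hD.w_le i
        · exact hD.x_le i k
        · exact hD.x_le i l
    _ = _ := by ring

lemma hess_mulVec (ha : Differentiable ℝ a) (u : Fin (p + 1) → ℝ) (k : Fin (p + 1)) :
    (hess a c D θ *ᵥ u) k =
      (n : ℝ)⁻¹ * ∑ i, D.w i * D.x i k * (deriv (deriv a) (D.x i ⬝ᵥ θ) * (D.x i ⬝ᵥ u)) := by
  simp only [Matrix.mulVec, dotProduct, hess, Matrix.of_apply, loss2_eq c ha]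
  simp only [Finset.mul_sum, Finset.sum_mul]
  rw [Finset.sum_comm]
  exact Finset.sum_congr rfl fun i _ => Finset.sum_congr rfl fun l _ => by ring

include ha ha' hB hL hD hρ hρη in
/-- Linearization of the score. -/
lemma abs_score_taylor_le (k : Fin (p + 1)) :
    |score a c D θ k - score a c D θ₀ k + (hess a c D θ₀ *ᵥ (θ - θ₀)) k| ≤
      B ^ 2 * (L * ((p + 1) * (B * ρ)) ^ 2) := by
  have hρ0 : 0 ≤ ρ := (norm_nonneg _).trans hρ
  rw [hess_mulVec c ha]
  simp only [score, loss1_eq c ha]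
  have : -((n : ℝ)⁻¹ * ∑ i, D.w i * D.x i k * (deriv a (D.x i ⬝ᵥ θ) - D.y i)) -
      -((n : ℝ)⁻¹ * ∑ i, D.w i * D.x i k * (deriv a (D.x i ⬝ᵥ θ₀) - D.y i)) +
      (n : ℝ)⁻¹ * ∑ i, D.w i * D.x i k * (deriv (deriv a) (D.x i ⬝ᵥ θ₀) *
        (D.x i ⬝ᵥ (θ - θ₀))) =
      -((n : ℝ)⁻¹ * ∑ i, D.w i * D.x i k * (deriv a (D.x i ⬝ᵥ θ) - deriv a (D.x i ⬝ᵥ θ₀) -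
        deriv (deriv a) (D.x i ⬝ᵥ θ₀) * (D.x i ⬝ᵥ θ - D.x i ⬝ᵥ θ₀))) := by
    simp only [dotProduct_sub, mul_sub, Finset.sum_sub_distrib]
    ring
  rw [this, abs_neg]
  refine abs_mean_le (by positivity) fun i => ?_
  have h1 := abs_predictor_sub_le hD hρ i
  have h2 := abs_deriv_taylor_le ha' hL (hD.lip i) (h1.trans hρη)
  rw [abs_mul, abs_mul, abs_of_nonneg (hD.w_nonneg i)]
  calc _ ≤ B * B * (L * ((p + 1) * (B * ρ)) ^ 2) := by
        gcongr
        · exact hD.w_le i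
        · exact hD.x_le i k
        · exact h2.trans (by gcongr)
    _ = _ := by ring

lemma score_dotProduct (ha : Differentiable ℝ a) (u : Fin (p + 1) → ℝ) :
    score a c D θ ⬝ᵥ u =
      -((n : ℝ)⁻¹ * ∑ i, D.w i * ((deriv a (D.x i ⬝ᵥ θ) - D.y i) * (D.x i ⬝ᵥ u))) := by
  simp only [dotProduct, score, loss1_eq c ha]
  simp only [Finset.mul_sum, Finset.sum_mul, neg_mul, Finset.sum_neg_distrib]
  rw [Finset.sum_comm]
  congr 1
  exact Finset.sum_congr rfl fun i _ => Finset.sum_congr rfl fun l _ => by ring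

lemma dotProduct_hess_mulVec (ha : Differentiable ℝ a) (u : Fin (p + 1) → ℝ) :
    u ⬝ᵥ (hess a c D θ *ᵥ u) =
      (n : ℝ)⁻¹ * ∑ i, D.w i * (deriv (deriv a) (D.x i ⬝ᵥ θ) * (D.x i ⬝ᵥ u) ^ 2) := by
  have h : ∀ i, D.w i * (deriv (deriv a) (D.x i ⬝ᵥ θ) * (D.x i ⬝ᵥ u) ^ 2) =
      ∑ k, u k * (D.w i * D.x i k * (deriv (deriv a) (D.x i ⬝ᵥ θ) * (D.x i ⬝ᵥ u))) := by
    intro i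
    rw [sq]
    nth_rw 2 [dotProduct]
    simp only [Finset.mul_sum, Finset.sum_mul]
    exact Finset.sum_congr rfl fun k _ => by ring
  rw [dotProduct]
  simp only [hess_mulVec c ha, h]
  rw [Finset.sum_comm, Finset.mul_sum]
  refine Finset.sum_congr rfl fun k _ => ?_
  simp only [Finset.mul_sum]
  exact Finset.sum_congr rfl fun i _ => by ring

include ha ha' hB hL hD hρ hρη in
/-- Quadratic lower bound for the excess loss. -/
lemma neg_logLik_sub_ge :
    -(score a c D θ₀ ⬝ᵥ (θ - θ₀)) + (θ - θ₀) ⬝ᵥ (hess a c D θ₀ *ᵥ (θ - θ₀)) / 2 -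
        B * (L * ((p + 1) * (B * ρ)) ^ 3) ≤ -logLik a c D θ - -logLik a c D θ₀ := by
  have hρ0 : 0 ≤ ρ := (norm_nonneg _).trans hρ
  rw [score_dotProduct c ha, dotProduct_hess_mulVec c ha]
  simp only [logLik, neg_neg]
  have hmain := abs_mean_le (n := n) (K := B * (L * ((p + 1) * (B * ρ)) ^ 3)) (by positivity)
    (f := fun i => D.w i * (a (D.x i ⬝ᵥ θ) - a (D.x i ⬝ᵥ θ₀) -
      deriv a (D.x i ⬝ᵥ θ₀) * (D.x i ⬝ᵥ θ - D.x i ⬝ᵥ θ₀) -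
      deriv (deriv a) (D.x i ⬝ᵥ θ₀) * (D.x i ⬝ᵥ θ - D.x i ⬝ᵥ θ₀) ^ 2 / 2)) (fun i => by
    have h1 := abs_predictor_sub_le hD hρ i
    have h2 := abs_taylor_two_le ha ha' hL (hD.lip i) (h1.trans hρη)
    rw [abs_mul, abs_of_nonneg (hD.w_nonneg i)]
    gcongr
    · exact hD.w_le i
    · exact h2.trans (by gcongr))
  have hsum : (n : ℝ)⁻¹ * ∑ i, D.w i * loss a c (D.y i) (D.x i ⬝ᵥ θ) -
      (n : ℝ)⁻¹ * ∑ i, D.w i * loss a c (D.y i) (D.x i ⬝ᵥ θ₀) =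
      (n : ℝ)⁻¹ * ∑ i, D.w i * ((deriv a (D.x i ⬝ᵥ θ₀) - D.y i) * (D.x i ⬝ᵥ (θ - θ₀))) +
      (n : ℝ)⁻¹ * (∑ i, D.w i * (deriv (deriv a) (D.x i ⬝ᵥ θ₀) * (D.x i ⬝ᵥ (θ - θ₀)) ^ 2)) / 2 +
      (n : ℝ)⁻¹ * ∑ i, D.w i * (a (D.x i ⬝ᵥ θ) - a (D.x i ⬝ᵥ θ₀) -
      deriv a (D.x i ⬝ᵥ θ₀) * (D.x i ⬝ᵥ θ - D.x i ⬝ᵥ θ₀) -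
      deriv (deriv a) (D.x i ⬝ᵥ θ₀) * (D.x i ⬝ᵥ θ - D.x i ⬝ᵥ θ₀) ^ 2 / 2) := by
    rw [← mul_sub, mul_div_assoc, ← mul_add, ← mul_add, Finset.sum_div, ← Finset.sum_sub_distrib,
      ← Finset.sum_add_distrib, ← Finset.sum_add_distrib]
    congr 1
    refine Finset.sum_congr rfl fun i _ => ?_
    rw [← mul_sub, loss_sub_loss, dotProduct_sub]
    ring
  rw [hsum]
  linarith [(abs_le.1 hmain).1]

end Bounds

section Criterion

lemma hasDerivAt_neg_logLik_line (ha : Differentiable ℝ a) (v : Fin (p + 1) → ℝ) :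
    HasDerivAt (fun τ : ℝ => -logLik a c D (θ + τ • v)) (-(score a c D θ ⬝ᵥ v)) 0 := by
  rw [score_dotProduct c ha, neg_neg]
  simp only [logLik, neg_neg]
  refine HasDerivAt.const_mul _ (HasDerivAt.fun_sum fun i _ => HasDerivAt.const_mul _ ?_)
  have h1 : HasDerivAt (fun τ : ℝ => D.x i ⬝ᵥ (θ + τ • v)) (D.x i ⬝ᵥ v) 0 := by
    have : (fun τ : ℝ => D.x i ⬝ᵥ (θ + τ • v)) =
        fun τ : ℝ => D.x i ⬝ᵥ θ + τ * (D.x i ⬝ᵥ v) := by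
      funext τ
      rw [dotProduct_add, dotProduct_smul, smul_eq_mul]
    rw [this]
    simpa using ((hasDerivAt_id (0 : ℝ)).mul_const (D.x i ⬝ᵥ v)).const_add (D.x i ⬝ᵥ θ)
  have h2 : HasDerivAt (loss a c (D.y i)) (deriv a (D.x i ⬝ᵥ θ) - D.y i)
      (D.x i ⬝ᵥ (θ + (0 : ℝ) • v)) := by
    simpa using hasDerivAt_loss c ha (D.y i) (D.x i ⬝ᵥ θ)
  exact h2.comp (0 : ℝ) h1

/-- Variational inequality for a Lasso solution. -/
lemma IsLasso.score_dotProduct_le (ha : Differentiable ℝ a) {lam : ℝ} (hlam : 0 ≤ lam)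
    (h : IsLasso a c D lam θ) (v : Fin (p + 1) → ℝ) :
    score a c D θ ⬝ᵥ v ≤ lam * ∑ k : Fin p, (|θ k.succ + v k.succ| - |θ k.succ|) := by
  set G : ℝ := lam * ∑ k : Fin p, (|θ k.succ + v k.succ| - |θ k.succ|) with hG
  have hd : HasDerivAt (fun τ : ℝ => -logLik a c D (θ + τ • v) + τ * G)
      (-(score a c D θ ⬝ᵥ v) + G) 0 := by
    exact ((hasDerivAt_neg_logLik_line c (D := D) (θ := θ) ha v).add
      ((hasDerivAt_id (0 : ℝ)).mul_const G)).congr_deriv (by simp)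
  have hge : ∀ τ ∈ Set.Ioo (0 : ℝ) 1,
      -logLik a c D (θ + (0 : ℝ) • v) + 0 * G ≤ -logLik a c D (θ + τ • v) + τ * G := by
    intro τ hτ
    have h1 := h (θ + τ • v)
    have h2 : lam * ∑ k : Fin p, |(θ + τ • v) k.succ| ≤
        lam * ∑ k : Fin p, |θ k.succ| + τ * G := by
      rw [hG, mul_left_comm τ, ← mul_add]
      refine mul_le_mul_of_nonneg_left ?_ hlam
      rw [Finset.mul_sum, ← Finset.sum_add_distrib]
      refine Finset.sum_le_sum fun k _ => ?_
      have : (θ + τ • v) k.succ = (1 - τ) * θ k.succ + τ * (θ k.succ + v k.succ) := by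
        simp only [Pi.add_apply, Pi.smul_apply, smul_eq_mul]; ring
      rw [this]
      refine (abs_add_le _ _).trans (le_of_eq ?_)
      rw [abs_mul, abs_mul, abs_of_pos hτ.1, abs_of_pos (by linarith [hτ.2] : 0 < 1 - τ)]
      ring
    simp only [lassoObj] at h1
    simp only [zero_smul, add_zero, zero_mul]
    linarith
  have hslope := (hasDerivWithinAt_iff_tendsto_slope' (s := Set.Ioi (0 : ℝ))
    (by simp)).1 (hd.hasDerivWithinAt (s := Set.Ioi (0 : ℝ)))
  have : 0 ≤ -(score a c D θ ⬝ᵥ v) + G := by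
    refine ge_of_tendsto hslope ?_
    filter_upwards [Ioo_mem_nhdsGT one_pos] with τ hτ
    rw [slope_def_field]
    have := hge τ hτ
    have h0 := hτ.1
    refine div_nonneg (by linarith) (by linarith)
  linarith

lemma IsLasso.score_zero (ha : Differentiable ℝ a) {lam : ℝ} (hlam : 0 ≤ lam)
    (h : IsLasso a c D lam θ) : score a c D θ 0 = 0 := by
  have key : ∀ r : ℝ, score a c D θ 0 * r ≤ 0 := fun r => by
    simpa using h.score_dotProduct_le c ha hlam (Pi.single 0 r)
  have h1 := key 1
  have h2 := key (-1)
  linarith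

lemma IsLasso.score_succ_mul_le (ha : Differentiable ℝ a) {lam : ℝ} (hlam : 0 ≤ lam)
    (h : IsLasso a c D lam θ) {k : Fin (p + 1)} (hk : k ≠ 0) (r : ℝ) :
    score a c D θ k * r ≤ lam * (|θ k + r| - |θ k|) := by
  obtain ⟨l, rfl⟩ := Fin.exists_succ_eq.2 hk
  have := h.score_dotProduct_le c ha hlam (Pi.single l.succ r)
  rw [dotProduct_single, Finset.sum_eq_single l] at this
  · simpa using this
  · intro m _ hml
    have : m.succ ≠ l.succ := fun h => hml (Fin.succ_injective _ h)
    simp [this]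
  · simp

/-- Karush--Kuhn--Tucker conditions for a slope. -/
lemma IsLasso.abs_score_le (ha : Differentiable ℝ a) {lam : ℝ} (hlam : 0 ≤ lam)
    (h : IsLasso a c D lam θ) {k : Fin (p + 1)} (hk : k ≠ 0) :
    |score a c D θ k| ≤ lam ∧ score a c D θ k * θ k = lam * |θ k| := by
  have key := h.score_succ_mul_le c ha hlam hk
  refine ⟨abs_le.2 ⟨?_, ?_⟩, le_antisymm ?_ ?_⟩
  · have h1 := key (-1)
    have : |θ k + -1| - |θ k| ≤ 1 := by
      have := abs_add_le (θ k) (-1)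
      simp only [abs_neg, abs_one] at this
      linarith
    nlinarith
  · have h1 := key 1
    have : |θ k + 1| - |θ k| ≤ 1 := by
      have := abs_add_le (θ k) 1
      simp only [abs_one] at this
      linarith
    nlinarith
  · have h1 := key (θ k)
    rw [← two_mul, abs_mul, abs_two] at h1
    linarith
  · have h1 := key (-θ k)
    rw [add_neg_cancel, abs_zero] at h1
    linarith

lemma convexOn_lassoObj (hconv : ∀ v, ConvexOn ℝ Set.univ (loss a c v)) (hw : ∀ i, 0 ≤ D.w i)
    {lam : ℝ} (hlam : 0 ≤ lam) : ConvexOn ℝ Set.univ (lassoObj a c D lam) := by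
  refine ⟨convex_univ, fun θ _ θ' _ s t hs ht hst => ?_⟩
  simp only [lassoObj, logLik, neg_neg, smul_eq_mul]
  have h1 : ∀ i, D.w i * loss a c (D.y i) (D.x i ⬝ᵥ (s • θ + t • θ')) ≤
      s * (D.w i * loss a c (D.y i) (D.x i ⬝ᵥ θ)) +
        t * (D.w i * loss a c (D.y i) (D.x i ⬝ᵥ θ')) := by
    intro i
    have := (hconv (D.y i)).2 (Set.mem_univ (D.x i ⬝ᵥ θ)) (Set.mem_univ (D.x i ⬝ᵥ θ')) hs ht hst
    simp only [smul_eq_mul] at this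
    rw [dotProduct_add, dotProduct_smul, dotProduct_smul, smul_eq_mul, smul_eq_mul]
    have := mul_le_mul_of_nonneg_left this (hw i)
    linarith
  have h2 : ∀ k : Fin p, |(s • θ + t • θ') k.succ| ≤ s * |θ k.succ| + t * |θ' k.succ| := by
    intro k
    simp only [Pi.add_apply, Pi.smul_apply, smul_eq_mul]
    refine (abs_add_le _ _).trans (le_of_eq ?_)
    rw [abs_mul, abs_mul, abs_of_nonneg hs, abs_of_nonneg ht]
  have h3 := mul_le_mul_of_nonneg_left (Finset.sum_le_sum fun i (_ : i ∈ Finset.univ) => h1 i)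
    (by positivity : (0 : ℝ) ≤ (n : ℝ)⁻¹)
  have h4 := mul_le_mul_of_nonneg_left (Finset.sum_le_sum fun k (_ : k ∈ Finset.univ) => h2 k)
    hlam
  rw [Finset.sum_add_distrib, ← Finset.mul_sum, ← Finset.mul_sum] at h3 h4
  linarith

lemma continuous_lassoObj (ha : Differentiable ℝ a) (lam : ℝ) :
    Continuous (lassoObj a c D lam) := by
  have hl : ∀ y, Continuous (loss a c y) := fun y =>
    continuous_iff_continuousAt.2 fun t => (hasDerivAt_loss c ha y t).continuousAt
  unfold lassoObj logLik
  simp only [neg_neg]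
  refine (continuous_const.mul (continuous_finsetSum _ fun i _ => continuous_const.mul
    ((hl _).comp ?_))).add (by fun_prop)
  unfold dotProduct
  fun_prop

/-- If the quadratic approximation dominates score, penalty and remainder on the sphere of radius
`ρ`, then Lasso solutions exist and all lie within `ρ` of `θ₀`. -/
lemma exists_isLasso_and_norm_sub_le (ha : Differentiable ℝ a) (ha' : Differentiable ℝ (deriv a))
    (hconv : ∀ v, ConvexOn ℝ Set.univ (loss a c v)) (hB : 0 ≤ B) (hL : 0 ≤ L)
    (hD : BoundedSample a D θ₀ B L η) (hρ : 0 < ρ) (hρη : (p + 1) * (B * ρ) ≤ η)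
    {lam K m δ : ℝ} (hlam : 0 ≤ lam) {Hm : Matrix (Fin (p + 1)) (Fin (p + 1)) ℝ}
    (hH : ∀ u : Fin (p + 1) → ℝ, m * ‖u‖ ^ 2 ≤ u ⬝ᵥ (Hm *ᵥ u))
    (hδ : ∀ k l, |hess a c D θ₀ k l - Hm k l| ≤ δ) (hδm : (p + 1) * ((p + 1) * δ) ≤ m / 4)
    (hK : ∀ k, |score a c D θ₀ k| ≤ K) (h1 : (p + 1) * (K + lam) < m * ρ / 8)
    (h2 : B * (L * ((p + 1) * B) ^ 3) * ρ ≤ m / 8) :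
    (∃ θ, IsLasso a c D lam θ) ∧ ∀ θ, IsLasso a c D lam θ → ‖θ - θ₀‖ ≤ ρ := by
  have hsphere : ∀ θ : Fin (p + 1) → ℝ, ‖θ - θ₀‖ = ρ →
      lassoObj a c D lam θ₀ < lassoObj a c D lam θ := by
    intro θ hθ
    have e1 := neg_logLik_sub_ge c ha ha' hB hL hD hθ.le hρη
    have e2 := (abs_le.1 (abs_dotProduct_le (x := score a c D θ₀) (u := θ - θ₀) hK hθ.le)).2
    have e3 : m * ρ ^ 2 - (p + 1) * ((p + 1) * δ * ρ * ρ) ≤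
        (θ - θ₀) ⬝ᵥ (hess a c D θ₀ *ᵥ (θ - θ₀)) := by
      have f1 := hH (θ - θ₀)
      have f2 : ∀ k, |((hess a c D θ₀ - Hm) *ᵥ (θ - θ₀)) k| ≤ (p + 1) * (δ * ρ) := fun k => by
        have := abs_dotProduct_le (x := (hess a c D θ₀ - Hm) k) (u := θ - θ₀)
          (fun l => hδ k l) hθ.le
        push_cast at this
        exact this
      have f3 := abs_dotProduct_le (x := (hess a c D θ₀ - Hm) *ᵥ (θ - θ₀)) (u := θ - θ₀) f2 hθ.le
      rw [dotProduct_comm, Matrix.sub_mulVec, dotProduct_sub] at f3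
      have f4 := (abs_le.1 f3).1
      rw [hθ] at f1
      push_cast at f4
      nlinarith
    have e4 : -(p * ρ) ≤ ∑ k : Fin p, |θ k.succ| - ∑ k : Fin p, |θ₀ k.succ| := by
      rw [← Finset.sum_sub_distrib]
      have : ∀ k ∈ Finset.univ, -ρ ≤ |θ (Fin.succ k)| - |θ₀ (Fin.succ k)| := fun k _ => by
        have g1 := norm_le_pi_norm (θ - θ₀) (Fin.succ k)
        rw [hθ, Pi.sub_apply, Real.norm_eq_abs] at g1
        have g2 := abs_sub_abs_le_abs_sub (θ₀ (Fin.succ k)) (θ (Fin.succ k))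
        rw [abs_sub_comm] at g2
        linarith
      have := Finset.card_nsmul_le_sum Finset.univ _ _ this
      simpa using this
    have e5 := mul_le_mul_of_nonneg_left e4 hlam
    have e6 : B * (L * ((p + 1) * (B * ρ)) ^ 3) ≤ m / 8 * ρ ^ 2 := by
      calc B * (L * ((p + 1) * (B * ρ)) ^ 3) = B * (L * ((p + 1) * B) ^ 3) * ρ * ρ ^ 2 := by ring
        _ ≤ _ := by gcongr
    have e7 : (p + 1) * (K + lam) * ρ < m * ρ / 8 * ρ := by gcongr
    have e8 : (p + 1) * ((p + 1) * δ * ρ * ρ) ≤ m / 4 * ρ ^ 2 := by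
      calc (p + 1) * ((p + 1) * δ * ρ * ρ) = (p + 1) * ((p + 1) * δ) * ρ ^ 2 := by ring
        _ ≤ _ := by gcongr
    have e9 : 0 ≤ lam * ρ := by positivity
    have hm : 0 ≤ m * ρ / 8 * ρ := by
      have : 0 ≤ K := (abs_nonneg _).trans (hK 0)
      exact mul_nonneg (le_trans (by positivity) h1.le) hρ.le
    simp only [lassoObj]
    push_cast at e2
    nlinarith
  -- by convexity, exceeding the value at the centre on the sphere propagates outwards along rays
  have hcv := convexOn_lassoObj c (D := D) hconv hD.w_nonneg hlam
  have hout : ∀ θ : Fin (p + 1) → ℝ, ρ < ‖θ - θ₀‖ →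
      lassoObj a c D lam θ₀ < lassoObj a c D lam θ := by
    intro θ hθ
    set r := ‖θ - θ₀‖
    have hr : 0 < r := hρ.trans hθ
    set s := ρ / r
    have hs0 : 0 < s := by positivity
    have hs1 : s < 1 := (div_lt_one hr).2 hθ
    have g1 := hcv.2 (Set.mem_univ θ₀) (Set.mem_univ θ) (by linarith : 0 ≤ 1 - s) hs0.le (by ring)
    have g2 := hsphere ((1 - s) • θ₀ + s • θ) (by
      have : (1 - s) • θ₀ + s • θ - θ₀ = s • (θ - θ₀) := by module
      rw [this, norm_smul, Real.norm_of_nonneg hs0.le]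
      exact div_mul_cancel₀ _ hr.ne')
    simp only [smul_eq_mul] at g1
    nlinarith
  have hmin : ∀ θ, IsLasso a c D lam θ → ‖θ - θ₀‖ ≤ ρ := fun θ hθ => by
    by_contra hcon
    exact absurd (hθ θ₀) (not_le.2 (hout θ (not_le.1 hcon)))
  refine ⟨?_, hmin⟩
  obtain ⟨θ, hθ, hθmin⟩ := (isCompact_closedBall θ₀ ρ).exists_isMinOn
    ⟨θ₀, Metric.mem_closedBall_self hρ.le⟩ (continuous_lassoObj c (D := D) ha lam).continuousOn
  refine ⟨θ, fun θ' => ?_⟩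
  by_cases h : θ' ∈ Metric.closedBall θ₀ ρ
  · exact hθmin h
  · rw [Metric.mem_closedBall, dist_eq_norm, not_le] at h
    exact (hθmin (Metric.mem_closedBall_self hρ.le)).trans (hout θ' h).le

end Criterion

end Deterministic

/-! ### Selection events as polyhedra in the localized score -/

section Extend

variable {p : ℕ} {M : Finset (Fin (p + 1))}

/-- Extension by zero of a vector indexed by the model. -/
def extendZero (f : Act M → ℝ) : Fin (p + 1) → ℝ := fun k => if h : k ∈ M then f ⟨k, h⟩ else 0

lemma extendZero_val (f : Act M → ℝ) (k : Act M) : extendZero f k.1 = f k := by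
  simp [extendZero, k.2]

lemma extendZero_of_notMem (f : Act M → ℝ) {k : Fin (p + 1)} (hk : k ∉ M) :
    extendZero f k = 0 := by
  simp [extendZero, hk]

lemma extendZero_dotProduct (f : Act M → ℝ) (v : Fin (p + 1) → ℝ) :
    extendZero f ⬝ᵥ v = f ⬝ᵥ fun k => v k.1 := by
  calc extendZero f ⬝ᵥ v = ∑ k ∈ M, extendZero f k * v k :=
        (Finset.sum_subset (Finset.subset_univ M) fun k _ hk => by
          rw [extendZero_of_notMem f hk, zero_mul]).symm
    _ = ∑ k : Act M, extendZero f k.1 * v k.1 :=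
        (Finset.sum_coe_sort M fun k => extendZero f k * v k).symm
    _ = _ := Finset.sum_congr rfl fun k _ => by rw [extendZero_val]

lemma mulVec_extendZero {ι : Type*} (A : Matrix ι (Fin (p + 1)) ℝ) (f : Act M → ℝ) (i : ι) :
    (A *ᵥ extendZero f) i = ((A.submatrix id Subtype.val : Matrix ι (Act M) ℝ) *ᵥ f) i := by
  rw [Matrix.mulVec, dotProduct_comm, extendZero_dotProduct, dotProduct_comm]
  rfl

lemma eq_extendZero {v : Fin (p + 1) → ℝ} (hv : ∀ k ∉ M, v k = 0) :
    v = extendZero fun k : Act M => v k.1 := by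
  ext k
  by_cases h : k ∈ M
  · exact (extendZero_val (fun k : Act M => v k.1) ⟨k, h⟩).symm
  · rw [hv k h, extendZero_of_notMem _ h]

end Extend

section Solution

variable {p : ℕ} (H : Matrix (Fin (p + 1)) (Fin (p + 1)) ℝ) (M : Finset (Fin (p + 1)))
  (s : Slope M → ℝ)

/-- Block of a matrix with rows and columns in the model. -/
abbrev blockMM : Matrix (Act M) (Act M) ℝ := H.submatrix Subtype.val Subtype.val

/-- Block of a matrix with rows outside and columns in the model. -/
abbrev blockNM : Matrix (Inact M) (Act M) ℝ := H.submatrix Subtype.val Subtype.val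

/-- Block of a matrix with rows in and columns outside the model. -/
abbrev blockMN : Matrix (Act M) (Inact M) ℝ := H.submatrix Subtype.val Subtype.val

/-- The active part `u_M = H_M⁻¹ (Y_M - c σ)` of the localized Lasso solution with model `M` and
signs `s`, as a function of the localized score `Y`. -/
noncomputable def activeSol (Y : Fin (p + 1) → ℝ) (c : ℝ) : Act M → ℝ :=
  (blockMM H M)⁻¹ *ᵥ fun k => Y k.1 - c * padSign M s k

/-- The inactive subgradient `Y_{-M} - H_{-MM} u_M` of the localized Lasso solution. -/
noncomputable def inactiveGrad (Y : Fin (p + 1) → ℝ) (c : ℝ) : Inact M → ℝ :=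
  fun k => Y k.1 - (blockNM H M *ᵥ activeSol H M s Y c) k

variable (θ₀ : Fin (p + 1) → ℝ)

/-- Rescaled slacks of the constraints which describe the selection of `(M, s)`; `τ` is the
localization rate `n^{-1/2}`. Where `θ₀ k ≠ 0` the slack is multiplied by `τ`, so that it has a
limit as `τ → 0`. -/
noncomputable def slack (Y : Fin (p + 1) → ℝ) (c τ : ℝ) : Slope M ⊕ (Inact M ⊕ Inact M) → ℝ :=
  Sum.elim
    (fun k => |θ₀ k.1| +
      (if θ₀ k.1 = 0 then 1 else τ) * (s k * activeSol H M s Y c ⟨k.1, k.2.1⟩))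
    (Sum.elim (fun k => c - inactiveGrad H M s Y c k) (fun k => c + inactiveGrad H M s Y c k))

/-- The factors by which `slack` rescales. -/
noncomputable def slackScale (τ : ℝ) : Slope M ⊕ (Inact M ⊕ Inact M) → ℝ :=
  Sum.elim (fun k => if θ₀ k.1 = 0 then 1 else τ) fun _ => 1

end Solution

/-- Karush--Kuhn--Tucker conditions of the Lasso at `θ₀ + τ u`, where `v` is the score. -/
structure IsKKT {p : ℕ} (c τ : ℝ) (θ₀ u v : Fin (p + 1) → ℝ) : Prop where
  zero : v 0 = 0
  abs_le : ∀ k ≠ 0, |v k| ≤ c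
  mul_eq : ∀ k ≠ 0, v k * (θ₀ k + τ * u k) = c * |θ₀ k + τ * u k|

/-- The vector `b` has active set `M` and signs `s`. -/
def Selects {p : ℕ} (M : Finset (Fin (p + 1))) (s : Slope M → ℝ) (b : Fin (p + 1) → ℝ) : Prop :=
  activeSet b = M ∧ ∀ k : Slope M, Real.sign (b k.1) = s k

lemma padSign_slope {p : ℕ} {M : Finset (Fin (p + 1))} (s : Slope M → ℝ) (k : Slope M) :
    padSign M s ⟨k.1, k.2.1⟩ = s k := by
  simp [padSign, k.2.2]

section Selection

variable {p : ℕ} {H : Matrix (Fin (p + 1)) (Fin (p + 1)) ℝ} {M : Finset (Fin (p + 1))}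
  {s : Slope M → ℝ} {θ₀ u v : Fin (p + 1) → ℝ} {c τ : ℝ}

lemma blockMM_det_isUnit (hH : H.PosDef) (M : Finset (Fin (p + 1))) :
    IsUnit (blockMM H M).det :=
  (Matrix.isUnit_iff_isUnit_det _).1 (hH.submatrix Subtype.val_injective).isUnit

lemma blockMM_mulVec_activeSol (hH : H.PosDef) (Y : Fin (p + 1) → ℝ) :
    blockMM H M *ᵥ activeSol H M s Y c = fun k => Y k.1 - c * padSign M s k := by
  rw [activeSol, Matrix.mulVec_mulVec, Matrix.mul_nonsing_inv _ (blockMM_det_isUnit hH M),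
    Matrix.one_mulVec]

/-- If `u` is supported in `M`, and `v = c σ` on `M`, then `(u, v)` is recovered from
`v + H u`. -/
lemma activeSol_eq (hH : H.PosDef) (hu : ∀ k ∉ M, u k = 0)
    (hv : ∀ k : Act M, v k.1 = c * padSign M s k) :
    activeSol H M s (v + H *ᵥ u) c = fun k => u k.1 := by
  have h : (fun k : Act M => (v + H *ᵥ u) k.1 - c * padSign M s k) =
      blockMM H M *ᵥ fun k => u k.1 := by
    ext k
    rw [Pi.add_apply, hv k, add_sub_cancel_left]
    conv_lhs => rw [eq_extendZero hu]
    exact mulVec_extendZero H _ _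
  rw [activeSol, h, Matrix.mulVec_mulVec, Matrix.nonsing_inv_mul _ (blockMM_det_isUnit hH M),
    Matrix.one_mulVec]

lemma inactiveGrad_eq (hH : H.PosDef) (hu : ∀ k ∉ M, u k = 0)
    (hv : ∀ k : Act M, v k.1 = c * padSign M s k) :
    inactiveGrad H M s (v + H *ᵥ u) c = fun k => v k.1 := by
  ext k
  rw [inactiveGrad, activeSol_eq hH hu hv, Pi.add_apply]
  have : (H *ᵥ u) k.1 = (blockNM H M *ᵥ fun k : Act M => u k.1) k := by
    conv_lhs => rw [eq_extendZero hu]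
    exact mulVec_extendZero H _ _
  rw [this, add_sub_cancel_right]

lemma Selects.eq_zero (hsel : Selects M s fun k => θ₀ k + τ * u k) (hM : ∀ k, θ₀ k ≠ 0 → k ∈ M)
    (hτ : τ ≠ 0) {k : Fin (p + 1)} (hk : k ∉ M) : u k = 0 := by
  have h0 : θ₀ k = 0 := by_contra fun h => hk (hM k h)
  have h1 : ¬ (k = 0 ∨ θ₀ k + τ * u k ≠ 0) := fun h => hk (by
    rw [← hsel.1]; simpa [activeSet] using h)
  push Not at h1
  simpa [h0, hτ] using h1.2

lemma Selects.ne_zero {b : Fin (p + 1) → ℝ} (hsel : Selects M s b) (k : Slope M) : b k.1 ≠ 0 := by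
  have h1 : k.1 ∈ activeSet b := by rw [hsel.1]; exact k.2.1
  have h2 : k.1 = 0 ∨ b k.1 ≠ 0 := by simpa [activeSet] using h1
  exact h2.resolve_left k.2.2

lemma Selects.score_eq (hsel : Selects M s fun k => θ₀ k + τ * u k) (hk : IsKKT c τ θ₀ u v)
    (k : Act M) : v k.1 = c * padSign M s k := by
  by_cases h : k.1 = 0
  · simp [padSign, h, hk.zero]
  have hb := hsel.ne_zero ⟨k.1, k.2, h⟩
  have hs := hsel.2 ⟨k.1, k.2, h⟩
  have hm := hk.mul_eq k.1 h
  simp only [padSign, h, dif_neg, not_false_eq_true]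
  simp only at hb hs
  rw [← hs]
  refine mul_right_cancel₀ hb (hm.trans ?_)
  rcases lt_or_gt_of_ne hb with h' | h'
  · rw [abs_of_neg h', Real.sign_of_neg h']; ring
  · rw [abs_of_pos h', Real.sign_of_pos h']; ring

lemma Selects.sign_mul_pos {b : Fin (p + 1) → ℝ} (hsel : Selects M s b) (k : Slope M) :
    0 < s k * b k.1 := by
  rw [← hsel.2 k]
  exact Real.sign_mul_pos_of_ne_zero _ (hsel.ne_zero k)

lemma sign_mul_eq_abs {t b : ℝ} (h : b ≠ 0 → t = Real.sign b) : t * b = |b| := by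
  rcases lt_trichotomy b 0 with h' | h' | h'
  · rw [h h'.ne, Real.sign_of_neg h', abs_of_neg h']; ring
  · simp [h']
  · rw [h h'.ne', Real.sign_of_pos h', abs_of_pos h']; ring

/-- The sign constraint `0 < s k * (θ₀ k + τ r)` in the scaling of `slack`: up to the factor `τ`, a
null coefficient leaves `s k * r`, and any other one `|θ₀ k| + τ * (s k * r)`. -/
lemma scale_mul_sign_mul (hs₀ : ∀ k : Slope M, θ₀ k.1 ≠ 0 → s k = Real.sign (θ₀ k.1))
    (k : Slope M) (r : ℝ) :
    (if θ₀ k.1 = 0 then 1 else τ) * (s k * (θ₀ k.1 + τ * r)) =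
      τ * (|θ₀ k.1| + (if θ₀ k.1 = 0 then 1 else τ) * (s k * r)) := by
  have := sign_mul_eq_abs (hs₀ k)
  split_ifs with h
  · simp [h]; ring
  · rw [← this]; ring

lemma Selects.slack_slope_pos (hH : H.PosDef) (hM : ∀ k, θ₀ k ≠ 0 → k ∈ M) (hτ : 0 < τ)
    (hs₀ : ∀ k : Slope M, θ₀ k.1 ≠ 0 → s k = Real.sign (θ₀ k.1))
    (hsel : Selects M s fun k => θ₀ k + τ * u k) (hk : IsKKT c τ θ₀ u v) (k : Slope M) :
    0 < slack H M s θ₀ (v + H *ᵥ u) c τ (Sum.inl k) := by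
  have h1 := hsel.sign_mul_pos k
  have h2 := scale_mul_sign_mul (τ := τ) hs₀ k (u k.1)
  simp only [slack, Sum.elim_inl]
  rw [activeSol_eq hH (fun _ => hsel.eq_zero hM hτ.ne') (hsel.score_eq hk)]
  refine (mul_pos_iff_of_pos_left hτ).1 ?_
  rw [← h2]
  refine mul_pos ?_ h1
  split_ifs <;> positivity

lemma Selects.slack_inactive_nonneg (hH : H.PosDef) (hM : ∀ k, θ₀ k ≠ 0 → k ∈ M) (hτ : 0 < τ)
    (hM0 : 0 ∈ M) (hsel : Selects M s fun k => θ₀ k + τ * u k) (hk : IsKKT c τ θ₀ u v)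
    (k : Inact M ⊕ Inact M) : 0 ≤ slack H M s θ₀ (v + H *ᵥ u) c τ (Sum.inr k) := by
  have hne : ∀ k : Inact M, k.1 ≠ 0 := fun k h => k.2 (h ▸ hM0)
  simp only [slack, Sum.elim_inr]
  rw [inactiveGrad_eq hH (fun _ => hsel.eq_zero hM hτ.ne') (hsel.score_eq hk)]
  rcases k with k | k
  · have := (abs_le.1 (hk.abs_le k.1 (hne k))).2
    simp only [Sum.elim_inl]; linarith
  · have := (abs_le.1 (hk.abs_le k.1 (hne k))).1
    simp only [Sum.elim_inr]; linarith

/-- The subdifferential of the penalty is monotone. -/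
lemma IsKKT.dotProduct_nonneg {u' v' : Fin (p + 1) → ℝ} (hτ : 0 < τ) (hk : IsKKT c τ θ₀ u v)
    (hk' : IsKKT c τ θ₀ u' v') : 0 ≤ (v - v') ⬝ᵥ (u - u') := by
  refine Finset.sum_nonneg fun k _ => ?_
  by_cases h : k = 0
  · simp [h, hk.zero, hk'.zero]
  have h1 := hk.mul_eq k h
  have h2 := hk'.mul_eq k h
  have h3 : v k * (θ₀ k + τ * u' k) ≤ c * |θ₀ k + τ * u' k| := (le_abs_self _).trans (by
    rw [abs_mul]; exact mul_le_mul_of_nonneg_right (hk.abs_le k h) (abs_nonneg _))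
  have h4 : v' k * (θ₀ k + τ * u k) ≤ c * |θ₀ k + τ * u k| := (le_abs_self _).trans (by
    rw [abs_mul]; exact mul_le_mul_of_nonneg_right (hk'.abs_le k h) (abs_nonneg _))
  refine nonneg_of_mul_nonneg_right (a := τ) ?_ hτ
  simp only [Pi.sub_apply]
  nlinarith

/-- For positive definite `H`, the localized score `v + H u` determines the solution `u`. -/
lemma IsKKT.unique {u' v' : Fin (p + 1) → ℝ} (hH : H.PosDef) (hτ : 0 < τ)
    (hk : IsKKT c τ θ₀ u v) (hk' : IsKKT c τ θ₀ u' v') (h : v + H *ᵥ u = v' + H *ᵥ u') :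
    u = u' := by
  have h1 := hk.dotProduct_nonneg hτ hk'
  have h2 : v - v' = -(H *ᵥ (u - u')) := by
    rw [Matrix.mulVec_sub]
    linear_combination (exp := 1) h
  by_contra hne
  have h3 := hH.dotProduct_mulVec_pos (sub_ne_zero.2 hne)
  rw [h2, neg_dotProduct, dotProduct_comm] at h1
  rw [star_trivial] at h3
  linarith

/-- If the localized score lies in the polyhedron of `(M, s)`, then `(M, s)` is selected. -/
lemma IsKKT.selects (hH : H.PosDef) (hM0 : 0 ∈ M) (hM : ∀ k, θ₀ k ≠ 0 → k ∈ M) (hτ : 0 < τ)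
    (hc : 0 ≤ c) (hs : ∀ k, s k = 1 ∨ s k = -1)
    (hs₀ : ∀ k : Slope M, θ₀ k.1 ≠ 0 → s k = Real.sign (θ₀ k.1)) (hk : IsKKT c τ θ₀ u v)
    (h1 : ∀ k, 0 < slack H M s θ₀ (v + H *ᵥ u) c τ (Sum.inl k))
    (h2 : ∀ k, 0 ≤ slack H M s θ₀ (v + H *ᵥ u) c τ (Sum.inr k)) :
    Selects M s fun k => θ₀ k + τ * u k := by
  set Y := v + H *ᵥ u with hY
  -- the candidate with model `M` and signs `s` satisfies the same conditions at the same `Y`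
  set u' := extendZero (activeSol H M s Y c)
  set v' := Y - H *ᵥ u'
  have hv'M : ∀ k : Act M, v' k.1 = c * padSign M s k := fun k => by
    have : (H *ᵥ u') k.1 = (blockMM H M *ᵥ activeSol H M s Y c) k := mulVec_extendZero H _ _
    simp only [v', Pi.sub_apply, this, blockMM_mulVec_activeSol hH]
    ring
  have hv'N : ∀ k : Inact M, v' k.1 = inactiveGrad H M s Y c k := fun k => by
    have : (H *ᵥ u') k.1 = (blockNM H M *ᵥ activeSol H M s Y c) k := mulVec_extendZero H _ _
    simp only [v', Pi.sub_apply, this, inactiveGrad]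
  have hpos : ∀ k : Slope M, 0 < s k * (θ₀ k.1 + τ * u' k.1) := fun k => by
    have e := scale_mul_sign_mul (τ := τ) hs₀ k (u' k.1)
    have e1 := h1 k
    simp only [slack, Sum.elim_inl] at e1
    rw [← extendZero_val (activeSol H M s Y c) ⟨k.1, k.2.1⟩] at e1
    have hsc : 0 < if θ₀ k.1 = 0 then 1 else τ := by split_ifs <;> positivity
    refine (mul_pos_iff_of_pos_left hsc).1 ?_
    rw [e]
    exact mul_pos hτ e1
  have hout : ∀ k ∉ M, θ₀ k + τ * u' k = 0 := fun k hk' => by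
    have h0 : θ₀ k = 0 := by_contra fun h => hk' (hM k h)
    simp [h0, u', extendZero_of_notMem _ hk']
  have hk' : IsKKT c τ θ₀ u' v' := by
    refine ⟨?_, fun k hk0 => ?_, fun k hk0 => ?_⟩
    · rw [hv'M ⟨0, hM0⟩]; simp [padSign]
    · by_cases hkM : k ∈ M
      · rw [hv'M ⟨k, hkM⟩]
        rcases hs ⟨k, hkM, hk0⟩ with h | h <;>
          simp [padSign, hk0, h, abs_of_nonneg hc]
      · rw [hv'N ⟨k, hkM⟩]
        have e1 := h2 (Sum.inl ⟨k, hkM⟩)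
        have e2 := h2 (Sum.inr ⟨k, hkM⟩)
        simp only [slack, Sum.elim_inr, Sum.elim_inl] at e1 e2
        exact _root_.abs_le.2 ⟨by linarith, by linarith⟩
    · by_cases hkM : k ∈ M
      · have e := hpos ⟨k, hkM, hk0⟩
        rw [hv'M ⟨k, hkM⟩, mul_assoc]
        simp only [padSign, hk0, dif_neg, not_false_eq_true]
        congr 1
        rw [← abs_of_pos e, abs_mul]
        rcases hs ⟨k, hkM, hk0⟩ with h | h <;> simp [h]
      · rw [hout k hkM]; simp
  have huu : u = u' := hk.unique hH hτ hk' (by simp [v', hY])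
  rw [huu]
  refine ⟨?_, fun k => ?_⟩
  · ext k
    simp only [activeSet, Finset.mem_filter, Finset.mem_univ, true_and]
    by_cases hkM : k ∈ M
    · by_cases hk0 : k = 0
      · simp [hk0, hM0]
      · have := hpos ⟨k, hkM, hk0⟩
        have : θ₀ k + τ * u' k ≠ 0 := fun h => by simp [h] at this
        simp [hkM, this]
    · have hk0 : k ≠ 0 := fun h => hkM (h ▸ hM0)
      simp [hkM, hk0, hout k hkM]
  · have e := hpos k
    rcases hs k with h | h
    · rw [h] at e ⊢
      exact Real.sign_of_pos (by linarith)
    · rw [h] at e ⊢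
      exact Real.sign_of_neg (by linarith)

end Selection

/-! ### The pivot in terms of the localized score -/

section Blocks

variable {p : ℕ} {M : Finset (Fin (p + 1))}

lemma dropIntercept_mulVec (f : Act M → ℝ) (k : Slope M) :
    (dropIntercept M *ᵥ f) k = f ⟨k.1, k.2.1⟩ := by
  rw [Matrix.mulVec, dotProduct, Finset.sum_eq_single ⟨k.1, k.2.1⟩]
  · simp [dropIntercept]
  · intro l _ hl
    have : k.1 ≠ l.1 := fun h => hl (Subtype.ext h.symm)
    simp [dropIntercept, this]
  · simp

lemma dropIntercept_mul {κ : Type*} (X : Matrix (Act M) κ ℝ) (k : Slope M) (l : κ) :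
    (dropIntercept M * X) k l = X ⟨k.1, k.2.1⟩ l :=
  dropIntercept_mulVec (fun m => X m l) k

lemma mul_dropIntercept_transpose {κ : Type*} (X : Matrix κ (Act M) ℝ) (k : κ) (l : Slope M) :
    (X * (dropIntercept M)ᵀ) k l = X k ⟨l.1, l.2.1⟩ := by
  rw [← Matrix.transpose_apply (X * _), Matrix.transpose_mul, Matrix.transpose_transpose,
    dropIntercept_mul, Matrix.transpose_apply]

variable (s : Slope M → ℝ) (z : Slope M ⊕ Inact M → ℝ)

lemma Amat_mulVec_inl (k : Slope M) : (Amat M s *ᵥ z) (Sum.inl k) = -(s k * z (Sum.inl k)) := by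
  rw [Amat, Matrix.fromBlocks_mulVec]
  simp [Matrix.neg_mulVec, Matrix.mulVec_diagonal]

lemma Amat_mulVec_inr_inl (k : Inact M) :
    (Amat M s *ᵥ z) (Sum.inr (Sum.inl k)) = z (Sum.inr k) := by
  rw [Amat, Matrix.fromBlocks_mulVec]
  simp

lemma Amat_mulVec_inr_inr (k : Inact M) :
    (Amat M s *ᵥ z) (Sum.inr (Sum.inr k)) = -z (Sum.inr k) := by
  rw [Amat, Matrix.fromBlocks_mulVec]
  simp [Matrix.neg_mulVec]

end Blocks

section Variance

variable {p : ℕ} (H I : Matrix (Fin (p + 1)) (Fin (p + 1)) ℝ) (M : Finset (Fin (p + 1)))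
  (s : Slope M → ℝ) (j : Slope M)

/-- The covariance matrix of `Z` as a function of the Hessian `H` and the information `I`; by
definition `sigmaHat` is its value at the empirical matrices. -/
noncomputable def sigmaOf : Matrix (Slope M ⊕ Inact M) (Slope M ⊕ Inact M) ℝ :=
  let Hi := (blockMM H M)⁻¹
  let E := dropIntercept M
  let K : Matrix (Inact M) (Inact M ⊕ Act M) ℝ := Matrix.fromCols 1 (-(blockNM H M * Hi))
  let Sbb := E * Hi * blockMM I M * Hi * Eᵀ
  let Sbs := E * (Hi * blockMN I M - Hi * blockMM I M * Hi * blockMN H M)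
  let Sss := K * Matrix.fromBlocks (I.submatrix Subtype.val Subtype.val) (blockNM I M)
    (blockMN I M) (blockMM I M) * Kᵀ
  Matrix.fromBlocks Sbb Sbs Sbsᵀ Sss

/-- The unit vector of the coefficient of interest. -/
noncomputable abbrev unitVec : Slope M ⊕ Inact M → ℝ := Pi.single (Sum.inl j) 1

/-- What the pivot retains of the Hessian and the information matrix: the rates `Aκ` at which the
statistic of interest moves the constraints, its variance, and the `j`-th entry of `H_M⁻¹σ`. -/
noncomputable def pivotParam : (Slope M ⊕ (Inact M ⊕ Inact M) → ℝ) × ℝ × ℝ :=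
  (Amat M s *ᵥ polyC (sigmaOf H I M) (unitVec M j),
    unitVec M j ⬝ᵥ (sigmaOf H I M *ᵥ unitVec M j),
    ((blockMM H M)⁻¹ *ᵥ padSign M s) ⟨j.1, j.2.1⟩)

/-- The pivot as a function of the localized score `Y`, the parameters of `pivotParam`, the penalty
constant and the localization rate. The Hessian `H` is the one used for localization. -/
noncomputable def localPivot (θ₀ Y : Fin (p + 1) → ℝ)
    (g : (Slope M ⊕ (Inact M ⊕ Inact M) → ℝ) × ℝ × ℝ) (c τ : ℝ) : ℝ :=
  haveI : Nonempty (Slope M ⊕ (Inact M ⊕ Inact M)) := ⟨Sum.inl j⟩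
  slopePivot (activeSol H M s Y c ⟨j.1, j.2.1⟩ + c * g.2.2) (Real.sqrt g.2.1)
    fun l => g.1 l * slackScale M θ₀ τ l / slack H M s θ₀ Y c τ l

end Variance

section Pivot

variable {n p : ℕ} {a : ℝ → ℝ} (cd : ℝ → ℝ) {D : Sample n p}
  {H : Matrix (Fin (p + 1)) (Fin (p + 1)) ℝ}
  {M : Finset (Fin (p + 1))} {s : Slope M → ℝ} {θ₀ θ u v : Fin (p + 1) → ℝ} {c : ℝ}

lemma slackScale_pos {τ : ℝ} (hτ : 0 < τ) (l : Slope M ⊕ (Inact M ⊕ Inact M)) :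
    0 < slackScale M θ₀ τ l := by
  rcases l with k | k
  · simp only [slackScale, Sum.elim_inl]; split_ifs <;> positivity
  · simp [slackScale]

/-- On the selection event the slacks of the polyhedral constraints are those of the localized
problem. -/
lemma bvec_sub_mulVec_eq (hH : H.PosDef) (hM : ∀ k, θ₀ k ≠ 0 → k ∈ M) (hn : 0 < n)
    (hs₀ : ∀ k : Slope M, θ₀ k.1 ≠ 0 → s k = Real.sign (θ₀ k.1))
    (hu : u = √n • (θ - θ₀)) (hv : v = √n • score a cd D θ)
    (hsel : Selects M s θ) (hk : IsKKT c (√n)⁻¹ θ₀ u v) (l : Slope M ⊕ (Inact M ⊕ Inact M)) :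
    (bvec a cd D (c / √n) θ M s - Amat M s *ᵥ Zvec a cd D θ M) l =
      slack H M s θ₀ (v + H *ᵥ u) c (√n)⁻¹ l / slackScale M θ₀ (√n)⁻¹ l := by
  have hn' : (0 : ℝ) < √n := Real.sqrt_pos.2 (by exact_mod_cast hn)
  have hθ : (fun k => θ₀ k + (√n)⁻¹ * u k) = θ := by
    ext k
    simp [hu, hn'.ne']
  have hsel' : Selects M s fun k => θ₀ k + (√n)⁻¹ * u k := hθ ▸ hsel
  have hout := fun k => hsel'.eq_zero (k := k) hM (inv_pos.2 hn').ne'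
  have hact := hsel'.score_eq hk
  have hscore : scoreM a cd D θ M = (c / √n) • padSign M s := by
    ext k
    have := hact k
    simp only [hv, Pi.smul_apply, smul_eq_mul] at this
    simp only [scoreM, Pi.smul_apply, smul_eq_mul]
    field_simp
    linarith
  rcases l with k | k | k
  · rw [Pi.sub_apply, Amat_mulVec_inl]
    have h1 := scale_mul_sign_mul (τ := (√n)⁻¹) hs₀ k (u k.1)
    rw [congrFun hθ k.1] at h1
    have h2 := slackScale_pos (M := M) (θ₀ := θ₀) (inv_pos.2 hn') (Sum.inl k)
    have h3 : bvec a cd D (c / √n) θ M s (Sum.inl k) - -(s k * Zvec a cd D θ M (Sum.inl k)) =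
        √n * (s k * θ k.1) := by
      simp only [bvec, Zvec, oneStep, hscore, Pi.smul_apply, Sum.elim_inl, Pi.neg_apply,
        Matrix.mulVec_diagonal, dropIntercept_mulVec, smul_eq_mul]
      ring
    rw [eq_div_iff h2.ne', h3]
    simp only [slack, slackScale, Sum.elim_inl, activeSol_eq hH hout hact]
    rw [mul_assoc, mul_comm (s k * θ k.1), h1, mul_inv_cancel_left₀ hn'.ne']
  · rw [Pi.sub_apply, Amat_mulVec_inr_inl]
    simp only [slack, slackScale, Sum.elim_inr, Sum.elim_inl]
    rw [inactiveGrad_eq hH hout hact]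
    simp only [Sum.elim_inr, Sum.elim_inl,
      bvec, Zvec, scoreTilde, hscore, Pi.smul_apply, Pi.sub_apply, Pi.one_apply, Matrix.mulVec_smul,
      smul_eq_mul, scoreN, hv]
    field_simp
    ring
  · rw [Pi.sub_apply, Amat_mulVec_inr_inr]
    simp only [slack, slackScale, Sum.elim_inr]
    rw [inactiveGrad_eq hH hout hact]
    simp only [Sum.elim_inr,
      bvec, Zvec, scoreTilde, hscore, Pi.smul_apply, Pi.sub_apply, Pi.add_apply, Pi.one_apply,
      Matrix.mulVec_smul, smul_eq_mul, scoreN, hv]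
    field_simp
    ring

/-- On the selection event, and where all slacks are positive, the confidence interval covers the
true coefficient if and only if the localized pivot lies between `ζ/2` and `1 - ζ/2`. -/
lemma mem_modelCI_iff (hH : H.PosDef) (hM : ∀ k, θ₀ k ≠ 0 → k ∈ M) (hn : 0 < n)
    (hs₀ : ∀ k : Slope M, θ₀ k.1 ≠ 0 → s k = Real.sign (θ₀ k.1))
    (hu : u = √n • (θ - θ₀)) (hv : v = √n • score a cd D θ)
    (hsel : Selects M s θ) (hk : IsKKT c (√n)⁻¹ θ₀ u v)
    (hslack : ∀ l, 0 < slack H M s θ₀ (v + H *ᵥ u) c (√n)⁻¹ l) (j : Slope M)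
    (hvar : 0 < (pivotParam (hess a cd D θ) (info a cd D θ) M s j).2.1)
    {ζ : ℝ} (hζ : ζ ∈ Set.Ioo (0 : ℝ) 1) :
    θ₀ j.1 ∈ modelCI a cd D (c / √n) θ M s ζ j ↔
      localPivot H M s j θ₀ (v + H *ᵥ u) (pivotParam (hess a cd D θ) (info a cd D θ) M s j) c
        (√n)⁻¹ ∈ Set.Icc (ζ / 2) (1 - ζ / 2) := by
  have hn' : (0 : ℝ) < √n := Real.sqrt_pos.2 (by exact_mod_cast hn)
  have hθ : (fun k => θ₀ k + (√n)⁻¹ * u k) = θ := by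
    ext k
    simp [hu, hn'.ne']
  have hsel' : Selects M s fun k => θ₀ k + (√n)⁻¹ * u k := hθ ▸ hsel
  have hout := fun k => hsel'.eq_zero (k := k) hM (inv_pos.2 hn').ne'
  have hact := hsel'.score_eq hk
  have hb := bvec_sub_mulVec_eq (a := a) cd (D := D) hH hM hn hs₀ hu hv hsel hk
  have hd : ∀ l, 0 < (bvec a cd D (c / √n) θ M s - Amat M s *ᵥ Zvec a cd D θ M) l := fun l => by
    rw [hb l]
    exact div_pos (hslack l) (slackScale_pos (inv_pos.2 hn') l)
  have : Nonempty (Slope M ⊕ (Inact M ⊕ Inact M)) := ⟨Sum.inl j⟩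
  set Sig := sigmaHat a cd D θ M with hSig
  set η := unitVec M j with hη
  set Z := Zvec a cd D θ M with hZ
  have hvar' : 0 < η ⬝ᵥ (Sig *ᵥ η) := hvar
  have hx : η ⬝ᵥ Z - √n * θ₀ j.1 = activeSol H M s (v + H *ᵥ u) c ⟨j.1, j.2.1⟩ +
      c * (pivotParam (hess a cd D θ) (info a cd D θ) M s j).2.2 := by
    have hscore : scoreM a cd D θ M = (c / √n) • padSign M s := by
      ext k
      have := hact k
      simp only [hv, Pi.smul_apply, smul_eq_mul] at this
      simp only [scoreM, Pi.smul_apply, smul_eq_mul]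
      field_simp
      linarith
    rw [activeSol_eq hH hout hact, single_one_dotProduct, hZ]
    simp only [Zvec, Pi.smul_apply, Sum.elim_inl, oneStep, hscore, dropIntercept_mulVec,
      Matrix.mulVec_smul, smul_eq_mul, hu, Pi.sub_apply, pivotParam]
    rw [show hessMM a cd D θ M = blockMM (hess a cd D θ) M from rfl]
    field_simp
    ring
  have key := truncCDF_interval_iff (x := η ⬝ᵥ Z) hvar'
    (vMinus_lt (cv := polyC Sig η) (x := η ⬝ᵥ Z) hd) (lt_vPlus (cv := polyC Sig η) (x := η ⬝ᵥ Z) hd)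
    hn' hζ (θ₀ j.1)
  rw [← polyR_eq] at key
  refine key.trans ?_
  rw [polyR_eq, truncCDF_eq_slopePivot hd _ hvar', hx]
  have : (fun l => (Amat M s *ᵥ polyC Sig η) l / (bvec a cd D (c / √n) θ M s - Amat M s *ᵥ Z) l) =
      fun l => (pivotParam (hess a cd D θ) (info a cd D θ) M s j).1 l *
        slackScale M θ₀ (√n)⁻¹ l / slack H M s θ₀ (v + H *ᵥ u) c (√n)⁻¹ l := by
    ext l
    rw [hb l, div_div_eq_mul_div]
    rfl
  rw [this]
  rfl

end Pivot

section LimitVariance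

variable {p : ℕ} {H I : Matrix (Fin (p + 1)) (Fin (p + 1)) ℝ} {M : Finset (Fin (p + 1))}
  {s : Slope M → ℝ} (j : Slope M)

/-- The coefficients `t` of the statistic of interest: `t ⬝ Y` is the `j`-th entry of
`H_M⁻¹ Y_M`. -/
noncomputable def targetVec (H : Matrix (Fin (p + 1)) (Fin (p + 1)) ℝ) (j : Slope M) :
    Fin (p + 1) → ℝ := extendZero fun k => (blockMM H M)⁻¹ k ⟨j.1, j.2.1⟩

lemma blockMM_inv_symm (hH : H.IsSymm) : ((blockMM H M)⁻¹)ᵀ = (blockMM H M)⁻¹ := by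
  rw [Matrix.transpose_nonsing_inv, Matrix.transpose_submatrix, hH.eq]

lemma targetVec_dotProduct (hH : H.IsSymm) (Y : Fin (p + 1) → ℝ) :
    targetVec H j ⬝ᵥ Y = ((blockMM H M)⁻¹ *ᵥ fun k => Y k.1) ⟨j.1, j.2.1⟩ := by
  rw [targetVec, extendZero_dotProduct, Matrix.mulVec]
  congr 1
  ext k
  exact congrFun (congrFun (blockMM_inv_symm (M := M) hH) ⟨j.1, j.2.1⟩) k

lemma sigmaOf_inl (k : Slope M) : sigmaOf H I M (Sum.inl k) (Sum.inl j) =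
    ((blockMM H M)⁻¹ *ᵥ fun m => (I *ᵥ targetVec H j) m.1) ⟨k.1, k.2.1⟩ := by
  have h : (fun m : Act M => (I *ᵥ targetVec H j) m.1) =
      blockMM I M *ᵥ fun k => (blockMM H M)⁻¹ k ⟨j.1, j.2.1⟩ := by
    ext m
    exact mulVec_extendZero I _ _
  simp only [sigmaOf, Matrix.fromBlocks_apply₁₁]
  rw [mul_dropIntercept_transpose, Matrix.mul_assoc, Matrix.mul_assoc, dropIntercept_mul, h]
  rfl

lemma sigmaOf_inr (hH : H.IsSymm) (hI : I.IsSymm) (k : Inact M) :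
    sigmaOf H I M (Sum.inr k) (Sum.inl j) = (I *ᵥ targetVec H j) k.1 -
      (blockNM H M *ᵥ ((blockMM H M)⁻¹ *ᵥ fun m => (I *ᵥ targetVec H j) m.1)) k := by
  have h : (fun m : Act M => (I *ᵥ targetVec H j) m.1) =
      blockMM I M *ᵥ fun k => (blockMM H M)⁻¹ k ⟨j.1, j.2.1⟩ := by
    ext m
    exact mulVec_extendZero I _ _
  have h' : (I *ᵥ targetVec H j) k.1 =
      (blockNM I M *ᵥ fun k => (blockMM H M)⁻¹ k ⟨j.1, j.2.1⟩) k := mulVec_extendZero I _ _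
  simp only [sigmaOf, Matrix.fromBlocks_apply₂₁]
  rw [Matrix.transpose_mul, mul_dropIntercept_transpose, Matrix.transpose_sub,
    Matrix.transpose_mul, Matrix.transpose_mul, Matrix.transpose_mul, Matrix.transpose_mul,
    blockMM_inv_symm hH, Matrix.transpose_submatrix, Matrix.transpose_submatrix,
    Matrix.transpose_submatrix, hI.eq, hH.eq, h, h']
  rfl

lemma pivotParam_var (hH : H.IsSymm) : (pivotParam H I M s j).2.1 =
    targetVec H j ⬝ᵥ (I *ᵥ targetVec H j) := by
  rw [targetVec_dotProduct j hH, ← sigmaOf_inl]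
  simp [pivotParam]

lemma isSymm_of_posSemidef {ι : Type*} {A : Matrix ι ι ℝ} (hA : A.PosSemidef) : A.IsSymm := by
  have := hA.isHermitian
  rwa [Matrix.IsHermitian, Matrix.conjTranspose_eq_transpose_of_trivial] at this

lemma targetVec_ne_zero (hH : H.PosDef) : targetVec H j ≠ 0 := by
  intro h
  have hsymm := isSymm_of_posSemidef hH.posSemidef
  have h1 := targetVec_dotProduct j hsymm (H *ᵥ extendZero (Pi.single ⟨j.1, j.2.1⟩ 1))
  have h2 : (fun k : Act M => (H *ᵥ extendZero (Pi.single ⟨j.1, j.2.1⟩ 1)) k.1) =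
      blockMM H M *ᵥ (Pi.single ⟨j.1, j.2.1⟩ 1) := by
    ext k
    exact mulVec_extendZero H _ _
  rw [h2, Matrix.mulVec_mulVec, Matrix.nonsing_inv_mul _ (blockMM_det_isUnit hH M),
    Matrix.one_mulVec, h] at h1
  simp at h1

/-- Moving the localized score in the direction `I t / (t ⬝ I t)` changes the slacks linearly, at
the rates recorded in `pivotParam`. -/
lemma slack_add_smul (hH : H.IsSymm) (hI : I.IsSymm) (θ₀ Y : Fin (p + 1) → ℝ) (c τ h : ℝ)
    (l : Slope M ⊕ (Inact M ⊕ Inact M)) :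
    slack H M s θ₀ (Y + h • ((targetVec H j ⬝ᵥ (I *ᵥ targetVec H j))⁻¹ •
        (I *ᵥ targetVec H j))) c τ l =
      slack H M s θ₀ Y c τ l - (pivotParam H I M s j).1 l * slackScale M θ₀ τ l * h := by
  set t := targetVec H j with ht
  set σ := t ⬝ᵥ (I *ᵥ t) with hσ
  have hpoly : ∀ i, polyC (sigmaOf H I M) (unitVec M j) i =
      σ⁻¹ * sigmaOf H I M i (Sum.inl j) := fun i => by
    have := pivotParam_var (I := I) (s := s) j hH
    simp only [pivotParam] at this
    rw [polyC, this, Pi.smul_apply, Matrix.mulVec_single_one]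
    rfl
  have h1 : ∀ k, activeSol H M s (Y + h • (σ⁻¹ • (I *ᵥ t))) c k = activeSol H M s Y c k +
      h * (σ⁻¹ * ((blockMM H M)⁻¹ *ᵥ fun m => (I *ᵥ t) m.1) k) := fun k => by
    have : (fun k : Act M => (Y + h • (σ⁻¹ • (I *ᵥ t))) k.1 - c * padSign M s k) =
        (fun k : Act M => Y k.1 - c * padSign M s k) +
          h • σ⁻¹ • fun m : Act M => (I *ᵥ t) m.1 := by
      ext k
      simp only [Pi.add_apply, Pi.smul_apply]
      ring
    rw [activeSol, this, Matrix.mulVec_add, Matrix.mulVec_smul, Matrix.mulVec_smul]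
    rfl
  have h2 : ∀ k, inactiveGrad H M s (Y + h • (σ⁻¹ • (I *ᵥ t))) c k = inactiveGrad H M s Y c k +
      h * (σ⁻¹ * sigmaOf H I M (Sum.inr k) (Sum.inl j)) := fun k => by
    have : activeSol H M s (Y + h • (σ⁻¹ • (I *ᵥ t))) c = activeSol H M s Y c +
        h • σ⁻¹ • ((blockMM H M)⁻¹ *ᵥ fun m => (I *ᵥ t) m.1) := funext h1
    rw [inactiveGrad, this, Matrix.mulVec_add, Matrix.mulVec_smul, Matrix.mulVec_smul,
      sigmaOf_inr j hH hI, inactiveGrad]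
    simp only [Pi.add_apply, Pi.smul_apply, smul_eq_mul]
    ring
  rcases l with k | k | k
  · simp only [slack, slackScale, Sum.elim_inl, h1, pivotParam, Amat_mulVec_inl, hpoly,
      sigmaOf_inl]
    ring
  · simp only [slack, slackScale, Sum.elim_inr, Sum.elim_inl, h2, pivotParam,
      Amat_mulVec_inr_inl, hpoly]
    ring
  · simp only [slack, slackScale, Sum.elim_inr, h2, pivotParam, Amat_mulVec_inr_inr, hpoly]
    ring

/-- The argument of the pivot does not depend on the penalty. -/
lemma activeSol_add_eq (hH : H.IsSymm) (Y : Fin (p + 1) → ℝ) (c : ℝ) :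
    activeSol H M s Y c ⟨j.1, j.2.1⟩ + c * (pivotParam H I M s j).2.2 = targetVec H j ⬝ᵥ Y := by
  have : (fun k : Act M => Y k.1 - c * padSign M s k) =
      (fun k : Act M => Y k.1) - c • padSign M s := rfl
  rw [targetVec_dotProduct j hH, activeSol, this, Matrix.mulVec_sub, Matrix.mulVec_smul]
  simp [pivotParam]

end LimitVariance

/-! ### The limit experiment -/

section Sandwich

/-- A version of the portmanteau theorem: if the events `A n` lie between `{V n ∈ G}` and
`{V n ∈ F}` off events of vanishing probability, and almost every point of the limit law is
interior to `G` or exterior to `F`, then their probabilities converge to that of `G`. -/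
lemma tendsto_measure_of_between {Ω Ω' E : Type*} [MeasurableSpace Ω] [MeasurableSpace Ω']
    {P : Measure Ω} [IsProbabilityMeasure P] {μ : Measure Ω'} [IsProbabilityMeasure μ]
    [PseudoMetricSpace E] [MeasurableSpace E] [BorelSpace E] {l : Filter ℕ} {V : ℕ → Ω → E}
    {Z : Ω' → E} (hV : TendstoInDistribution V l Z (fun _ => P) μ) {G F : Set E} (hGF : G ⊆ F)
    {A bad : ℕ → Set Ω} (hbad : Tendsto (fun n => P (bad n)) l (𝓝 0))
    (hA1 : ∀ᶠ n in l, ∀ ω ∉ bad n, V n ω ∈ G → ω ∈ A n)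
    (hA2 : ∀ᶠ n in l, ∀ ω ∉ bad n, ω ∈ A n → V n ω ∈ F)
    (hb : ∀ᵐ z ∂μ, G ∈ 𝓝 (Z z) ∨ Fᶜ ∈ 𝓝 (Z z)) :
    Tendsto (fun n => P (A n)) l (𝓝 (μ (Z ⁻¹' G))) := by
  rcases l.eq_or_neBot with rfl | hl
  · exact tendsto_bot
  have hin : (μ.map Z) (interior G) = μ (Z ⁻¹' G) := by
    rw [Measure.map_apply_of_aemeasurable hV.aemeasurable_limit isOpen_interior.measurableSet]
    refine measure_congr ?_
    filter_upwards [hb] with z hz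
    refine propext ⟨fun h => interior_subset h, fun h => ?_⟩
    rcases hz with hz | hz
    · exact mem_interior_iff_mem_nhds.2 hz
    · exact absurd (hGF h) (mem_of_mem_nhds hz)
  have hcl : (μ.map Z) (closure F) = μ (Z ⁻¹' G) := by
    rw [Measure.map_apply_of_aemeasurable hV.aemeasurable_limit isClosed_closure.measurableSet]
    refine measure_congr ?_
    filter_upwards [hb] with z hz
    refine propext ⟨fun h => ?_, fun h => subset_closure (hGF h)⟩
    rcases hz with hz | hz
    · exact mem_of_mem_nhds hz
    · obtain ⟨w, hw1, hw2⟩ := mem_closure_iff_nhds.1 h _ hz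
      exact absurd hw2 hw1
  have hop := ProbabilityMeasure.le_liminf_measure_open_of_tendsto hV.tendsto
    (isOpen_interior (s := G))
  have hclo := ProbabilityMeasure.limsup_measure_closed_le_of_tendsto hV.tendsto
    (isClosed_closure (s := F))
  simp only [ProbabilityMeasure.coe_mk] at hop hclo
  rw [hin] at hop
  rw [hcl] at hclo
  have hle1 : ∀ᶠ n in l, (P.map (V n)) (interior G) ≤ P (A n) + P (bad n) := by
    filter_upwards [hA1] with n hn
    rw [Measure.map_apply_of_aemeasurable (hV.forall_aemeasurable n)
      isOpen_interior.measurableSet]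
    refine (measure_mono fun ω hω => ?_).trans (measure_union_le _ _)
    by_cases hb' : ω ∈ bad n
    · exact Or.inr hb'
    · exact Or.inl (hn ω hb' (interior_subset hω))
  have hle2 : ∀ᶠ n in l, P (A n) ≤ (P.map (V n)) (closure F) + P (bad n) := by
    filter_upwards [hA2] with n hn
    rw [Measure.map_apply_of_aemeasurable (hV.forall_aemeasurable n)
      isClosed_closure.measurableSet]
    refine (measure_mono fun ω hω => ?_).trans (measure_union_le _ _)
    by_cases hb' : ω ∈ bad n
    · exact Or.inr hb'
    · exact Or.inl (subset_closure (hn ω hb' hω))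
  have hne : μ (Z ⁻¹' G) ≠ ∞ := measure_ne_top _ _
  rw [ENNReal.tendsto_nhds hne]
  intro ε hε
  have hε2 : 0 < ε / 2 := ENNReal.half_pos hε.ne'
  have e1 : ∀ᶠ n in l, μ (Z ⁻¹' G) ≤ (P.map (V n)) (interior G) + ε / 2 := by
    rcases le_or_gt (μ (Z ⁻¹' G)) (ε / 2) with h | h
    · exact Eventually.of_forall fun n => h.trans le_add_self
    have h0 : μ (Z ⁻¹' G) ≠ 0 := (hε2.trans h).ne'
    have hlt : μ (Z ⁻¹' G) - ε / 2 < μ (Z ⁻¹' G) := ENNReal.sub_lt_self hne h0 hε2.ne'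
    filter_upwards [eventually_lt_of_lt_liminf (hlt.trans_le hop)] with n hn
    exact tsub_le_iff_right.1 hn.le
  have e2 : ∀ᶠ n in l, (P.map (V n)) (closure F) ≤ μ (Z ⁻¹' G) + ε / 2 := by
    have hlt : μ (Z ⁻¹' G) < μ (Z ⁻¹' G) + ε / 2 := ENNReal.lt_add_right hne hε2.ne'
    filter_upwards [eventually_lt_of_limsup_lt (hclo.trans_lt hlt)] with n hn
    exact hn.le
  have e3 : ∀ᶠ n in l, P (bad n) ≤ ε / 2 := (hbad.eventually (gt_mem_nhds hε2)).mono
    fun _ h => h.le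
  filter_upwards [e1, e2, e3, hle1, hle2] with n h1 h2 h3 h4 h5
  refine ⟨tsub_le_iff_right.2 ?_, ?_⟩
  · calc μ (Z ⁻¹' G) ≤ P (A n) + P (bad n) + ε / 2 := h1.trans (by gcongr)
      _ ≤ P (A n) + ε / 2 + ε / 2 := by gcongr
      _ = P (A n) + ε := by rw [add_assoc, ENNReal.add_halves]
  · calc P (A n) ≤ μ (Z ⁻¹' G) + ε / 2 + ε / 2 := h5.trans (by gcongr)
      _ = _ := by rw [add_assoc, ENNReal.add_halves]

end Sandwich

section Continuity

variable {p : ℕ} {H I : Matrix (Fin (p + 1)) (Fin (p + 1)) ℝ} {M : Finset (Fin (p + 1))}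
  {s : Slope M → ℝ} {θ₀ : Fin (p + 1) → ℝ}

lemma continuousAt_blockMM_inv (hH : H.PosDef) :
    ContinuousAt (fun A : Matrix (Fin (p + 1)) (Fin (p + 1)) ℝ => (blockMM A M)⁻¹) H := by
  have h : ContinuousAt Ring.inverse (blockMM H M).det := by
    have := NormedRing.inverse_continuousAt (blockMM_det_isUnit hH M).unit
    simpa using this
  have h2 : Continuous fun A : Matrix (Fin (p + 1)) (Fin (p + 1)) ℝ => blockMM A M :=
    continuous_id.matrix_submatrix _ _
  exact (continuousAt_matrix_inv (blockMM H M) h).comp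
    (f := fun A : Matrix (Fin (p + 1)) (Fin (p + 1)) ℝ => blockMM A M) h2.continuousAt

lemma continuousAt_sigmaOf (hH : H.PosDef) (i : Slope M ⊕ Inact M) (j : Slope M) :
    ContinuousAt (fun A : Matrix (Fin (p + 1)) (Fin (p + 1)) ℝ ×
      Matrix (Fin (p + 1)) (Fin (p + 1)) ℝ => sigmaOf A.1 A.2 M i (Sum.inl j)) (H, I) := by
  have h1 : ContinuousAt (fun A : Matrix (Fin (p + 1)) (Fin (p + 1)) ℝ ×
      Matrix (Fin (p + 1)) (Fin (p + 1)) ℝ => (A, (blockMM A.1 M)⁻¹)) (H, I) :=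
    continuousAt_id.prodMk (ContinuousAt.comp (f := Prod.fst)
      (g := fun A : Matrix (Fin (p + 1)) (Fin (p + 1)) ℝ => (blockMM A M)⁻¹)
      (continuousAt_blockMM_inv hH) continuousAt_fst)
  rcases i with i | i
  · have h2 : Continuous fun A : (Matrix (Fin (p + 1)) (Fin (p + 1)) ℝ ×
        Matrix (Fin (p + 1)) (Fin (p + 1)) ℝ) × Matrix (Act M) (Act M) ℝ =>
        (dropIntercept M * A.2 * blockMM A.1.2 M * A.2 * (dropIntercept M)ᵀ) i j := by
      fun_prop
    have h3 := ContinuousAt.comp (x := (H, I)) h2.continuousAt h1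
    refine h3.congr (Eventually.of_forall fun A => ?_)
    simp only [sigmaOf, Matrix.fromBlocks_apply₁₁, Function.comp_apply]
  · have h2 : Continuous fun A : (Matrix (Fin (p + 1)) (Fin (p + 1)) ℝ ×
        Matrix (Fin (p + 1)) (Fin (p + 1)) ℝ) × Matrix (Act M) (Act M) ℝ =>
        (dropIntercept M * (A.2 * blockMN A.1.2 M -
          A.2 * blockMM A.1.2 M * A.2 * blockMN A.1.1 M))ᵀ i j := by
      fun_prop
    have h3 := ContinuousAt.comp (x := (H, I)) h2.continuousAt h1
    refine h3.congr (Eventually.of_forall fun A => ?_)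
    simp only [sigmaOf, Matrix.fromBlocks_apply₂₁, Function.comp_apply]

lemma continuousAt_pivotParam (hH : H.PosDef) (j : Slope M)
    (hvar : (pivotParam H I M s j).2.1 ≠ 0) :
    ContinuousAt (fun A : Matrix (Fin (p + 1)) (Fin (p + 1)) ℝ ×
      Matrix (Fin (p + 1)) (Fin (p + 1)) ℝ => pivotParam A.1 A.2 M s j) (H, I) := by
  have h1 : ContinuousAt (fun A : Matrix (Fin (p + 1)) (Fin (p + 1)) ℝ ×
      Matrix (Fin (p + 1)) (Fin (p + 1)) ℝ => sigmaOf A.1 A.2 M *ᵥ unitVec M j) (H, I) := by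
    refine continuousAt_pi.2 fun i => ?_
    simpa [Matrix.col] using continuousAt_sigmaOf hH i j
  have h2 : ContinuousAt (fun A : Matrix (Fin (p + 1)) (Fin (p + 1)) ℝ ×
      Matrix (Fin (p + 1)) (Fin (p + 1)) ℝ =>
        unitVec M j ⬝ᵥ (sigmaOf A.1 A.2 M *ᵥ unitVec M j)) (H, I) := by
    simpa using continuousAt_sigmaOf hH (Sum.inl j) j
  have h3 : ContinuousAt (fun A : Matrix (Fin (p + 1)) (Fin (p + 1)) ℝ ×
      Matrix (Fin (p + 1)) (Fin (p + 1)) ℝ => polyC (sigmaOf A.1 A.2 M) (unitVec M j)) (H, I) :=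
    (h2.inv₀ hvar).smul h1
  refine ContinuousAt.prodMk ?_ (h2.prodMk ?_)
  · have h4 : Continuous fun z : Slope M ⊕ Inact M → ℝ => Amat M s *ᵥ z := by fun_prop
    exact h4.continuousAt.comp h3
  · have h4 : Continuous fun A : Matrix (Act M) (Act M) ℝ =>
        (A *ᵥ padSign M s) ⟨j.1, j.2.1⟩ := by fun_prop
    exact h4.continuousAt.comp (ContinuousAt.comp (f := Prod.fst)
      (g := fun A : Matrix (Fin (p + 1)) (Fin (p + 1)) ℝ => (blockMM A M)⁻¹)
      (continuousAt_blockMM_inv hH) continuousAt_fst)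

lemma continuous_activeSol :
    Continuous fun v : (Fin (p + 1) → ℝ) × ℝ => activeSol H M s v.1 v.2 := by
  unfold activeSol
  fun_prop

lemma continuous_slack (l : Slope M ⊕ (Inact M ⊕ Inact M)) :
    Continuous fun v : (Fin (p + 1) → ℝ) × ℝ × ℝ => slack H M s θ₀ v.1 v.2.1 v.2.2 l := by
  have h : Continuous fun v : (Fin (p + 1) → ℝ) × ℝ × ℝ => activeSol H M s v.1 v.2.1 :=
    continuous_activeSol.comp (f := fun v : (Fin (p + 1) → ℝ) × ℝ × ℝ => (v.1, v.2.1))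
      (by fun_prop)
  have h2 : ∀ k, Continuous fun v : (Fin (p + 1) → ℝ) × ℝ × ℝ =>
      inactiveGrad H M s v.1 v.2.1 k := fun k => by
    unfold inactiveGrad
    fun_prop
  rcases l with k | k | k
  · simp only [slack, Sum.elim_inl]
    split_ifs <;> fun_prop
  · simp only [slack, Sum.elim_inl, Sum.elim_inr]
    exact continuous_snd.fst.sub (h2 k)
  · simp only [slack, Sum.elim_inr]
    exact continuous_snd.fst.add (h2 k)

lemma continuous_slackScale (l : Slope M ⊕ (Inact M ⊕ Inact M)) :
    Continuous fun τ : ℝ => slackScale M θ₀ τ l := by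
  rcases l with k | k
  · simp only [slackScale, Sum.elim_inl]
    split_ifs <;> fun_prop
  · simp only [slackScale, Sum.elim_inr]
    fun_prop

end Continuity

/-- The statistics on which selection and pivot depend: the localized score, the Hessian and the
information matrix at the Lasso solution, the penalty constant and the localization rate. -/
abbrev LocalData (p : ℕ) : Type :=
  (Fin (p + 1) → ℝ) × ((Fin (p + 1) → Fin (p + 1) → ℝ) × (Fin (p + 1) → Fin (p + 1) → ℝ)) × ℝ × ℝ

section Regions

variable {p : ℕ} (H : Matrix (Fin (p + 1)) (Fin (p + 1)) ℝ) (M : Finset (Fin (p + 1)))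
  (s : Slope M → ℝ) (θ₀ : Fin (p + 1) → ℝ) (j : Slope M) (ζ : ℝ)

/-- Slacks at given local data. They involve the limit Hessian `H`, which defines the localized score,
and not the Hessian recorded in the data. -/
noncomputable def dataSlack (v : LocalData p) : Slope M ⊕ (Inact M ⊕ Inact M) → ℝ :=
  slack H M s θ₀ v.1 v.2.2.1 v.2.2.2

/-- Pivot parameters at given local data. -/
noncomputable def dataParam (v : LocalData p) :
    (Slope M ⊕ (Inact M ⊕ Inact M) → ℝ) × ℝ × ℝ :=
  pivotParam (Matrix.of v.2.1.1) (Matrix.of v.2.1.2) M s j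

/-- Pivot at given local data. -/
noncomputable def dataPivot (v : LocalData p) : ℝ :=
  localPivot H M s j θ₀ v.1 (dataParam M s j v) v.2.2.1 v.2.2.2

/-- The selection region with its faces for the inactive constraints. -/
def weakRegion : Set (LocalData p) :=
  {v | (∀ k, 0 < dataSlack H M s θ₀ v (Sum.inl k)) ∧ ∀ k, 0 ≤ dataSlack H M s θ₀ v (Sum.inr k)}

/-- The interior of the selection region, where moreover the pivot is not degenerate. -/
def strictRegion : Set (LocalData p) :=
  {v | (∀ l, 0 < dataSlack H M s θ₀ v l) ∧ 0 < (dataParam M s j v).2.1}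

/-- The part of the selection region where the confidence interval covers. -/
def coverRegion : Set (LocalData p) :=
  {v | v ∈ strictRegion H M s θ₀ j ∧ dataPivot H M s θ₀ j v ∈ Set.Icc (ζ / 2) (1 - ζ / 2)}

/-- The selection region without the part where the interval certainly fails to cover. -/
def notMissRegion : Set (LocalData p) :=
  {v | v ∈ weakRegion H M s θ₀ ∧ (v ∈ strictRegion H M s θ₀ j →
    dataPivot H M s θ₀ j v ∈ Set.Icc (ζ / 2) (1 - ζ / 2))}

lemma strictRegion_subset : strictRegion H M s θ₀ j ⊆ weakRegion H M s θ₀ :=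
  fun _ hv => ⟨fun _ => hv.1 _, fun _ => (hv.1 _).le⟩

lemma coverRegion_subset : coverRegion H M s θ₀ j ζ ⊆ notMissRegion H M s θ₀ j ζ :=
  fun _ hv => ⟨strictRegion_subset H M s θ₀ j hv.1, fun _ => hv.2⟩

end Regions

section Limit

variable {p : ℕ} {H I : Matrix (Fin (p + 1)) (Fin (p + 1)) ℝ} {M : Finset (Fin (p + 1))}
  {s : Slope M → ℝ} {θ₀ : Fin (p + 1) → ℝ} {c : ℝ}

/-- Local data in the limit, as a function of the localized score. -/
def limitData (H I : Matrix (Fin (p + 1)) (Fin (p + 1)) ℝ) (c : ℝ) (Y : Fin (p + 1) → ℝ) :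
    LocalData p := (Y, ((fun k l => H k l), fun k l => I k l), c, 0)

lemma continuous_dataSlack (l : Slope M ⊕ (Inact M ⊕ Inact M)) :
    Continuous fun v : LocalData p => dataSlack H M s θ₀ v l :=
  (continuous_slack (H := H) (M := M) (s := s) (θ₀ := θ₀) l).comp
    (f := fun v : LocalData p => (v.1, v.2.2.1, v.2.2.2)) (by fun_prop)

lemma continuousAt_dataParam (hH : H.PosDef) (j : Slope M) (Y : Fin (p + 1) → ℝ)
    (hvar : (pivotParam H I M s j).2.1 ≠ 0) :
    ContinuousAt (fun v : LocalData p => dataParam M s j v) (limitData H I c Y) := by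
  have h : Continuous fun v : LocalData p => ((Matrix.of v.2.1.1, Matrix.of v.2.1.2) :
      Matrix (Fin (p + 1)) (Fin (p + 1)) ℝ × Matrix (Fin (p + 1)) (Fin (p + 1)) ℝ) :=
    continuous_snd.fst.fst.prodMk continuous_snd.fst.snd
  exact ContinuousAt.comp (x := limitData H I c Y) (continuousAt_pivotParam hH j hvar)
    h.continuousAt

lemma continuousAt_dataPivot (hH : H.PosDef) (j : Slope M) {Y : Fin (p + 1) → ℝ}
    (hY : limitData H I c Y ∈ strictRegion H M s θ₀ j) :
    ContinuousAt (dataPivot H M s θ₀ j) (limitData H I c Y) := by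
  have hvar : 0 < (pivotParam H I M s j).2.1 := hY.2
  have hpar := continuousAt_dataParam (c := c) (s := s) hH j Y hvar.ne'
  have : Nonempty (Slope M ⊕ (Inact M ⊕ Inact M)) := ⟨Sum.inl j⟩
  refine continuousAt_slopePivot (x := fun v : LocalData p =>
    activeSol H M s v.1 v.2.2.1 ⟨j.1, j.2.1⟩ + v.2.2.1 * (dataParam M s j v).2.2)
    (σ := fun v : LocalData p => Real.sqrt (dataParam M s j v).2.1)
    (r := fun (v : LocalData p) l => (dataParam M s j v).1 l * slackScale M θ₀ v.2.2.2 l /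
      dataSlack H M s θ₀ v l) ?_ (fun l => ?_) ?_ (Real.sqrt_pos.2 hvar)
  · have h1 : Continuous fun v : LocalData p => activeSol H M s v.1 v.2.2.1 ⟨j.1, j.2.1⟩ :=
      (continuous_apply _).comp (continuous_activeSol.comp
        (f := fun v : LocalData p => (v.1, v.2.2.1)) (by fun_prop))
    exact h1.continuousAt.add (continuous_snd.snd.fst.continuousAt.mul hpar.snd.snd)
  · have h1 : Continuous fun v : LocalData p => slackScale M θ₀ v.2.2.2 l :=
      (continuous_slackScale l).comp continuous_snd.snd.snd
    exact ((continuousAt_pi.1 hpar.fst l).mul h1.continuousAt).div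
      (continuous_dataSlack l).continuousAt (hY.1 l).ne'
  · exact hpar.snd.fst.sqrt

lemma pivotParam_var_pos (hH : H.PosDef) (hI : I.PosDef) (j : Slope M) :
    0 < (pivotParam H I M s j).2.1 := by
  rw [pivotParam_var j (isSymm_of_posSemidef hH.posSemidef)]
  simpa using hI.dotProduct_mulVec_pos (targetVec_ne_zero j hH)

lemma strictRegion_mem_nhds (hH : H.PosDef) (j : Slope M) {Y : Fin (p + 1) → ℝ}
    (hY : limitData H I c Y ∈ strictRegion H M s θ₀ j) :
    strictRegion H M s θ₀ j ∈ 𝓝 (limitData H I c Y) := by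
  have hvar : 0 < (pivotParam H I M s j).2.1 := hY.2
  have h1 : ∀ᶠ v in 𝓝 (limitData H I c Y), ∀ l, 0 < dataSlack H M s θ₀ v l :=
    eventually_all.2 fun l => (continuous_dataSlack l).continuousAt.eventually (lt_mem_nhds (hY.1 l))
  have h2 : ∀ᶠ v in 𝓝 (limitData H I c Y), 0 < (dataParam M s j v).2.1 :=
    (continuousAt_dataParam hH j Y hvar.ne').snd.fst.eventually (lt_mem_nhds hvar)
  filter_upwards [h1, h2] with v hv1 hv2 using ⟨hv1, hv2⟩

lemma weakRegion_compl_mem_nhds {Y : Fin (p + 1) → ℝ} {l : Slope M ⊕ (Inact M ⊕ Inact M)}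
    (hl : dataSlack H M s θ₀ (limitData H I c Y) l < 0) :
    (weakRegion H M s θ₀)ᶜ ∈ 𝓝 (limitData H I c Y) := by
  filter_upwards [(continuous_dataSlack l).continuousAt.eventually (gt_mem_nhds hl)] with v hv hv'
  rcases l with k | k
  · exact lt_asymm hv (hv'.1 k)
  · exact not_le.2 hv (hv'.2 k)

/-- The slacks at the limit do not vanish, almost surely. -/
lemma ae_dataSlack_ne_zero (hH : H.PosDef) (hI : I.PosDef) (hs : ∀ k, s k = 1 ∨ s k = -1) :
    ∀ᵐ Y ∂gaussianVec I, ∀ l, dataSlack H M s θ₀ (limitData H I c Y) l ≠ 0 := by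
  have hsymm := isSymm_of_posSemidef hH.posSemidef
  have hgrad : ∀ (k : Inact M) (a : ℝ), ∀ᵐ Y ∂gaussianVec I, inactiveGrad H M s Y c k ≠ a := by
    intro k a
    set w : Act M → ℝ := (blockNM H M * (blockMM H M)⁻¹) k
    have hne : (Pi.single k.1 1 - extendZero w : Fin (p + 1) → ℝ) ≠ 0 := fun h => by
      have := congrFun h k.1
      simp [extendZero_of_notMem w k.2] at this
    have h0 := gaussianVec_dotProduct_null hI hne (a - c * (w ⬝ᵥ padSign M s))
    rw [← nonpos_iff_eq_zero] at h0
    refine measure_mono_null (fun Y hY => ?_) (nonpos_iff_eq_zero.1 h0)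
    have hY' : inactiveGrad H M s Y c k = a := not_not.1 hY
    have : (fun k : Act M => Y k.1 - c * padSign M s k) =
        (fun k : Act M => Y k.1) - c • padSign M s := rfl
    rw [inactiveGrad, activeSol, Matrix.mulVec_mulVec, this, Matrix.mulVec_sub,
      Matrix.mulVec_smul] at hY'
    show (Pi.single k.1 1 - extendZero w) ⬝ᵥ Y = _
    rw [sub_dotProduct, extendZero_dotProduct, single_one_dotProduct, ← hY']
    simp only [Pi.sub_apply, Pi.smul_apply, smul_eq_mul, Matrix.mulVec, w]
    ring
  rw [ae_all_iff]
  rintro (k | k | k)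
  -- where `θ₀ k ≠ 0` the slack at `τ = 0` is the constant `|θ₀ k|`
  · by_cases hk : θ₀ k.1 = 0
    · have h0 := gaussianVec_dotProduct_null hI (targetVec_ne_zero k hH)
        (c * (pivotParam H I M s k).2.2)
      refine measure_mono_null (fun Y hY => ?_) h0
      have hY' : ¬ s k = 0 → activeSol H M s Y c ⟨k.1, k.2.1⟩ = 0 := by
        simpa [dataSlack, slack, limitData, hk] using hY
      have hsk : s k ≠ 0 := by rcases hs k with h | h <;> simp [h]
      show targetVec H k ⬝ᵥ Y = _
      rw [← activeSol_add_eq (s := s) (I := I) k hsymm Y c,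
        hY' hsk, zero_add]
    · refine Eventually.of_forall fun Y => ?_
      simp [dataSlack, slack, limitData, hk]
  · filter_upwards [hgrad k c] with Y hY h
    have : c - inactiveGrad H M s Y c k = 0 := h
    exact hY (by linarith)
  · filter_upwards [hgrad k (-c)] with Y hY h
    have : c + inactiveGrad H M s Y c k = 0 := h
    exact hY (by linarith)

/-- In the limit the pivot is uniformly distributed given the selection. -/
lemma gaussianVec_dataPivot (hH : H.PosDef) (hI : I.PosDef) (j : Slope M) {α β : ℝ} (hα : 0 ≤ α)
    (hαβ : α ≤ β) (hβ : β ≤ 1) :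
    gaussianVec I {Y | limitData H I c Y ∈ strictRegion H M s θ₀ j ∧
        dataPivot H M s θ₀ j (limitData H I c Y) ∈ Set.Icc α β} =
      ENNReal.ofReal (β - α) *
        gaussianVec I {Y | limitData H I c Y ∈ strictRegion H M s θ₀ j} := by
  have hHs := isSymm_of_posSemidef hH.posSemidef
  have hIs := isSymm_of_posSemidef hI.posSemidef
  have hvar := pivotParam_var_pos (s := s) hH hI j
  have hvar' := hvar
  rw [pivotParam_var j hHs] at hvar'
  have : Nonempty (Slope M ⊕ (Inact M ⊕ Inact M)) := ⟨Sum.inl j⟩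
  have key := gaussianVec_polyhedral hI.posSemidef (targetVec H j) hvar'
    (fun Y l => slack H M s θ₀ Y c 0 l)
    (fun l => ((continuous_slack (H := H) (M := M) (s := s) (θ₀ := θ₀) l).comp
      (f := fun Y : Fin (p + 1) → ℝ => (Y, c, (0 : ℝ))) (by fun_prop)).measurable)
    (fun l => (pivotParam H I M s j).1 l * slackScale M θ₀ 0 l)
    (fun Y h l => slack_add_smul j hHs hIs θ₀ Y c 0 h l) hα hαβ hβ
  have h1 : ∀ Y, limitData H I c Y ∈ strictRegion H M s θ₀ j ↔
      ∀ l, 0 < slack H M s θ₀ Y c 0 l := fun Y => ⟨fun h => h.1, fun h => ⟨h, hvar⟩⟩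
  have h2 : ∀ Y, dataPivot H M s θ₀ j (limitData H I c Y) =
      slopePivot (targetVec H j ⬝ᵥ Y) (Real.sqrt (targetVec H j ⬝ᵥ (I *ᵥ targetVec H j)))
        fun l => (pivotParam H I M s j).1 l * slackScale M θ₀ 0 l / slack H M s θ₀ Y c 0 l := by
    intro Y
    rw [← activeSol_add_eq (s := s) (I := I) j hHs Y c, ← pivotParam_var (s := s) j hHs]
    rfl
  simp only [h1, h2]
  exact key

lemma ae_strictRegion (hH : H.PosDef) (hI : I.PosDef) (hs : ∀ k, s k = 1 ∨ s k = -1)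
    (j : Slope M) : ∀ᵐ Y ∂gaussianVec I, strictRegion H M s θ₀ j ∈ 𝓝 (limitData H I c Y) ∨
      (weakRegion H M s θ₀)ᶜ ∈ 𝓝 (limitData H I c Y) := by
  filter_upwards [ae_dataSlack_ne_zero (θ₀ := θ₀) (c := c) hH hI hs] with Y hY
  by_cases h : ∃ l, dataSlack H M s θ₀ (limitData H I c Y) l < 0
  · obtain ⟨l, hl⟩ := h
    exact Or.inr (weakRegion_compl_mem_nhds hl)
  · push Not at h
    exact Or.inl (strictRegion_mem_nhds hH j
      ⟨fun l => lt_of_le_of_ne (h l) (hY l).symm, pivotParam_var_pos hH hI j⟩)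

lemma ae_coverRegion (hH : H.PosDef) (hI : I.PosDef) (hs : ∀ k, s k = 1 ∨ s k = -1)
    (j : Slope M) {ζ : ℝ} (hζ : ζ ∈ Set.Ioo (0 : ℝ) 1) :
    ∀ᵐ Y ∂gaussianVec I, coverRegion H M s θ₀ j ζ ∈ 𝓝 (limitData H I c Y) ∨
      (notMissRegion H M s θ₀ j ζ)ᶜ ∈ 𝓝 (limitData H I c Y) := by
  -- the pivot, being uniform, does not hit the levels of the interval
  have hnull : ∀ α ∈ Set.Icc (0 : ℝ) 1, ∀ᵐ Y ∂gaussianVec I,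
      ¬ (limitData H I c Y ∈ strictRegion H M s θ₀ j ∧
        dataPivot H M s θ₀ j (limitData H I c Y) = α) := by
    intro α hα
    have := gaussianVec_dataPivot (c := c) (s := s) (θ₀ := θ₀) hH hI j hα.1 le_rfl hα.2
    rw [sub_self, ENNReal.ofReal_zero, zero_mul] at this
    refine measure_mono_null (fun Y hY => ?_) this
    have hY' := not_not.1 hY
    exact ⟨hY'.1, by rw [hY'.2]; exact Set.left_mem_Icc.2 le_rfl⟩
  obtain ⟨hζ0, hζ1⟩ := hζ
  filter_upwards [ae_strictRegion (θ₀ := θ₀) (c := c) hH hI hs j,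
    hnull (ζ / 2) ⟨by linarith, by linarith⟩,
    hnull (1 - ζ / 2) ⟨by linarith, by linarith⟩] with Y hY h1 h2
  rcases hY with hY | hY
  · have hmem := mem_of_mem_nhds hY
    have hcont := continuousAt_dataPivot hH j hmem
    by_cases hin : dataPivot H M s θ₀ j (limitData H I c Y) ∈ Set.Icc (ζ / 2) (1 - ζ / 2)
    · left
      have hlt1 := lt_of_le_of_ne hin.1 fun h => h1 ⟨hmem, h.symm⟩
      have hlt2 := lt_of_le_of_ne hin.2 fun h => h2 ⟨hmem, h⟩
      filter_upwards [hY, hcont.eventually (Icc_mem_nhds hlt1 hlt2)] with v hv1 hv2 using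
        ⟨hv1, hv2⟩
    · right
      filter_upwards [hY, hcont.eventually (isClosed_Icc.isOpen_compl.mem_nhds hin)]
        with v hv1 hv2 hv3
      exact hv2 (hv3.2 hv1)
  · exact Or.inr (mem_of_superset hY fun v hv h => hv h.1)

/-- In the limit experiment the interval covers with conditional probability `1 - ζ`. -/
lemma gaussianVec_coverRegion (hH : H.PosDef) (hI : I.PosDef) (j : Slope M) {ζ : ℝ}
    (hζ : ζ ∈ Set.Ioo (0 : ℝ) 1) :
    gaussianVec I (limitData H I c ⁻¹' coverRegion H M s θ₀ j ζ) = ENNReal.ofReal (1 - ζ) *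
      gaussianVec I (limitData H I c ⁻¹' strictRegion H M s θ₀ j) := by
  have := gaussianVec_dataPivot (c := c) (s := s) (θ₀ := θ₀) hH hI j (α := ζ / 2)
    (β := 1 - ζ / 2) (by linarith [hζ.1]) (by linarith [hζ.2]) (by linarith [hζ.1])
  rw [show 1 - ζ / 2 - ζ / 2 = 1 - ζ by ring] at this
  exact this

/-- Every model which contains the true one, with compatible signs, is selected with positive
probability in the limit. -/
lemma gaussianVec_strictRegion_ne_zero (hH : H.PosDef) (hI : I.PosDef) (hc : 0 < c)
    (hs : ∀ k, s k = 1 ∨ s k = -1) (j : Slope M) :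
    gaussianVec I (limitData H I c ⁻¹' strictRegion H M s θ₀ j) ≠ 0 := by
  have := isOpenPosMeasure_gaussianVec hI
  have heq : limitData H I c ⁻¹' strictRegion H M s θ₀ j =
      ⋂ l, {Y | 0 < slack H M s θ₀ Y c 0 l} := by
    ext Y
    rw [Set.mem_iInter]
    exact ⟨fun h => h.1, fun h => ⟨h, pivotParam_var_pos hH hI j⟩⟩
  have hopen : IsOpen (limitData H I c ⁻¹' strictRegion H M s θ₀ j) := by
    rw [heq]
    refine isOpen_iInter_of_finite fun l => isOpen_lt continuous_const ?_
    exact (continuous_slack (H := H) (M := M) (s := s) (θ₀ := θ₀) l).comp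
      (f := fun Y : Fin (p + 1) → ℝ => (Y, c, (0 : ℝ))) (by fun_prop)
  refine (hopen.measure_pos _ ?_).ne'
  -- the score which makes the signs themselves the localized solution, with zero inactive gradient
  set u : Fin (p + 1) → ℝ := extendZero (padSign M s)
  set v : Fin (p + 1) → ℝ := c • extendZero (padSign M s)
  have hu : ∀ k ∉ M, u k = 0 := fun k hk => extendZero_of_notMem _ hk
  have hv : ∀ k : Act M, v k.1 = c * padSign M s k := fun k => by
    simp [v, extendZero_val]
  refine ⟨v + H *ᵥ u, ?_⟩
  rw [heq, Set.mem_iInter]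
  rintro (k | k | k)
  · show 0 < |θ₀ k.1| + _
    rw [activeSol_eq hH hu hv]
    have h1 : s k * u k.1 = 1 := by
      rw [show u k.1 = s k from (extendZero_val (padSign M s) ⟨k.1, k.2.1⟩).trans
        (padSign_slope s k)]
      rcases hs k with h | h <;> simp [h]
    simp only [h1]
    split_ifs with h
    · simp [h]
    · simpa using h
  · show 0 < c - _
    rw [inactiveGrad_eq hH hu hv]
    simpa [v, extendZero_of_notMem _ k.2] using hc
  · show 0 < c + _
    rw [inactiveGrad_eq hH hu hv]
    simpa [v, extendZero_of_notMem _ k.2] using hc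

end Limit

/-! ### Limit theorems for score, Hessian and information matrix -/

section Array

variable {Ω : Type*} [MeasurableSpace Ω] {P : Measure Ω} {p : ℕ}

/-- The consequences of the model and of the regularity conditions from which the limit theory of
the Lasso is derived. -/
structure RegularArray (P : Measure Ω) (a cd : ℝ → ℝ) (θ₀ : Fin (p + 1) → ℝ)
    (y : (n : ℕ) → Fin n → Ω → ℝ) (x : (n : ℕ) → Fin n → Ω → Fin (p + 1) → ℝ)
    (w : (n : ℕ) → Fin n → ℝ) (B L η : ℝ) (H I : Matrix (Fin (p + 1)) (Fin (p + 1)) ℝ) : Prop where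
  measurable_y : ∀ n i, Measurable (y n i)
  measurable_x : ∀ n i, Measurable (x n i)
  diff : Differentiable ℝ a
  diff_deriv : Differentiable ℝ (deriv a)
  convex : ∀ v, ConvexOn ℝ Set.univ (loss a cd v)
  B_nonneg : 0 ≤ B
  L_nonneg : 0 ≤ L
  η_pos : 0 < η
  indep : ∀ᶠ n in atTop, iIndepFun (fun i ω => (y n i ω, x n i ω)) P
  bounded : ∀ᶠ n in atTop, ∀ᵐ ω ∂P, BoundedSample a (sampleAt (y n) (x n) (w n) ω) θ₀ B L η
  mean_score : ∀ᶠ n in atTop, ∀ i k,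
    ∫ ω, -(w n i * x n i ω k) * (deriv a (x n i ω ⬝ᵥ θ₀) - y n i ω) ∂P = 0
  tendsto_hess : Tendsto (fun n => meanMatrix P fun ω =>
    hess a cd (sampleAt (y n) (x n) (w n) ω) θ₀) atTop (𝓝 H)
  tendsto_info : Tendsto (fun n => meanMatrix P fun ω =>
    info a cd (sampleAt (y n) (x n) (w n) ω) θ₀) atTop (𝓝 I)
  posDef_hess : H.PosDef
  posDef_info : I.PosDef

lemma measurable_dotProduct_const {d : ℕ} (θ : Fin d → ℝ) :
    Measurable fun v : Fin d → ℝ => v ⬝ᵥ θ := by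
  unfold dotProduct
  fun_prop

lemma measurable_deriv_dotProduct {d : ℕ} (f : ℝ → ℝ) (θ : Fin d → ℝ) :
    Measurable fun z : ℝ × (Fin d → ℝ) => deriv f (z.2 ⬝ᵥ θ) :=
  (measurable_deriv f).comp ((measurable_dotProduct_const θ).comp measurable_snd)

lemma BoundedSample.abs_hess_summand_le {n : ℕ} {a : ℝ → ℝ} {D : Sample n p}
    {θ₀ : Fin (p + 1) → ℝ} {B L η : ℝ} (hD : BoundedSample a D θ₀ B L η) (hη : 0 < η)
    (i : Fin n) (k l : Fin (p + 1)) :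
    |D.w i * (D.x i k * D.x i l) * deriv (deriv a) (D.x i ⬝ᵥ θ₀)| ≤ B * (B * B) * B := by
  have h1 := hD.hess_le i (D.x i ⬝ᵥ θ₀) (by simpa using hη.le)
  rw [abs_mul, abs_mul, abs_mul, abs_of_nonneg (hD.w_nonneg i)]
  have hB : 0 ≤ B := (abs_nonneg _).trans h1
  gcongr
  · exact hD.w_le i
  · exact hD.x_le i k
  · exact hD.x_le i l

lemma BoundedSample.abs_info_summand_le {n : ℕ} {a : ℝ → ℝ} {D : Sample n p}
    {θ₀ : Fin (p + 1) → ℝ} {B L η : ℝ} (hD : BoundedSample a D θ₀ B L η)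
    (i : Fin n) (k l : Fin (p + 1)) :
    |D.w i ^ 2 * (D.x i k * D.x i l) * (deriv a (D.x i ⬝ᵥ θ₀) - D.y i) ^ 2| ≤
      B ^ 2 * (B * B) * B ^ 2 := by
  have h1 := hD.score_le i
  have h0 := hD.w_nonneg i
  rw [abs_mul, abs_mul, abs_mul, abs_pow, abs_pow, abs_of_nonneg h0]
  have hB : 0 ≤ B := (abs_nonneg _).trans h1
  gcongr
  · exact hD.w_le i
  · exact hD.x_le i k
  · exact hD.x_le i l

lemma BoundedSample.abs_score_summand_le {n : ℕ} {a : ℝ → ℝ} {D : Sample n p}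
    {θ₀ : Fin (p + 1) → ℝ} {B L η : ℝ} (hD : BoundedSample a D θ₀ B L η)
    (i : Fin n) (k : Fin (p + 1)) :
    |-(D.w i * D.x i k) * (deriv a (D.x i ⬝ᵥ θ₀) - D.y i)| ≤ B * B * B := by
  have h1 := hD.score_le i
  have h0 := hD.w_nonneg i
  have hB : 0 ≤ B := (abs_nonneg _).trans h1
  rw [abs_mul, abs_neg, abs_mul, abs_of_nonneg h0]
  gcongr
  · exact hD.w_le i
  · exact hD.x_le i k

variable [IsProbabilityMeasure P] {a cd : ℝ → ℝ} {θ₀ : Fin (p + 1) → ℝ}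
  {y : (n : ℕ) → Fin n → Ω → ℝ} {x : (n : ℕ) → Fin n → Ω → Fin (p + 1) → ℝ}
  {w : (n : ℕ) → Fin n → ℝ} {B L η : ℝ} {H I : Matrix (Fin (p + 1)) (Fin (p + 1)) ℝ}

/-- A law of large numbers for sample means of bounded functions of the observations. -/
lemma tendsto_measure_mean_of_integral {f : (n : ℕ) → Fin n → ℝ × (Fin (p + 1) → ℝ) → ℝ}
    (hy : ∀ n i, Measurable (y n i)) (hx : ∀ n i, Measurable (x n i))
    (hf : ∀ n i, Measurable (f n i))
    (hind : ∀ᶠ n in atTop, iIndepFun (fun i ω => (y n i ω, x n i ω)) P) {K : ℝ}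
    (hb : ∀ᶠ n in atTop, ∀ i, ∀ᵐ ω ∂P, |f n i (y n i ω, x n i ω)| ≤ K) {m : ℝ}
    (hmean : Tendsto (fun n : ℕ => ∫ ω, (n : ℝ)⁻¹ * ∑ i, f n i (y n i ω, x n i ω) ∂P) atTop (𝓝 m))
    {ε : ℝ} (hε : 0 < ε) :
    Tendsto (fun n : ℕ => P {ω | ε ≤ |(n : ℝ)⁻¹ * ∑ i, f n i (y n i ω, x n i ω) - m|}) atTop
      (𝓝 0) := by
  have hm : ∀ n i, Measurable fun ω => f n i (y n i ω, x n i ω) := fun n i =>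
    (hf n i).comp ((hy n i).prodMk (hx n i))
  refine tendsto_measure_mean_array (ξ := fun n i ω => f n i (y n i ω, x n i ω))
    (Eventually.of_forall hm) ?_ hb (hmean.congr' ?_) hε
  · filter_upwards [hind] with n hn using hn.comp (f n) (hf n)
  · filter_upwards [hb] with n hn
    rw [integral_const_mul, integral_finsetSum _ fun i _ => integrable_of_ae_abs_le (hm n i) (hn i)]

lemma RegularArray.tendsto_measure_hess (h : RegularArray P a cd θ₀ y x w B L η H I)
    (k l : Fin (p + 1)) {ε : ℝ} (hε : 0 < ε) :
    Tendsto (fun n => P {ω | ε ≤ |hess a cd (sampleAt (y n) (x n) (w n) ω) θ₀ k l - H k l|})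
      atTop (𝓝 0) := by
  have hlim := (tendsto_pi_nhds.1 ((tendsto_pi_nhds.1 h.tendsto_hess) k)) l
  simp only [meanMatrix, hess, Matrix.of_apply, loss2_eq cd h.diff] at hlim ⊢
  refine tendsto_measure_mean_of_integral (f := fun n i z => w n i * (z.2 k * z.2 l) *
    deriv (deriv a) (z.2 ⬝ᵥ θ₀)) (K := B * (B * B) * B) h.measurable_y h.measurable_x (fun n i => ?_) h.indep ?_ hlim hε
  · exact Measurable.mul (by fun_prop) (measurable_deriv_dotProduct (deriv a) θ₀)
  · filter_upwards [h.bounded] with n hn i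
    filter_upwards [hn] with ω hω using hω.abs_hess_summand_le h.η_pos i k l

lemma RegularArray.tendsto_measure_info (h : RegularArray P a cd θ₀ y x w B L η H I)
    (k l : Fin (p + 1)) {ε : ℝ} (hε : 0 < ε) :
    Tendsto (fun n => P {ω | ε ≤ |info a cd (sampleAt (y n) (x n) (w n) ω) θ₀ k l - I k l|})
      atTop (𝓝 0) := by
  have hlim := (tendsto_pi_nhds.1 ((tendsto_pi_nhds.1 h.tendsto_info) k)) l
  simp only [meanMatrix, info, Matrix.of_apply, loss1_eq cd h.diff] at hlim ⊢
  refine tendsto_measure_mean_of_integral (f := fun n i z => w n i ^ 2 * (z.2 k * z.2 l) *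
    (deriv a (z.2 ⬝ᵥ θ₀) - z.1) ^ 2) (K := B ^ 2 * (B * B) * B ^ 2) h.measurable_y h.measurable_x
    (fun n i => ?_) h.indep ?_ hlim hε
  · exact Measurable.mul (by fun_prop)
      (((measurable_deriv_dotProduct a θ₀).sub measurable_fst).pow_const 2)
  · filter_upwards [h.bounded] with n hn i
    filter_upwards [hn] with ω hω using hω.abs_info_summand_le i k l

/-- Central limit theorem for the score at the true parameter. -/
lemma RegularArray.tendstoInDistribution_score (h : RegularArray P a cd θ₀ y x w B L η H I) :
    TendstoInDistribution (fun (n : ℕ) ω => √n • score a cd (sampleAt (y n) (x n) (w n) ω) θ₀)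
      atTop id (fun _ => P) (gaussianVec I) := by
  have hfm : ∀ (n : ℕ) (i : Fin n), Measurable fun (z : ℝ × (Fin (p + 1) → ℝ)) (k : Fin (p + 1)) =>
      -(w n i * z.2 k) * (deriv a (z.2 ⬝ᵥ θ₀) - z.1) := fun n i => by
    exact measurable_pi_lambda _ fun k => Measurable.mul (by fun_prop)
      ((measurable_deriv_dotProduct a θ₀).sub measurable_fst)
  have hm : ∀ (n : ℕ) (i : Fin n), Measurable fun ω (k : Fin (p + 1)) =>
      -(w n i * x n i ω k) * (deriv a (x n i ω ⬝ᵥ θ₀) - y n i ω) := fun n i =>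
    (hfm n i).comp ((h.measurable_y n i).prodMk (h.measurable_x n i))
  have key := tendstoInDistribution_sum_array (P := P) (B := B * B * B) (S := I)
    (ζ := fun n i ω k => -(w n i * x n i ω k) * (deriv a (x n i ω ⬝ᵥ θ₀) - y n i ω)) hm
    (by filter_upwards [h.indep] with n hn using hn.comp _ (hfm n))
    (by
      filter_upwards [h.bounded] with n hn i
      filter_upwards [hn] with ω hω k using hω.abs_score_summand_le i k)
    h.mean_score h.posDef_info.posSemidef
    (fun k l => by
      have hlim := (tendsto_pi_nhds.1 ((tendsto_pi_nhds.1 h.tendsto_info) k)) l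
      simp only [meanMatrix, info, Matrix.of_apply, loss1_eq cd h.diff] at hlim
      refine hlim.congr' ?_
      filter_upwards [h.bounded] with n hn
      rw [integral_const_mul, integral_finsetSum]
      · congr 1
        refine Finset.sum_congr rfl fun i _ => ?_
        congr 1
        ext ω
        simp only [sampleAt]
        ring
      · intro i _
        have h1 := (measurable_pi_iff.1 (hm n i) k).mul (measurable_pi_iff.1 (hm n i) l)
        refine integrable_of_ae_abs_le (B := B ^ 2 * (B * B) * B ^ 2) ?_ ?_
        · convert h1 using 1
          ext ω
          simp only [Pi.mul_apply, sampleAt]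
          ring
        · filter_upwards [hn] with ω hω using hω.abs_info_summand_le i k l)
  refine ⟨fun n => ?_, key.aemeasurable_limit, key.tendsto.congr fun n => ?_⟩
  all_goals
    have heq : (fun ω => √n • score a cd (sampleAt (y n) (x n) (w n) ω) θ₀) =
        fun ω => (√n)⁻¹ • ∑ i, fun k => -(w n i * x n i ω k) *
          (deriv a (x n i ω ⬝ᵥ θ₀) - y n i ω) := by
      ext ω k
      simp only [score, loss1_eq cd h.diff, Pi.smul_apply, smul_eq_mul, Finset.sum_apply, neg_mul,
        Finset.sum_neg_distrib, sampleAt]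
      rw [mul_neg, mul_neg, ← mul_assoc]
      congr 2
      rcases Nat.eq_zero_or_pos n with rfl | hn
      · simp
      have hn' : (0 : ℝ) < √n := Real.sqrt_pos.2 (by exact_mod_cast hn)
      nth_rw 2 [← Real.mul_self_sqrt (Nat.cast_nonneg n)]
      field_simp
  · rw [heq]
    exact key.forall_aemeasurable n
  · congr 1
    simp only [heq]

end Array

section Definite

variable {Ω : Type*} [MeasurableSpace Ω] {P : Measure Ω} {d : ℕ}

/-- Limits of mean matrices inherit positive semidefiniteness. -/
lemma posSemidef_of_tendsto_meanMatrix {A : ℕ → Ω → Matrix (Fin d) (Fin d) ℝ}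
    {S : Matrix (Fin d) (Fin d) ℝ} (hS : Tendsto (fun n => meanMatrix P (A n)) atTop (𝓝 S))
    (hsymm : ∀ n ω, (A n ω).IsSymm) (hint : ∀ᶠ n in atTop, ∀ k l, Integrable (fun ω => A n ω k l) P)
    (hpos : ∀ᶠ n in atTop, ∀ u : Fin d → ℝ, ∀ᵐ ω ∂P, 0 ≤ u ⬝ᵥ (A n ω *ᵥ u)) : S.PosSemidef := by
  have hent : ∀ k l, Tendsto (fun n => meanMatrix P (A n) k l) atTop (𝓝 (S k l)) := fun k l =>
    (tendsto_pi_nhds.1 ((tendsto_pi_nhds.1 hS) k)) l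
  refine Matrix.PosSemidef.of_dotProduct_mulVec_nonneg ?_ fun u => ?_
  · ext k l
    rw [Matrix.conjTranspose_apply, star_trivial]
    refine tendsto_nhds_unique (hent l k) ((hent k l).congr fun n => ?_)
    simp only [meanMatrix, Matrix.of_apply]
    exact integral_congr_ae (Eventually.of_forall fun ω => (hsymm n ω).apply l k)
  · have hcont : Continuous fun S : Matrix (Fin d) (Fin d) ℝ => u ⬝ᵥ (S *ᵥ u) := by fun_prop
    rw [star_trivial]
    refine ge_of_tendsto ((hcont.tendsto S).comp hS) ?_
    filter_upwards [hint, hpos] with n hn1 hn2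
    have : u ⬝ᵥ (meanMatrix P (A n) *ᵥ u) = ∫ ω, u ⬝ᵥ (A n ω *ᵥ u) ∂P := by
      simp only [dotProduct, Matrix.mulVec, meanMatrix, Matrix.of_apply]
      rw [integral_finsetSum _ fun k _ => (integrable_finsetSum _ fun l _ =>
        (hn1 k l).mul_const _).const_mul _]
      refine Finset.sum_congr rfl fun k _ => ?_
      rw [integral_const_mul, integral_finsetSum _ fun l _ => (hn1 k l).mul_const _]
      congr 1
      exact Finset.sum_congr rfl fun l _ => (integral_mul_const _ _).symm
    simp only [Function.comp_apply, this]
    exact integral_nonneg_of_ae (hn2 u)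

lemma exists_quadratic_lower_bound [NeZero d] {S : Matrix (Fin d) (Fin d) ℝ} (hS : S.PosDef) :
    ∃ m > 0, ∀ u : Fin d → ℝ, m * ‖u‖ ^ 2 ≤ u ⬝ᵥ (S *ᵥ u) := by
  have hcont : Continuous fun u : Fin d → ℝ => u ⬝ᵥ (S *ᵥ u) := by fun_prop
  obtain ⟨u₀, hu₀, hmin⟩ := (isCompact_sphere (0 : Fin d → ℝ) 1).exists_isMinOn
    (NormedSpace.sphere_nonempty.2 zero_le_one) hcont.continuousOn
  have hne : u₀ ≠ 0 := fun h => by simp [h] at hu₀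
  refine ⟨u₀ ⬝ᵥ (S *ᵥ u₀), by simpa using hS.dotProduct_mulVec_pos hne, fun u => ?_⟩
  rcases eq_or_ne u 0 with rfl | hu
  · simp
  have hn : 0 < ‖u‖ := norm_pos_iff.2 hu
  have h1 := hmin (show ‖u‖⁻¹ • u ∈ Metric.sphere (0 : Fin d → ℝ) 1 by
    simp [norm_smul, hn.ne'])
  simp only [Set.mem_ofPred_eq, Matrix.mulVec_smul, dotProduct_smul, smul_dotProduct,
    smul_eq_mul] at h1
  calc _ ≤ ‖u‖⁻¹ * (‖u‖⁻¹ * (u ⬝ᵥ (S *ᵥ u))) * ‖u‖ ^ 2 := by gcongr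
    _ = _ := by field_simp

end Definite

/-! ### Localization of the Lasso solution -/

section Tools

variable {Ω : Type*} [MeasurableSpace Ω] {P : Measure Ω}

lemma tendsto_measure_exists_zero {κ : Type*} [Fintype κ] {l : Filter ℕ} {A : κ → ℕ → Set Ω}
    (h : ∀ k, Tendsto (fun n => P (A k n)) l (𝓝 0)) :
    Tendsto (fun n => P {ω | ∃ k, ω ∈ A k n}) l (𝓝 0) := by
  have hsum : Tendsto (fun n => ∑ k, P (A k n)) l (𝓝 0) := by
    simpa using tendsto_finsetSum Finset.univ fun k _ => h k
  refine tendsto_of_tendsto_of_tendsto_of_le_of_le tendsto_const_nhds hsum (fun _ => zero_le)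
    fun n => ?_
  have : {ω | ∃ k, ω ∈ A k n} = ⋃ k, A k n := by ext; simp
  rw [this]
  exact measure_iUnion_fintype_le P fun k => A k n

lemma tendsto_const_div_sqrt (K : ℝ) : Tendsto (fun n : ℕ => K / √n) atTop (𝓝 0) :=
  tendsto_const_nhds.div_atTop (Real.tendsto_sqrt_atTop.comp tendsto_natCast_atTop_atTop)

/-- A sequence which converges in distribution is bounded in probability. -/
lemma exists_norm_bound {Ω' E : Type*} [MeasurableSpace Ω'] [IsProbabilityMeasure P]
    {μ : Measure Ω'} [IsProbabilityMeasure μ] [NormedAddCommGroup E] [MeasurableSpace E]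
    [BorelSpace E] {X : ℕ → Ω → E} {Z : Ω' → E}
    (hX : TendstoInDistribution X atTop Z (fun _ => P) μ) {ε : ℝ≥0∞} (hε : ε ≠ 0) :
    ∃ K : ℝ, 0 < K ∧ ∀ᶠ n in atTop, P {ω | K ≤ ‖X n ω‖} ≤ ε := by
  have : IsProbabilityMeasure (μ.map Z) := Measure.isProbabilityMeasure_map hX.aemeasurable_limit
  set S : ℕ → Set E := fun k => {z | (k : ℝ) + 1 ≤ ‖z‖} with hS
  have hcl : ∀ k, IsClosed (S k) := fun k => isClosed_le continuous_const continuous_norm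
  have hanti : Antitone S := fun k l hkl z hz => by
    have : (k : ℝ) ≤ l := by exact_mod_cast hkl
    exact le_trans (by linarith) (show (l : ℝ) + 1 ≤ ‖z‖ from hz)
  have hlim := tendsto_measure_iInter_atTop (μ := μ.map Z)
    (fun k => (hcl k).measurableSet.nullMeasurableSet) hanti ⟨0, measure_ne_top _ _⟩
  have hempty : ⋂ k, S k = ∅ := by
    ext z
    simp only [Set.mem_iInter, Set.mem_empty_iff_false, iff_false, not_forall]
    obtain ⟨k, hk⟩ := exists_nat_gt ‖z‖
    refine ⟨k, fun h => ?_⟩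
    have : (k : ℝ) + 1 ≤ ‖z‖ := h
    linarith
  rw [hempty, measure_empty] at hlim
  obtain ⟨k, hk⟩ := (hlim.eventually (gt_mem_nhds (pos_iff_ne_zero.2 hε))).exists
  have hclo := ProbabilityMeasure.limsup_measure_closed_le_of_tendsto hX.tendsto (hcl k)
  simp only [ProbabilityMeasure.coe_mk] at hclo
  refine ⟨(k : ℝ) + 1, by positivity, ?_⟩
  filter_upwards [eventually_lt_of_limsup_lt (hclo.trans_lt hk)] with n hn
  rw [Measure.map_apply_of_aemeasurable (hX.forall_aemeasurable n) (hcl k).measurableSet] at hn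
  exact hn.le

end Tools

section Localization

variable {Ω : Type*} [MeasurableSpace Ω] {P : Measure Ω} {p : ℕ}

/-- The Lasso `θhat` has penalty level `C n / √n`, with `C` bounded and bounded away from zero. -/
structure IsLassoSeq (P : Measure Ω) (a cd : ℝ → ℝ)
    (y : (n : ℕ) → Fin n → Ω → ℝ) (x : (n : ℕ) → Fin n → Ω → Fin (p + 1) → ℝ)
    (w : (n : ℕ) → Fin n → ℝ) (C : ℕ → ℝ) (Clow Chigh : ℝ)
    (θhat : ℕ → Ω → Fin (p + 1) → ℝ) : Prop where
  pos : 0 < Clow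
  bounds : ∀ᶠ n in atTop, Clow ≤ C n ∧ C n ≤ Chigh
  measurable : ∀ n, Measurable (θhat n)
  isLasso : ∀ n, ∀ᵐ ω ∂P,
    (∃ θ, IsLasso a cd (sampleAt (y n) (x n) (w n) ω) (C n / √n) θ) →
      IsLasso a cd (sampleAt (y n) (x n) (w n) ω) (C n / √n) (θhat n ω)

variable [IsProbabilityMeasure P] {a cd : ℝ → ℝ} {θ₀ : Fin (p + 1) → ℝ}
  {y : (n : ℕ) → Fin n → Ω → ℝ} {x : (n : ℕ) → Fin n → Ω → Fin (p + 1) → ℝ}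
  {w : (n : ℕ) → Fin n → ℝ} {B L η : ℝ} {H I : Matrix (Fin (p + 1)) (Fin (p + 1)) ℝ}
  {C : ℕ → ℝ} {Clow Chigh : ℝ} {θhat : ℕ → Ω → Fin (p + 1) → ℝ}

/-- The event that `θhat` is a Lasso solution within `R / √n` of the true parameter, for a sample
which satisfies the almost sure bounds. -/
def goodEvent (a cd : ℝ → ℝ) (θ₀ : Fin (p + 1) → ℝ) (y : (n : ℕ) → Fin n → Ω → ℝ)
    (x : (n : ℕ) → Fin n → Ω → Fin (p + 1) → ℝ) (w : (n : ℕ) → Fin n → ℝ) (B L η : ℝ)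
    (C : ℕ → ℝ) (θhat : ℕ → Ω → Fin (p + 1) → ℝ) (R : ℝ) (n : ℕ) : Set Ω :=
  {ω | IsLasso a cd (sampleAt (y n) (x n) (w n) ω) (C n / √n) (θhat n ω) ∧
    ‖θhat n ω - θ₀‖ ≤ R / √n ∧ BoundedSample a (sampleAt (y n) (x n) (w n) ω) θ₀ B L η}

lemma RegularArray.tendsto_measure_exists_hess (h : RegularArray P a cd θ₀ y x w B L η H I)
    {ε : ℝ} (hε : 0 < ε) :
    Tendsto (fun n => P {ω | ∃ kl : Fin (p + 1) × Fin (p + 1),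
      ε ≤ |hess a cd (sampleAt (y n) (x n) (w n) ω) θ₀ kl.1 kl.2 - H kl.1 kl.2|}) atTop (𝓝 0) :=
  tendsto_measure_exists_zero fun kl => h.tendsto_measure_hess kl.1 kl.2 hε

/-- The Lasso is `√n`-consistent. -/
lemma RegularArray.exists_goodEvent (h : RegularArray P a cd θ₀ y x w B L η H I)
    (hl : IsLassoSeq P a cd y x w C Clow Chigh θhat) {ε : ℝ≥0∞} (hε : ε ≠ 0) :
    ∃ R > 0, ∀ᶠ n in atTop, P (goodEvent a cd θ₀ y x w B L η C θhat R n)ᶜ ≤ ε := by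
  obtain ⟨K, hK, hKn⟩ := exists_norm_bound h.tendstoInDistribution_score
    (ENNReal.half_pos hε).ne'
  obtain ⟨m, hm, hmH⟩ := exists_quadratic_lower_bound h.posDef_hess
  -- `δ` and `R` are such that on the sphere of radius `R / √n` the quadratic term `m R² / n`
  -- outweighs the error in the Hessian, the score and the penalty
  set δ : ℝ := m / 4 / ((p + 1) * (p + 1)) with hδ
  have hδ0 : 0 < δ := by positivity
  set R : ℝ := 8 * ((p + 1) * (K + |Chigh|)) / m + 1 with hR
  have hR0 : 0 < R := by positivity
  have hRm : (p + 1) * (K + |Chigh|) < m * R / 8 := by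
    have : m * R / 8 = (p + 1) * (K + |Chigh|) + m / 8 := by rw [hR]; field_simp
    linarith
  refine ⟨R, hR0, ?_⟩
  have e1 : ∀ᶠ n : ℕ in atTop, (p + 1) * (B * R) / √n < η :=
    (tendsto_const_div_sqrt _).eventually (gt_mem_nhds h.η_pos)
  have e2 : ∀ᶠ n : ℕ in atTop, B * (L * ((p + 1) * B) ^ 3) * R / √n < m / 8 :=
    (tendsto_const_div_sqrt _).eventually (gt_mem_nhds (by positivity))
  have e3 := (h.tendsto_measure_exists_hess hδ0).eventually (gt_mem_nhds (ENNReal.half_pos hε))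
  filter_upwards [hKn, e1, e2, e3, h.bounded, hl.bounds, eventually_gt_atTop 0]
    with n f1 f2 f3 f4 f5 f6 hn
  have hn' : (0 : ℝ) < √n := Real.sqrt_pos.2 (by exact_mod_cast hn)
  have hsub : (goodEvent a cd θ₀ y x w B L η C θhat R n)ᶜ ≤ᵐ[P]
      ({ω | K ≤ ‖√n • score a cd (sampleAt (y n) (x n) (w n) ω) θ₀‖} ∪
        {ω | ∃ kl : Fin (p + 1) × Fin (p + 1),
          δ ≤ |hess a cd (sampleAt (y n) (x n) (w n) ω) θ₀ kl.1 kl.2 - H kl.1 kl.2|} : Set Ω) := by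
    filter_upwards [f5, hl.isLasso n] with ω hω hlω hbad
    by_contra hcon
    have hcon1 : ¬ K ≤ ‖√n • score a cd (sampleAt (y n) (x n) (w n) ω) θ₀‖ :=
      fun h => hcon (Or.inl h)
    have hcon2 : ∀ k l, |hess a cd (sampleAt (y n) (x n) (w n) ω) θ₀ k l - H k l| ≤ δ :=
      fun k l => by
        by_contra hlt
        exact hcon (Or.inr ⟨(k, l), (not_le.1 hlt).le⟩)
    obtain ⟨hex, hloc⟩ := exists_isLasso_and_norm_sub_le cd h.diff h.diff_deriv h.convex
      h.B_nonneg h.L_nonneg hω (ρ := R / √n) (by positivity)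
      (by rw [← mul_div_assoc, ← mul_div_assoc]; exact f2.le)
      (lam := C n / √n) (K := K / √n) (m := m) (δ := δ)
      (div_nonneg (hl.pos.le.trans f6.1) hn'.le) hmH hcon2
      (le_of_eq (by rw [hδ]; field_simp))
      (fun k => by
        rw [le_div_iff₀ hn']
        have := (norm_le_pi_norm (√n • score a cd (sampleAt (y n) (x n) (w n) ω) θ₀) k).trans
          (not_le.1 hcon1).le
        rwa [Pi.smul_apply, smul_eq_mul, Real.norm_eq_abs, abs_mul, abs_of_pos hn', mul_comm]
          at this)
      (by
        rw [← add_div, ← mul_div_assoc, ← mul_div_assoc, div_right_comm]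
        refine div_lt_div_of_pos_right (lt_of_le_of_lt ?_ hRm) hn'
        gcongr
        exact f6.2.trans (le_abs_self _))
      (by rw [← mul_div_assoc]; exact f3.le)
    exact hbad ⟨hlω hex, hloc _ (hlω hex), hω⟩
  calc _ ≤ _ := measure_mono_ae hsub
    _ ≤ ε / 2 + ε / 2 := (measure_union_le _ _).trans (add_le_add f1 f4.le)
    _ = ε := ENNReal.add_halves ε

lemma RegularArray.tendsto_measure_zero (h : RegularArray P a cd θ₀ y x w B L η H I)
    (hl : IsLassoSeq P a cd y x w C Clow Chigh θhat) {A : ℕ → Set Ω}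
    (hA : ∀ R > 0, Tendsto (fun n => P (goodEvent a cd θ₀ y x w B L η C θhat R n ∩ A n)) atTop
      (𝓝 0)) : Tendsto (fun n => P (A n)) atTop (𝓝 0) := by
  rw [ENNReal.tendsto_nhds_zero]
  intro ε hε
  obtain ⟨R, hR, hRn⟩ := h.exists_goodEvent hl (ENNReal.half_pos hε.ne').ne'
  filter_upwards [hRn, (hA R hR).eventually (gt_mem_nhds (ENNReal.half_pos hε.ne'))] with n h1 h2
  calc P (A n) ≤ P (goodEvent a cd θ₀ y x w B L η C θhat R n ∩ A n ∪
        (goodEvent a cd θ₀ y x w B L η C θhat R n)ᶜ) := measure_mono fun ω hω => by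
          by_cases hg : ω ∈ goodEvent a cd θ₀ y x w B L η C θhat R n
          · exact Or.inl ⟨hg, hω⟩
          · exact Or.inr hg
    _ ≤ ε / 2 + ε / 2 := (measure_union_le _ _).trans (add_le_add h2.le h1)
    _ = ε := ENNReal.add_halves ε

/-- The localized Lasso solution. -/
noncomputable def localSol (θ₀ : Fin (p + 1) → ℝ) (θhat : ℕ → Ω → Fin (p + 1) → ℝ) (n : ℕ)
    (ω : Ω) : Fin (p + 1) → ℝ := √n • (θhat n ω - θ₀)

/-- The rescaled score at the Lasso solution. -/
noncomputable def localSubgrad (a cd : ℝ → ℝ) (y : (n : ℕ) → Fin n → Ω → ℝ)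
    (x : (n : ℕ) → Fin n → Ω → Fin (p + 1) → ℝ) (w : (n : ℕ) → Fin n → ℝ)
    (θhat : ℕ → Ω → Fin (p + 1) → ℝ) (n : ℕ) (ω : Ω) : Fin (p + 1) → ℝ :=
  √n • score a cd (sampleAt (y n) (x n) (w n) ω) (θhat n ω)

omit [MeasurableSpace Ω] in
lemma add_localSol (θ₀ : Fin (p + 1) → ℝ) (θhat : ℕ → Ω → Fin (p + 1) → ℝ) {n : ℕ} (hn : 0 < n)
    (ω : Ω) : (fun k => θ₀ k + (√n)⁻¹ * localSol θ₀ θhat n ω k) = θhat n ω := by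
  have hn' : (0 : ℝ) < √n := Real.sqrt_pos.2 (by exact_mod_cast hn)
  ext k
  simp [localSol, hn'.ne']

omit [MeasurableSpace Ω] in
lemma IsLasso.isKKT {n : ℕ} (hn : 0 < n) {ω : Ω} (ha : Differentiable ℝ a) (hC : 0 ≤ C n)
    (hlas : IsLasso a cd (sampleAt (y n) (x n) (w n) ω) (C n / √n) (θhat n ω)) :
    IsKKT (C n) (√n)⁻¹ θ₀ (localSol θ₀ θhat n ω) (localSubgrad a cd y x w θhat n ω) := by
  have hn' : (0 : ℝ) < √n := Real.sqrt_pos.2 (by exact_mod_cast hn)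
  have hlam : 0 ≤ C n / √n := by positivity
  refine ⟨?_, fun k hk => ?_, fun k hk => ?_⟩
  · simp [localSubgrad, hlas.score_zero cd ha hlam]
  · have := (hlas.abs_score_le cd ha hlam hk).1
    rw [le_div_iff₀ hn'] at this
    simpa [localSubgrad, abs_mul, abs_of_pos hn', mul_comm] using this
  · have h1 := (hlas.abs_score_le cd ha hlam hk).2
    rw [congrFun (add_localSol θ₀ θhat hn ω) k]
    simp only [localSubgrad, Pi.smul_apply, smul_eq_mul]
    rw [mul_assoc, h1]
    field_simp

lemma RegularArray.tendsto_measure_not_isKKT (h : RegularArray P a cd θ₀ y x w B L η H I)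
    (hl : IsLassoSeq P a cd y x w C Clow Chigh θhat) :
    Tendsto (fun n => P {ω | ¬ IsKKT (C n) (√n)⁻¹ θ₀ (localSol θ₀ θhat n ω)
      (localSubgrad a cd y x w θhat n ω)}) atTop (𝓝 0) := by
  refine h.tendsto_measure_zero hl fun R _ => tendsto_const_nhds.congr' ?_
  filter_upwards [hl.bounds, eventually_gt_atTop 0] with n hn hn0
  refine (measure_mono_null (fun ω hω => ?_) measure_empty).symm
  exact hω.2 (hω.1.1.isKKT hn0 h.diff (hl.pos.le.trans hn.1))

lemma RegularArray.tendsto_measure_hess_hat (h : RegularArray P a cd θ₀ y x w B L η H I)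
    (hl : IsLassoSeq P a cd y x w C Clow Chigh θhat) (k l : Fin (p + 1)) {ε : ℝ} (hε : 0 < ε) :
    Tendsto (fun n => P {ω | ε ≤ |hess a cd (sampleAt (y n) (x n) (w n) ω) (θhat n ω) k l -
      H k l|}) atTop (𝓝 0) := by
  refine h.tendsto_measure_zero hl fun R hR => ?_
  refine tendsto_of_tendsto_of_tendsto_of_le_of_le' tendsto_const_nhds
    (h.tendsto_measure_hess k l (half_pos hε)) (Eventually.of_forall fun _ => zero_le) ?_
  have e1 : ∀ᶠ n : ℕ in atTop, (p + 1) * (B * R) / √n < η :=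
    (tendsto_const_div_sqrt _).eventually (gt_mem_nhds h.η_pos)
  have e2 : ∀ᶠ n : ℕ in atTop, B ^ 3 * (L * ((p + 1) * (B * R))) / √n < ε / 2 :=
    (tendsto_const_div_sqrt _).eventually (gt_mem_nhds (half_pos hε))
  filter_upwards [e1, e2] with n f1 f2
  refine measure_mono fun ω hω => ?_
  obtain ⟨⟨-, hloc, hbd⟩, hω2⟩ := hω
  have h1 := abs_hess_sub_le cd h.diff h.B_nonneg h.L_nonneg hbd hloc
    (by rw [← mul_div_assoc, ← mul_div_assoc]; exact f1.le) k l
  rw [show B ^ 3 * (L * ((p + 1) * (B * (R / √n)))) = B ^ 3 * (L * ((p + 1) * (B * R))) / √n by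
    ring] at h1
  have h2 := abs_sub_le (hess a cd (sampleAt (y n) (x n) (w n) ω) (θhat n ω) k l)
    (hess a cd (sampleAt (y n) (x n) (w n) ω) θ₀ k l) (H k l)
  have hω3 : ε ≤ |hess a cd (sampleAt (y n) (x n) (w n) ω) (θhat n ω) k l - H k l| := hω2
  show ε / 2 ≤ _
  linarith

lemma RegularArray.tendsto_measure_info_hat (h : RegularArray P a cd θ₀ y x w B L η H I)
    (hl : IsLassoSeq P a cd y x w C Clow Chigh θhat) (k l : Fin (p + 1)) {ε : ℝ} (hε : 0 < ε) :
    Tendsto (fun n => P {ω | ε ≤ |info a cd (sampleAt (y n) (x n) (w n) ω) (θhat n ω) k l -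
      I k l|}) atTop (𝓝 0) := by
  refine h.tendsto_measure_zero hl fun R hR => ?_
  refine tendsto_of_tendsto_of_tendsto_of_le_of_le' tendsto_const_nhds
    (h.tendsto_measure_info k l (half_pos hε)) (Eventually.of_forall fun _ => zero_le) ?_
  have e1 : ∀ᶠ n : ℕ in atTop, (p + 1) * (B * R) / √n < η :=
    (tendsto_const_div_sqrt _).eventually (gt_mem_nhds h.η_pos)
  have e2 : ∀ᶠ n : ℕ in atTop, B ^ 4 * (B * ((p + 1) * (B * (R / √n))) *
      (2 * B + B * ((p + 1) * (B * (R / √n))))) < ε / 2 := by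
    have hlim : Tendsto (fun n : ℕ => B ^ 4 * (B * ((p + 1) * (B * (R / √n))) *
        (2 * B + B * ((p + 1) * (B * (R / √n)))))) atTop (𝓝 (B ^ 4 * (B * ((p + 1) * (B * 0)) *
        (2 * B + B * ((p + 1) * (B * 0)))))) := by
      have := tendsto_const_div_sqrt R
      have h2 := ((this.const_mul B).const_mul ((p : ℝ) + 1)).const_mul B
      exact (h2.mul (h2.const_add (2 * B))).const_mul (B ^ 4)
    exact hlim.eventually (gt_mem_nhds (by simpa using hε))
  filter_upwards [e1, e2] with n f1 f2
  refine measure_mono fun ω hω => ?_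
  obtain ⟨⟨-, hloc, hbd⟩, hω2⟩ := hω
  have h1 := abs_info_sub_le cd h.diff h.diff_deriv h.B_nonneg hbd hloc
    (by rw [← mul_div_assoc, ← mul_div_assoc]; exact f1.le) k l
  have h2 := abs_sub_le (info a cd (sampleAt (y n) (x n) (w n) ω) (θhat n ω) k l)
    (info a cd (sampleAt (y n) (x n) (w n) ω) θ₀ k l) (I k l)
  have hω3 : ε ≤ |info a cd (sampleAt (y n) (x n) (w n) ω) (θhat n ω) k l - I k l| := hω2
  show ε / 2 ≤ _
  linarith

/-- The localized score is asymptotically equivalent to the rescaled score at the true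
parameter. -/
lemma RegularArray.tendsto_measure_score_sub (h : RegularArray P a cd θ₀ y x w B L η H I)
    (hl : IsLassoSeq P a cd y x w C Clow Chigh θhat) {ε : ℝ} (hε : 0 < ε) (k : Fin (p + 1)) :
    Tendsto (fun n : ℕ => P {ω | ε ≤ |(localSubgrad a cd y x w θhat n ω +
      H *ᵥ localSol θ₀ θhat n ω) k -
        (√n • score a cd (sampleAt (y n) (x n) (w n) ω) θ₀) k|}) atTop (𝓝 0) := by
  refine h.tendsto_measure_zero hl fun R hR => ?_
  set δ : ℝ := ε / 2 / ((p + 1) * R) with hδ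
  have hδ0 : 0 < δ := by positivity
  refine tendsto_of_tendsto_of_tendsto_of_le_of_le' tendsto_const_nhds
    (h.tendsto_measure_exists_hess hδ0) (Eventually.of_forall fun _ => zero_le) ?_
  have e1 : ∀ᶠ n : ℕ in atTop, (p + 1) * (B * R) / √n < η :=
    (tendsto_const_div_sqrt _).eventually (gt_mem_nhds h.η_pos)
  have e2 : ∀ᶠ n : ℕ in atTop, B ^ 2 * (L * ((p + 1) * (B * R)) ^ 2) / √n < ε / 2 :=
    (tendsto_const_div_sqrt _).eventually (gt_mem_nhds (half_pos hε))
  filter_upwards [e1, e2, eventually_gt_atTop 0] with n f1 f2 hn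
  have hn' : (0 : ℝ) < √n := Real.sqrt_pos.2 (by exact_mod_cast hn)
  refine measure_mono fun ω hω => ?_
  obtain ⟨⟨-, hloc, hbd⟩, hω2⟩ := hω
  by_contra hcon
  have hcon2 : ∀ l, |(H - hess a cd (sampleAt (y n) (x n) (w n) ω) θ₀) k l| ≤ δ := fun l => by
    by_contra hlt
    rw [Matrix.sub_apply, abs_sub_comm] at hlt
    exact hcon ⟨(k, l), (not_le.1 hlt).le⟩
  have h1 := abs_score_taylor_le cd h.diff h.diff_deriv h.B_nonneg h.L_nonneg hbd hloc
    (by rw [← mul_div_assoc, ← mul_div_assoc]; exact f1.le) k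
  set D := sampleAt (y n) (x n) (w n) ω
  set u := localSol θ₀ θhat n ω with hu
  have hun : ‖u‖ ≤ R := by
    rw [hu, localSol, norm_smul, Real.norm_of_nonneg hn'.le, mul_comm, ← le_div_iff₀ hn']
    exact hloc
  have h2 := abs_dotProduct_le (x := (H - hess a cd D θ₀) k) hcon2 hun
  have h3 : √n * (B ^ 2 * (L * ((p + 1) * (B * (R / √n))) ^ 2)) =
      B ^ 2 * (L * ((p + 1) * (B * R)) ^ 2) / √n := by
    field_simp
  -- the remainder of the linearized score plus the error in replacing the Hessian by its limit
  have h4 : (localSubgrad a cd y x w θhat n ω + H *ᵥ u) k - (√n • score a cd D θ₀) k =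
      √n * (score a cd D (θhat n ω) k - score a cd D θ₀ k +
        (hess a cd D θ₀ *ᵥ (θhat n ω - θ₀)) k) + (H - hess a cd D θ₀) k ⬝ᵥ u := by
    have h5 : (H - hess a cd D θ₀) k ⬝ᵥ u =
        (H *ᵥ u) k - √n * (hess a cd D θ₀ *ᵥ (θhat n ω - θ₀)) k := by
      show ((H - hess a cd D θ₀) *ᵥ u) k = _
      rw [Matrix.sub_mulVec, Pi.sub_apply]
      congr 1
      rw [hu, localSol, Matrix.mulVec_smul]
      rfl
    rw [h5]
    simp only [localSubgrad, Pi.add_apply, Pi.smul_apply, smul_eq_mul, D]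
    ring
  have h6 : √n * |score a cd D (θhat n ω) k - score a cd D θ₀ k +
        (hess a cd D θ₀ *ᵥ (θhat n ω - θ₀)) k| < ε / 2 :=
    (mul_le_mul_of_nonneg_left h1 hn'.le).trans_lt (by rw [h3]; exact f2)
  have h7 : ((p + 1 : ℕ) : ℝ) * (δ * R) = ε / 2 := by
    rw [hδ]; push_cast; field_simp
  have hω3 : ε ≤ |(localSubgrad a cd y x w θhat n ω + H *ᵥ u) k - (√n • score a cd D θ₀) k| := hω2
  rw [h4] at hω3
  have h8 := abs_add_le (√n * (score a cd D (θhat n ω) k - score a cd D θ₀ k +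
        (hess a cd D θ₀ *ᵥ (θhat n ω - θ₀)) k)) ((H - hess a cd D θ₀) k ⬝ᵥ u)
  rw [abs_mul, abs_of_pos hn'] at h8
  linarith

end Localization

/-! ### Coverage -/

section Coverage

variable {Ω : Type*} [MeasurableSpace Ω] {P : Measure Ω} [IsProbabilityMeasure P] {p : ℕ}
  {a cd : ℝ → ℝ} {θ₀ : Fin (p + 1) → ℝ}
  {y : (n : ℕ) → Fin n → Ω → ℝ} {x : (n : ℕ) → Fin n → Ω → Fin (p + 1) → ℝ}
  {w : (n : ℕ) → Fin n → ℝ} {B L η : ℝ} {H I : Matrix (Fin (p + 1)) (Fin (p + 1)) ℝ}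
  {C : ℕ → ℝ} {Clow Chigh : ℝ} {θhat : ℕ → Ω → Fin (p + 1) → ℝ}

omit [IsProbabilityMeasure P] in
lemma RegularArray.measurable_deriv_predictor (h : RegularArray P a cd θ₀ y x w B L η H I)
    {θ : Ω → Fin (p + 1) → ℝ} (hθ : Measurable θ) (f : ℝ → ℝ) (n : ℕ) (i : Fin n) :
    Measurable fun ω => deriv f (x n i ω ⬝ᵥ θ ω) := by
  have h1 : Measurable fun ω => x n i ω ⬝ᵥ θ ω := by
    unfold dotProduct
    exact Finset.measurable_fun_sum _ fun k _ =>
      (measurable_pi_iff.1 (h.measurable_x n i) k).mul (measurable_pi_iff.1 hθ k)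
  exact (measurable_deriv f).comp h1

omit [IsProbabilityMeasure P] in
lemma RegularArray.measurable_score (h : RegularArray P a cd θ₀ y x w B L η H I)
    {θ : Ω → Fin (p + 1) → ℝ} (hθ : Measurable θ) (n : ℕ) :
    Measurable fun ω => score a cd (sampleAt (y n) (x n) (w n) ω) (θ ω) := by
  refine measurable_pi_lambda _ fun k => ?_
  simp only [score, loss1_eq cd h.diff, sampleAt]
  refine ((Finset.measurable_fun_sum _ fun i _ => ?_).const_mul _).neg
  exact ((measurable_pi_iff.1 (h.measurable_x n i) k).const_mul _).mul
    ((h.measurable_deriv_predictor hθ a n i).sub (h.measurable_y n i))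

omit [IsProbabilityMeasure P] in
lemma RegularArray.measurable_hess (h : RegularArray P a cd θ₀ y x w B L η H I)
    {θ : Ω → Fin (p + 1) → ℝ} (hθ : Measurable θ) (n : ℕ) :
    Measurable fun ω k l => hess a cd (sampleAt (y n) (x n) (w n) ω) (θ ω) k l := by
  refine measurable_pi_lambda _ fun k => measurable_pi_lambda _ fun l => ?_
  simp only [hess, Matrix.of_apply, loss2_eq cd h.diff, sampleAt]
  refine (Finset.measurable_fun_sum _ fun i _ => ?_).const_mul _
  exact (((measurable_pi_iff.1 (h.measurable_x n i) k).mul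
    (measurable_pi_iff.1 (h.measurable_x n i) l)).const_mul _).mul
    (h.measurable_deriv_predictor hθ (deriv a) n i)

omit [IsProbabilityMeasure P] in
lemma RegularArray.measurable_info (h : RegularArray P a cd θ₀ y x w B L η H I)
    {θ : Ω → Fin (p + 1) → ℝ} (hθ : Measurable θ) (n : ℕ) :
    Measurable fun ω k l => info a cd (sampleAt (y n) (x n) (w n) ω) (θ ω) k l := by
  refine measurable_pi_lambda _ fun k => measurable_pi_lambda _ fun l => ?_
  simp only [info, Matrix.of_apply, loss1_eq cd h.diff, sampleAt]
  refine (Finset.measurable_fun_sum _ fun i _ => ?_).const_mul _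
  exact (((measurable_pi_iff.1 (h.measurable_x n i) k).mul
    (measurable_pi_iff.1 (h.measurable_x n i) l)).const_mul _).mul
    (((h.measurable_deriv_predictor hθ a n i).sub (h.measurable_y n i)).pow_const 2)

/-- The local data of the sample. -/
noncomputable def sampleData (a cd : ℝ → ℝ) (θ₀ : Fin (p + 1) → ℝ) (y : (n : ℕ) → Fin n → Ω → ℝ)
    (x : (n : ℕ) → Fin n → Ω → Fin (p + 1) → ℝ) (w : (n : ℕ) → Fin n → ℝ)
    (H : Matrix (Fin (p + 1)) (Fin (p + 1)) ℝ) (C : ℕ → ℝ) (θhat : ℕ → Ω → Fin (p + 1) → ℝ)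
    (n : ℕ) (ω : Ω) : LocalData p :=
  (localSubgrad a cd y x w θhat n ω + H *ᵥ localSol θ₀ θhat n ω,
    ((fun k l => hess a cd (sampleAt (y n) (x n) (w n) ω) (θhat n ω) k l,
      fun k l => info a cd (sampleAt (y n) (x n) (w n) ω) (θhat n ω) k l), C n, (√n)⁻¹))

omit [IsProbabilityMeasure P] in
lemma RegularArray.measurable_localScore (h : RegularArray P a cd θ₀ y x w B L η H I)
    (hl : IsLassoSeq P a cd y x w C Clow Chigh θhat) (n : ℕ) :
    Measurable fun ω => localSubgrad a cd y x w θhat n ω + H *ᵥ localSol θ₀ θhat n ω := by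
  have h1 : Measurable (localSubgrad a cd y x w θhat n) :=
    (h.measurable_score (hl.measurable n) n).const_smul (√n)
  have h2 : Measurable (localSol θ₀ θhat n) :=
    ((hl.measurable n).sub measurable_const).const_smul (√n)
  have h3 : Continuous fun u : Fin (p + 1) → ℝ => H *ᵥ u := by fun_prop
  exact h1.add (h3.measurable.comp h2)

/-- The local data converge in distribution to those of the limit experiment, along any filter
along which the penalty constant converges. -/
lemma RegularArray.tendstoInDistribution_sampleData
    (h : RegularArray P a cd θ₀ y x w B L η H I)
    (hl : IsLassoSeq P a cd y x w C Clow Chigh θhat) {l : Filter ℕ} [l.IsCountablyGenerated]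
    (hlt : l ≤ atTop) {c : ℝ} (hc : Tendsto C l (𝓝 c)) :
    TendstoInDistribution (sampleData a cd θ₀ y x w H C θhat) l (limitData H I c) (fun _ => P)
      (gaussianVec I) := by
  have hscore : TendstoInDistribution
      (fun n ω => localSubgrad a cd y x w θhat n ω + H *ᵥ localSol θ₀ θhat n ω) l id
      (fun _ => P) (gaussianVec I) := by
    have hW := h.tendstoInDistribution_score
    refine tendstoInDistribution_of_tendstoInMeasure_sub
      (X := fun (n : ℕ) ω => √n • score a cd (sampleAt (y n) (x n) (w n) ω) θ₀) _ _
      ⟨hW.forall_aemeasurable, hW.aemeasurable_limit, hW.tendsto.mono_left hlt⟩ ?_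
      (fun n => (h.measurable_localScore hl n).aemeasurable)
    rw [tendstoInMeasure_iff_norm]
    intro ε hε
    have hlim := (tendsto_measure_exists_zero fun k =>
      h.tendsto_measure_score_sub hl hε k).mono_left hlt
    refine tendsto_of_tendsto_of_tendsto_of_le_of_le tendsto_const_nhds hlim (fun _ => zero_le)
      fun n => measure_mono fun ω hω => ?_
    by_contra hcon
    have hω' : ε ≤ ‖localSubgrad a cd y x w θhat n ω + H *ᵥ localSol θ₀ θhat n ω -
        √n • score a cd (sampleAt (y n) (x n) (w n) ω) θ₀‖ := by simpa using hω
    refine not_lt.2 hω' ((pi_norm_lt_iff hε).2 fun k => ?_)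
    by_contra hk
    exact hcon ⟨k, not_lt.1 hk⟩
  refine hscore.prodMk_of_tendstoInMeasure_const _ (fun n ω =>
    ((fun k l => hess a cd (sampleAt (y n) (x n) (w n) ω) (θhat n ω) k l,
      fun k l => info a cd (sampleAt (y n) (x n) (w n) ω) (θhat n ω) k l), C n, (√n)⁻¹)) _
    (c := ((fun k l => H k l, fun k l => I k l), c, 0)) ?_ fun n =>
      (((h.measurable_hess (hl.measurable n) n).prodMk
        (h.measurable_info (hl.measurable n) n)).prodMk measurable_const).aemeasurable
  rw [tendstoInMeasure_iff_dist]
  intro ε hε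
  have h1 := (tendsto_measure_exists_zero fun kl : Fin (p + 1) × Fin (p + 1) =>
    h.tendsto_measure_hess_hat hl kl.1 kl.2 hε).mono_left hlt
  have h2 := (tendsto_measure_exists_zero fun kl : Fin (p + 1) × Fin (p + 1) =>
    h.tendsto_measure_info_hat hl kl.1 kl.2 hε).mono_left hlt
  have h3 : ∀ᶠ n in l, dist (C n) c < ε := Metric.tendsto_nhds.1 hc ε hε
  have h4 : ∀ᶠ n : ℕ in l, dist (√n)⁻¹ 0 < ε := by
    have : Tendsto (fun n : ℕ => (√n)⁻¹) atTop (𝓝 0) := by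
      simpa using tendsto_const_div_sqrt 1
    exact Metric.tendsto_nhds.1 (this.mono_left hlt) ε hε
  have h12 := h1.add h2
  rw [add_zero] at h12
  refine tendsto_of_tendsto_of_tendsto_of_le_of_le' tendsto_const_nhds h12
    (Eventually.of_forall fun _ => zero_le) ?_
  filter_upwards [h3, h4] with n f3 f4
  refine (measure_mono fun ω hω => ?_).trans (measure_union_le _ _)
  by_contra hcon
  have g1 : ∀ k l, dist (hess a cd (sampleAt (y n) (x n) (w n) ω) (θhat n ω) k l) (H k l) < ε :=
    fun k l => by
      by_contra hk
      exact hcon (Or.inl ⟨(k, l), not_lt.1 hk⟩)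
  have g2 : ∀ k l, dist (info a cd (sampleAt (y n) (x n) (w n) ω) (θhat n ω) k l) (I k l) < ε :=
    fun k l => by
      by_contra hk
      exact hcon (Or.inr ⟨(k, l), not_lt.1 hk⟩)
  refine not_lt.2 hω (max_lt (max_lt ?_ ?_) (max_lt f3 f4))
  · exact (dist_pi_lt_iff hε).2 fun k => (dist_pi_lt_iff hε).2 fun l => g1 k l
  · exact (dist_pi_lt_iff hε).2 fun k => (dist_pi_lt_iff hε).2 fun l => g2 k l

section Selected

variable {M : Finset (Fin (p + 1))} {s : Slope M → ℝ}

lemma measurableSet_selects {θ : Ω → Fin (p + 1) → ℝ} (hθ : Measurable θ) :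
    MeasurableSet {ω | Selects M s (θ ω)} := by
  have hk : ∀ k, Measurable fun ω => θ ω k := measurable_pi_iff.1 hθ
  have h1 : MeasurableSet {ω | activeSet (θ ω) = M} := by
    have : {ω | activeSet (θ ω) = M} = ⋂ k, {ω | (k = 0 ∨ θ ω k ≠ 0) ↔ k ∈ M} := by
      ext ω
      simp [Finset.ext_iff, activeSet]
    rw [this]
    refine MeasurableSet.iInter fun k => ?_
    have h0 : MeasurableSet {ω | k = 0 ∨ θ ω k ≠ 0} :=
      (MeasurableSet.const _).union ((hk k) (measurableSet_singleton 0).compl)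
    by_cases hkM : k ∈ M
    · simpa [hkM] using h0
    · have := h0.compl
      simpa [hkM, Set.compl_def] using this
  have h2 : MeasurableSet {ω | ∀ k : Slope M, Real.sign (θ ω k.1) = s k} := by
    have : {ω | ∀ k : Slope M, Real.sign (θ ω k.1) = s k} =
        ⋂ k : Slope M, {ω | Real.sign (θ ω k.1) = s k} := by
      ext ω
      simp
    rw [this]
    refine MeasurableSet.iInter fun k => ?_
    have hsign : Measurable Real.sign := by
      unfold Real.sign
      exact Measurable.ite measurableSet_Iio measurable_const
        (Measurable.ite measurableSet_Ioi measurable_const measurable_const)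
    exact (hsign.comp (hk k.1)) (measurableSet_singleton (s k))
  exact h1.inter h2

lemma selectiveCI_iff {n : ℕ} {D : Sample n p} {lam ζ : ℝ} {θ : Fin (p + 1) → ℝ}
    (hsel : Selects M s θ) (j : Slope M) (q : ℝ) :
    q ∈ selectiveCI a cd D lam θ ζ j.1 ↔ q ∈ modelCI a cd D lam θ M s ζ j := by
  obtain ⟨rfl, hs⟩ := hsel
  have : (fun l : Slope (activeSet θ) => Real.sign (θ l.1)) = s := funext hs
  constructor
  · rintro ⟨_, hq⟩
    rwa [this] at hq
  · intro hq
    refine ⟨j.2, ?_⟩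
    rwa [this]

/-- Along a filter along which the penalty constant converges, the probabilities of selection and
of selection with coverage converge to those of the limit experiment. The first limit is positive,
so their quotient converges as well. -/
lemma RegularArray.tendsto_coverage_of_tendsto
    (h : RegularArray P a cd θ₀ y x w B L η H I)
    (hl : IsLassoSeq P a cd y x w C Clow Chigh θhat) (hM0 : 0 ∈ M)
    (hM : ∀ k, θ₀ k ≠ 0 → k ∈ M) (hs : ∀ k, s k = 1 ∨ s k = -1)
    (hs₀ : ∀ k : Slope M, θ₀ k.1 ≠ 0 → s k = Real.sign (θ₀ k.1)) (j : Slope M) {ζ : ℝ}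
    (hζ : ζ ∈ Set.Ioo (0 : ℝ) 1) {l : Filter ℕ} [l.IsCountablyGenerated] (hlt : l ≤ atTop) {c : ℝ}
    (hc0 : 0 < c) (hc : Tendsto C l (𝓝 c)) :
    Tendsto (fun n => (P[|{ω | Selects M s (θhat n ω)}]).real
      {ω | θ₀ j.1 ∈ selectiveCI a cd (sampleAt (y n) (x n) (w n) ω) (C n / √n) (θhat n ω) ζ j.1})
      l (𝓝 (1 - ζ)) := by
  have hV := h.tendstoInDistribution_sampleData hl hlt hc
  have hbad := (h.tendsto_measure_not_isKKT hl).mono_left hlt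
  have hev : ∀ᶠ n in l, 0 < n ∧ 0 ≤ C n := by
    filter_upwards [hlt (eventually_gt_atTop 0), hlt hl.bounds] with n h1 h2
    exact ⟨h1, hl.pos.le.trans h2.1⟩
  have hstrict : ∀ᶠ n in l, ∀ ω ∉ {ω | ¬ IsKKT (C n) (√n)⁻¹ θ₀ (localSol θ₀ θhat n ω)
      (localSubgrad a cd y x w θhat n ω)},
      sampleData a cd θ₀ y x w H C θhat n ω ∈ strictRegion H M s θ₀ j →
        Selects M s (θhat n ω) := by
    filter_upwards [hev] with n hn ω hω hreg
    have hτ : (0 : ℝ) < (√n)⁻¹ := inv_pos.2 (Real.sqrt_pos.2 (by exact_mod_cast hn.1))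
    rw [← add_localSol θ₀ θhat hn.1 ω]
    exact (not_not.1 hω).selects h.posDef_hess hM0 hM hτ hn.2 hs hs₀ (fun k => hreg.1 _)
      fun k => (hreg.1 _).le
  have hweak : ∀ᶠ n in l, ∀ ω ∉ {ω | ¬ IsKKT (C n) (√n)⁻¹ θ₀ (localSol θ₀ θhat n ω)
      (localSubgrad a cd y x w θhat n ω)}, Selects M s (θhat n ω) →
        sampleData a cd θ₀ y x w H C θhat n ω ∈ weakRegion H M s θ₀ := by
    filter_upwards [hev] with n hn ω hω hsel
    have hτ : (0 : ℝ) < (√n)⁻¹ := inv_pos.2 (Real.sqrt_pos.2 (by exact_mod_cast hn.1))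
    rw [← add_localSol θ₀ θhat hn.1 ω] at hsel
    exact ⟨hsel.slack_slope_pos h.posDef_hess hM hτ hs₀ (not_not.1 hω),
      hsel.slack_inactive_nonneg h.posDef_hess hM hτ hM0 (not_not.1 hω)⟩
  have hcover : ∀ᶠ n in l, ∀ ω ∉ {ω | ¬ IsKKT (C n) (√n)⁻¹ θ₀ (localSol θ₀ θhat n ω)
      (localSubgrad a cd y x w θhat n ω)}, Selects M s (θhat n ω) →
      sampleData a cd θ₀ y x w H C θhat n ω ∈ strictRegion H M s θ₀ j →
      (θ₀ j.1 ∈ selectiveCI a cd (sampleAt (y n) (x n) (w n) ω) (C n / √n) (θhat n ω) ζ j.1 ↔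
        dataPivot H M s θ₀ j (sampleData a cd θ₀ y x w H C θhat n ω) ∈
          Set.Icc (ζ / 2) (1 - ζ / 2)) := by
    filter_upwards [hev] with n hn ω hω hsel hreg
    exact (selectiveCI_iff hsel j _).trans (mem_modelCI_iff cd h.posDef_hess hM hn.1 hs₀ rfl rfl
      hsel (not_not.1 hω) hreg.1 j hreg.2 hζ)
  -- strict inequalities imply selection, which implies weak ones; the boundary is null in the limit
  have lim1 := tendsto_measure_of_between hV (strictRegion_subset H M s θ₀ j)
    (A := fun n => {ω | Selects M s (θhat n ω)}) hbad hstrict hweak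
    (ae_strictRegion h.posDef_hess h.posDef_info hs j)
  have lim2 := tendsto_measure_of_between hV (coverRegion_subset H M s θ₀ j ζ)
    (A := fun n => {ω | Selects M s (θhat n ω)} ∩
      {ω | θ₀ j.1 ∈ selectiveCI a cd (sampleAt (y n) (x n) (w n) ω) (C n / √n) (θhat n ω) ζ j.1})
    hbad
    (by
      filter_upwards [hstrict, hcover] with n h1 h2 ω hω hreg
      have hsel := h1 ω hω hreg.1
      exact ⟨hsel, (h2 ω hω hsel hreg.1).2 hreg.2⟩)
    (by
      filter_upwards [hweak, hcover] with n h1 h2 ω hω hA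
      exact ⟨h1 ω hω hA.1, fun hreg => (h2 ω hω hA.1 hreg).1 hA.2⟩)
    (ae_coverRegion h.posDef_hess h.posDef_info hs j hζ)
  rw [gaussianVec_coverRegion h.posDef_hess h.posDef_info j hζ] at lim2
  have hne := gaussianVec_strictRegion_ne_zero (θ₀ := θ₀) h.posDef_hess h.posDef_info hc0 hs j
  set π := gaussianVec I (limitData H I c ⁻¹' strictRegion H M s θ₀ j)
  have hπ : π ≠ ∞ := measure_ne_top _ _
  have hdiv := ENNReal.Tendsto.div lim2 (Or.inr hne) lim1 (Or.inl hπ)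
  rw [mul_div_assoc, ENNReal.div_self hne hπ, mul_one] at hdiv
  have hreal := (ENNReal.tendsto_toReal ENNReal.ofReal_ne_top).comp hdiv
  rw [ENNReal.toReal_ofReal (by linarith [hζ.2])] at hreal
  refine hreal.congr fun n => ?_
  rw [Measure.real, cond_apply (measurableSet_selects (hl.measurable n)), mul_comm]
  rfl

lemma RegularArray.tendsto_coverage
    (h : RegularArray P a cd θ₀ y x w B L η H I)
    (hl : IsLassoSeq P a cd y x w C Clow Chigh θhat) (hM0 : 0 ∈ M)
    (hM : ∀ k, θ₀ k ≠ 0 → k ∈ M) (hs : ∀ k, s k = 1 ∨ s k = -1)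
    (hs₀ : ∀ k : Slope M, θ₀ k.1 ≠ 0 → s k = Real.sign (θ₀ k.1)) (j : Slope M) {ζ : ℝ}
    (hζ : ζ ∈ Set.Ioo (0 : ℝ) 1) :
    Tendsto (fun n => (P[|{ω | Selects M s (θhat n ω)}]).real
      {ω | θ₀ j.1 ∈ selectiveCI a cd (sampleAt (y n) (x n) (w n) ω) (C n / √n) (θhat n ω) ζ j.1})
      atTop (𝓝 (1 - ζ)) := by
  refine tendsto_of_subseq_tendsto fun ns hns => ?_
  -- the penalty constants stay in a compact interval, so they converge along a subsequence
  obtain ⟨c, hc, φ, hφ, hlim⟩ := (isCompact_Icc (a := Clow) (b := Chigh)).tendsto_subseq'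
    (x := C ∘ ns) (hns.eventually hl.bounds).frequently
  refine ⟨φ, ?_⟩
  have hle : map (ns ∘ φ) atTop ≤ atTop := hns.comp hφ.tendsto_atTop
  exact tendsto_map'_iff.1 (h.tendsto_coverage_of_tendsto hl hM0 hM hs hs₀ j hζ hle
    (hl.pos.trans_le hc.1) (tendsto_map'_iff.2 hlim))

end Selected

end Coverage

/-! ### Consequences of the regularity conditions -/

section Regularity

variable {Ω : Type*} [MeasurableSpace Ω] {P : Measure Ω} {p : ℕ} {ν : Measure ℝ} {Y : Set ℝ}
  {a c : ℝ → ℝ} {θ₀ : Fin (p + 1) → ℝ} {Cl Cu lmin lmax L₀ η : ℝ}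

section Sample

variable {n : ℕ} {y : Fin n → Ω → ℝ} {x : Fin n → Ω → Fin (p + 1) → ℝ} {w : Fin n → ℝ}

lemma Regular.differentiable (h : Regular P Y a c θ₀ y x w Cl Cu lmin lmax L₀ η) :
    Differentiable ℝ a := by
  have h0 := (h.diff 0).add_const (Real.log (c 0))
  have : a = fun t => loss a c 0 t + Real.log (c 0) := by
    ext t
    simp [loss]
  rw [this]
  exact h0

lemma Regular.differentiable_deriv (h : Regular P Y a c θ₀ y x w Cl Cu lmin lmax L₀ η) :
    Differentiable ℝ (deriv a) := by
  have h0 := h.diff_deriv 0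
  have : deriv (loss a c 0) = deriv a := funext fun t => by
    simpa using (hasDerivAt_loss c h.differentiable 0 t).deriv
  rwa [this] at h0

lemma Regular.boundedSample (h : Regular P Y a c θ₀ y x w Cl Cu lmin lmax L₀ η) (hCl : 0 < Cl)
    (hη : 0 < η) (hY : Y.Nonempty) (hyY : ∀ i, ∀ᵐ ω ∂P, y i ω ∈ Y) :
    ∀ᵐ ω ∂P, BoundedSample a (sampleAt y x w ω) θ₀ |Cu| L₀ η := by
  have ha := h.differentiable
  obtain ⟨v, hv⟩ := hY
  filter_upwards [h.x_bdd, h.lip, h.bdd1, h.bdd2, ae_all_iff.2 hyY] with ω h1 h2 h3 h4 h5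
  refine ⟨fun i k => (h1 i k).le.trans (le_abs_self _), fun i => hCl.le.trans (h.weight i).1.le,
    fun i => (h.weight i).2.le.trans (le_abs_self _), fun i => ?_, fun i t ht => ?_,
    fun i t ht => ?_⟩
  · have := h3 i _ (h5 i)
    rw [loss1_eq c ha] at this
    exact this.trans (le_abs_self _)
  · have := h2 i t (x i ω ⬝ᵥ θ₀) ht (by simpa using hη.le) v hv
    rw [loss2_eq c ha, loss2_eq c ha] at this
    exact this
  · have := h4 i t ht v hv
    rw [loss2_eq c ha] at this
    exact this.trans (le_abs_self _)

lemma Regular.deriv_deriv_nonneg (h : Regular P Y a c θ₀ y x w Cl Cu lmin lmax L₀ η) (t : ℝ) :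
    0 ≤ deriv (deriv a) t := by
  have hmono : Monotone (deriv (loss a c 0)) := by
    have := (h.convex 0).monotoneOn_deriv fun t _ => h.diff 0 t
    exact monotoneOn_univ.1 this
  have := hmono.deriv_nonneg (x := t)
  rwa [← loss2, loss2_eq c h.differentiable] at this

end Sample

variable [IsProbabilityMeasure P] {y : (n : ℕ) → Fin n → Ω → ℝ}
  {x : (n : ℕ) → Fin n → Ω → Fin (p + 1) → ℝ} {w : (n : ℕ) → Fin n → ℝ}
  {Hlim Ilim : Matrix (Fin (p + 1)) (Fin (p + 1)) ℝ}

lemma dotProduct_info_mulVec_nonneg {n : ℕ} (D : Sample n p) (θ u : Fin (p + 1) → ℝ) :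
    0 ≤ u ⬝ᵥ (info a c D θ *ᵥ u) := by
  have h : u ⬝ᵥ (info a c D θ *ᵥ u) =
      (n : ℝ)⁻¹ * ∑ i, (D.w i * loss1 a c (D.y i) (D.x i ⬝ᵥ θ) * (D.x i ⬝ᵥ u)) ^ 2 := by
    have h1 : ∀ i, (D.w i * loss1 a c (D.y i) (D.x i ⬝ᵥ θ) * (D.x i ⬝ᵥ u)) ^ 2 =
        ∑ k, ∑ l, u k * (D.w i ^ 2 * (D.x i k * D.x i l) *
          loss1 a c (D.y i) (D.x i ⬝ᵥ θ) ^ 2 * u l) := fun i => by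
      have : (D.x i ⬝ᵥ u) ^ 2 = ∑ k, ∑ l, (D.x i k * u k) * (D.x i l * u l) := by
        rw [sq, dotProduct, Finset.sum_mul_sum]
      rw [mul_pow, this, Finset.mul_sum]
      refine Finset.sum_congr rfl fun k _ => ?_
      rw [Finset.mul_sum]
      exact Finset.sum_congr rfl fun l _ => by ring
    simp only [h1]
    rw [Finset.sum_comm, Finset.mul_sum]
    refine Finset.sum_congr rfl fun k _ => ?_
    rw [Finset.sum_comm, Finset.mul_sum, Matrix.mulVec, dotProduct, Finset.mul_sum]
    refine Finset.sum_congr rfl fun l _ => ?_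
    simp only [info, Matrix.of_apply, Finset.mul_sum, Finset.sum_mul]
    exact Finset.sum_congr rfl fun i _ => by ring
  rw [h]
  positivity

/-- The regularity conditions provide the setting of the limit theory. The limits of the mean
Hessian and information matrices are positive definite, being limits of positive semidefinite
matrices and nonsingular. -/
lemma regularArray_of_regular [SigmaFinite ν] (hglm : IsGLM ν Y a c)
    (hy : ∀ n i, Measurable (y n i)) (hx : ∀ n i, Measurable (x n i))
    (hdens : ∀ n i, HasGLMDensity P ν a c θ₀ (x n i) (y n i))
    (hCl : 0 < Cl) (hL₀ : 0 < L₀) (hη : 0 < η)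
    (hreg : ∀ᶠ n in atTop, Regular P Y a c θ₀ (y n) (x n) (w n) Cl Cu lmin lmax L₀ η)
    (hHlim : Tendsto (fun n => meanMatrix P fun ω => hess a c (sampleAt (y n) (x n) (w n) ω) θ₀)
      atTop (𝓝 Hlim))
    (hIlim : Tendsto (fun n => meanMatrix P fun ω => info a c (sampleAt (y n) (x n) (w n) ω) θ₀)
      atTop (𝓝 Ilim))
    (hHdet : IsUnit Hlim.det) (hIdet : IsUnit Ilim.det) :
    RegularArray P a c θ₀ y x w |Cu| L₀ η Hlim Ilim := by
  obtain ⟨n₀, hn₀⟩ := hreg.exists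
  have ha := hn₀.differentiable
  have hbdd : ∀ᶠ n in atTop, ∀ᵐ ω ∂P,
      BoundedSample a (sampleAt (y n) (x n) (w n) ω) θ₀ |Cu| L₀ η := by
    filter_upwards [hreg] with n hn
    exact hn.boundedSample hCl hη hglm.nonempty fun i => (hdens n i).ae_mem hglm
  have hxk : ∀ n i k, Measurable fun ω => x n i ω k := fun n i => measurable_pi_iff.1 (hx n i)
  have hd : ∀ (f : ℝ → ℝ) n i, Measurable fun ω => deriv f (x n i ω ⬝ᵥ θ₀) := fun f n i =>
    (measurable_deriv_dotProduct f θ₀).comp ((hy n i).prodMk (hx n i))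
  have hHpsd : Hlim.PosSemidef := by
    refine posSemidef_of_tendsto_meanMatrix hHlim (fun n ω => ?_) ?_ ?_
    · ext k l
      simp only [Matrix.transpose_apply, hess, Matrix.of_apply, mul_comm]
    · filter_upwards [hbdd] with n hn k l
      simp only [hess, Matrix.of_apply, loss2_eq c ha]
      refine (integrable_finsetSum _ fun i _ => ?_).const_mul _
      refine integrable_of_ae_abs_le ?_ (hn.mono fun ω hω => hω.abs_hess_summand_le hη i k l)
      exact (((hxk n i k).mul (hxk n i l)).const_mul _).mul (hd (deriv a) n i)
    · filter_upwards [hbdd] with n hn u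
      filter_upwards [hn] with ω hω
      rw [dotProduct_hess_mulVec c ha]
      refine mul_nonneg (by positivity) (Finset.sum_nonneg fun i _ =>
        mul_nonneg (hω.w_nonneg i) (mul_nonneg (hn₀.deriv_deriv_nonneg _) (sq_nonneg _)))
  have hIpsd : Ilim.PosSemidef := by
    refine posSemidef_of_tendsto_meanMatrix hIlim (fun n ω => ?_) ?_
      (Eventually.of_forall fun n u => Eventually.of_forall fun ω =>
        dotProduct_info_mulVec_nonneg _ _ _)
    · ext k l
      simp only [Matrix.transpose_apply, info, Matrix.of_apply, mul_comm]
    · filter_upwards [hbdd] with n hn k l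
      simp only [info, Matrix.of_apply, loss1_eq c ha]
      refine (integrable_finsetSum _ fun i _ => ?_).const_mul _
      refine integrable_of_ae_abs_le ?_ (hn.mono fun ω hω => hω.abs_info_summand_le i k l)
      exact (((hxk n i k).mul (hxk n i l)).const_mul (w n i ^ 2)).mul
        (((hd a n i).sub (hy n i)).pow_const 2)
  refine ⟨hy, hx, ha, hn₀.differentiable_deriv, hn₀.convex, abs_nonneg _, hL₀.le, hη,
    hreg.mono fun n hn => hn.indep, hbdd, ?_, hHlim, hIlim,
    hHpsd.posDef_iff_isUnit.2 ((Matrix.isUnit_iff_isUnit_det _).2 hHdet),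
    hIpsd.posDef_iff_isUnit.2 ((Matrix.isUnit_iff_isUnit_det _).2 hIdet)⟩
  filter_upwards [hbdd] with n hn i k
  refine (hdens n i).integral_score_eq_zero hglm ha (hx n i) (hy n i)
    (φ := fun v => -(w n i * v k)) (by fun_prop) ?_
  refine integrable_of_ae_abs_le ?_ (hn.mono fun ω hω => hω.abs_score_summand_le i k)
  exact ((hxk n i k).const_mul _).neg.mul ((hd a n i).sub (hy n i))

end Regularity

end SurveyLasso

open SurveyLasso in
theorem proposition1 {Ω : Type*} [MeasurableSpace Ω] (P : Measure Ω) [IsProbabilityMeasure P]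
    {p : ℕ}
    -- the generalized linear model and the true parameter
    (ν : Measure ℝ) [SigmaFinite ν] (Y : Set ℝ) (a c : ℝ → ℝ) (hglm : IsGLM ν Y a c)
    (θ₀ : Fin (p + 1) → ℝ)
    -- the triangular array of observations and deterministic survey weights
    (y : (n : ℕ) → Fin n → Ω → ℝ) (x : (n : ℕ) → Fin n → Ω → Fin (p + 1) → ℝ)
    (w : (n : ℕ) → Fin n → ℝ)
    (hy : ∀ n i, Measurable (y n i)) (hx : ∀ n i, Measurable (x n i))
    (hx0 : ∀ n i ω, x n i ω 0 = 1)
    (hdens : ∀ n i, HasGLMDensity P ν a c θ₀ (x n i) (y n i))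
    -- regularity conditions, with constants that do not depend on `n`
    (Cl Cu lmin lmax L₀ η : ℝ) (hCl : 0 < Cl) (hlmin : 0 < lmin) (hL₀ : 0 < L₀) (hη : 0 < η)
    (hreg : ∀ᶠ n in atTop, Regular P Y a c θ₀ (y n) (x n) (w n) Cl Cu lmin lmax L₀ η)
    -- the penalty level `λ = C n^{-1/2}`
    (C : ℕ → ℝ) (Clow Chigh : ℝ) (hClow : 0 < Clow)
    (hC : ∀ᶠ n in atTop, Clow ≤ C n ∧ C n ≤ Chigh)
    -- the expected Hessian and information matrices converge to nonsingular limits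
    (Hlim Ilim : Matrix (Fin (p + 1)) (Fin (p + 1)) ℝ)
    (hHlim : Tendsto (fun n => meanMatrix P fun ω => hess a c (sampleAt (y n) (x n) (w n) ω) θ₀)
      atTop (𝓝 Hlim))
    (hIlim : Tendsto (fun n => meanMatrix P fun ω => info a c (sampleAt (y n) (x n) (w n) ω) θ₀)
      atTop (𝓝 Ilim))
    (hHdet : IsUnit Hlim.det) (hIdet : IsUnit Ilim.det)
    -- the Lasso estimator: almost surely a minimizer whenever there is one
    (θhat : (n : ℕ) → Ω → Fin (p + 1) → ℝ) (hθmeas : ∀ n, Measurable (θhat n))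
    (hθ : ∀ n, ∀ᵐ ω ∂P, (∃ θ, IsLasso a c (sampleAt (y n) (x n) (w n) ω) (C n / Real.sqrt n) θ) →
      IsLasso a c (sampleAt (y n) (x n) (w n) ω) (C n / Real.sqrt n) (θhat n ω))
    -- the model and the signs that are conditioned on
    (M : Finset (Fin (p + 1))) (hM0 : 0 ∈ M) (hM : ∀ k, θ₀ k ≠ 0 → k ∈ M)
    (s : Slope M → ℝ) (hs : ∀ k, s k = 1 ∨ s k = -1)
    (hs₀ : ∀ k : Slope M, θ₀ k.1 ≠ 0 → s k = Real.sign (θ₀ k.1))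
    (j : Slope M) (ζ : ℝ) (hζ : ζ ∈ Set.Ioo (0 : ℝ) 1) :
    liminf (fun n : ℕ =>
      (P[|{ω | activeSet (θhat n ω) = M ∧ ∀ k : Slope M, Real.sign (θhat n ω k.1) = s k}]).real
        {ω | θ₀ j.1 ∈ selectiveCI a c (sampleAt (y n) (x n) (w n) ω) (C n / Real.sqrt n)
          (θhat n ω) ζ j.1}) atTop = 1 - ζ := by
  have h := regularArray_of_regular hglm hy hx hdens hCl hL₀ hη hreg hHlim hIlim hHdet hIdet
  have hl : IsLassoSeq P a c y x w C Clow Chigh θhat := ⟨hClow, hC, hθmeas, hθ⟩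
  exact (h.tendsto_coverage hl hM0 hM hs hs₀ j hζ).liminf_eq
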